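/- Conventions. Let $\mathbb{R}$ be the ordered field of real numbers in the language $\{0,1,+,\cdot,<\}$. $HF(\mathbb{R})$ is the structure whose universe is $\bigcup_n HF_n$, where $HF_0=\emptyset$ and $HF_{n+1}$ is the set of all finite subsets of $\mathbb{R}\cup HF_n$; its relations are membership and, for each relation $\sigma$ (or graph of an operation or constant) of $\mathbb{R}$, the relation $\sigma^*$ which holds exactly of the tuples $(\{x_0\},\{x_1\},\dots)$ with $\sigma(x_0,x_1,\dots)$. $\Delta_0$-formulas are built from atomic formulas by propositional connectives and bounded quantifiers $\exists x\in t$, $\forall x\in t$; $\Sigma$-formulas form the least class containing the $\Delta_0$-formulas and closed under $\wedge$, $\vee$, bounded quantifiers and $\exists x$. Let $\mathcal{N}=(N,P_0,P_1,\dots)$ be a nonempty structure in a finite or countable relational language. $\mathcal{N}$ is *$\Sigma$-definable over $HF(\mathbb{R})$* if there are $\Sigma$-formulas $\Psi_0,\Psi_1,\Psi_1^*$ and $\Phi_i,\Phi_i^*$ (one pair for each $P_i$), using altogether finitely many parameters from $HF(\mathbb{R})$, such that $\Psi_0$ defines a nonempty set $D\subseteq HF(\mathbb{R})$; $\Psi_1$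 defines a congruence relation on $(D,\Phi_0,\Phi_1,\dots)$; $\Psi_1^*$ defines the complement of $\Psi_1$ relative to $D^2$; each $\Phi_i^*$ defines the complement of $\Phi_i$ relative to $D^{k_i}$, where $k_i$ is the arity of $P_i$; and $\mathcal{N}\cong(D,\Phi_0,\Phi_1,\dots)/\Psi_1$. A set $S\subseteq\mathbb{R}^\infty=\bigcup_n\mathbb{R}^n$ is *$\mathbb{R}$-computable* if its characteristic function is computed by a Blum–Shub–Smale machine over $\mathbb{R}$ (with finitely many real constants). $\mathcal{N}$ *has an $\mathbb{R}$-computable isomorphic copy* if it is isomorphic to a structure whose elements are named by the members of a set $D\subseteq\mathbb{R}^\infty$ (several names may name the same element) and whose atomic diagram, that is, the set of all true sentences $a=b$ and $P_i(a_1,\dots,a_{k_i})$ with names $a,b,a_j\in D$, is $\mathbb{R}$-computable; a sentence is coded in $\mathbb{R}^\infty$ by the number of its predicate symbol followed by its names, each preceded by its length. Theorem. Every structure $\Sigma$-definable over $HF(\mathbb{R})$ has an isomorphic copy which is $\mathbb{R}$-computable. Conversely, every nonempty structure with an $\mathbb{R}$-computable isomorphic copy is $\Sigma$-definable over $HF(\mathbb{R})$.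 Hence the structures with $\mathbb{R}$-computable copies are exactly the structures with copies $\Sigma$-definable over $HF(\mathbb{R})$. -/

import Mathlib

open FirstOrder FirstOrder.Language

universe u v w u' v' w'

/-! ### The structure of hereditarily finite sets over a structure -/

namespace HFSets

variable {M : Type u}

theorem listsMem_iff_of_equiv {a a' l l' : Lists M} (ha : a ≈ a') (hl : l ≈ l') :
    Lists.mem a l ↔ Lists.mem a' l' := by
  rcases hl with _ | ⟨h₁, h₂⟩
  · obtain ⟨b, l⟩ := l
    cases b
    · exact Iff.rfl
    · exact Lists'.mem_equiv_left ha
  · exact ⟨fun h => (Lists'.mem_equiv_left ha).1 (Lists'.mem_of_subset h₁ h),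
      fun h => Lists'.mem_of_subset h₂ ((Lists'.mem_equiv_left ha).2 h)⟩

/-- Membership between finite sets with atoms in `M` (`Finsets M` is the type of all atoms `x : M`
and of all hereditarily finite sets over these atoms; an atom has no members). -/
def Mem (a b : Finsets M) : Prop :=
  Quotient.liftOn₂ a b Lists.mem
    (fun _ _ _ _ ha hl => propext (listsMem_iff_of_equiv ha hl))

/-- The atom of `Finsets M` given by an element of `M`. -/
def atom (x : M) : Finsets M := Quotient.mk _ (Lists.atom x)

/-- The singleton `{x}` of an element `x` of `M`. -/
def singletonAtom (x : M) : Finsets M :=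
  Quotient.mk _ (Lists.of' (Lists'.cons (Lists.atom x) Lists'.nil))

/-- `a` is a set, not an atom. -/
def IsSet (a : Finsets M) : Prop := ∀ x : M, a ≠ atom x

theorem isSet_of' (l : Lists' M true) : IsSet (Quotient.mk _ (Lists.of' l) : Finsets M) := by
  intro x h
  have h' := (Lists.equiv_atom (a := x) (l := Lists.of' l)).1 (Quotient.exact h.symm)
  cases h'

theorem isSet_singletonAtom (x : M) : IsSet (singletonAtom x) := isSet_of' _

/-- The chain `HF₀(M) = ∅`, `HFₙ₊₁(M)` = the set of all finite subsets of `M ∪ HFₙ(M)`. -/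
def level (M : Type u) : ℕ → Set (Finsets M)
  | 0 => ∅
  | n + 1 => {a | IsSet a ∧ ∀ b, Mem b a → (∃ x, b = atom x) ∨ b ∈ level M n}

theorem level_mono_succ (n : ℕ) : level M n ⊆ level M (n + 1) := by
  induction n with
  | zero => exact Set.empty_subset _
  | succ k ih => exact fun a ha => ⟨ha.1, fun b hb => (ha.2 b hb).imp_right (fun h => ih h)⟩

theorem level_mono {m n : ℕ} (h : m ≤ n) : level M m ⊆ level M n :=
  monotone_nat_of_le_succ (f := level M) (fun k => level_mono_succ k) h

/-- The union of the chain `HFₙ(M)` consists of all sets. -/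
theorem mem_iUnion_level (a : Finsets M) : a ∈ ⋃ n, level M n ↔ IsSet a := by
  constructor
  · intro h
    obtain ⟨n, hn⟩ := Set.mem_iUnion.1 h
    cases n with
    | zero => exact hn.elim
    | succ n => exact hn.1
  · intro h
    have key := Lists.inductionMut (α := M)
      (fun l => PLift ((∃ x, (Quotient.mk _ l : Finsets M) = atom x) ∨
        ∃ n, (Quotient.mk _ l : Finsets M) ∈ level M n))
      (fun l => PLift (∃ n, (Quotient.mk _ (Lists.of' l) : Finsets M) ∈ level M n))
      (fun x => ⟨Or.inl ⟨x, rfl⟩⟩) (fun l hl => ⟨Or.inr hl.down⟩)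
      ⟨⟨1, isSet_of' _, by
        intro b
        induction b using Quotient.inductionOn with
        | h b => rintro ⟨c, hc, -⟩; cases hc⟩⟩
      (fun c l hc hl => ⟨by
        obtain ⟨n, hn⟩ := hl.down
        have hc' : ∃ m, (∃ x, (Quotient.mk _ c : Finsets M) = atom x) ∨
            (Quotient.mk _ c : Finsets M) ∈ level M m := by
          rcases hc.down with h | ⟨m, h⟩
          · exact ⟨0, Or.inl h⟩
          · exact ⟨m, Or.inr h⟩
        obtain ⟨m, hm⟩ := hc'
        refine ⟨max m n + 1, isSet_of' _, ?_⟩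
        intro b
        induction b using Quotient.inductionOn with
        | h b =>
          intro hb
          rcases Lists'.mem_cons.1 hb with h | h
          · have e : (Quotient.mk _ b : Finsets M) = Quotient.mk _ c := Quotient.sound h
            rw [e]
            exact hm.imp_right (fun h => level_mono (le_max_left _ _) h)
          · have h2 := level_mono_succ (M := M) n hn
            exact (h2.2 (Quotient.mk _ b) h).imp_right
              (fun h => level_mono (le_max_right _ _) h)⟩)
    induction a using Quotient.inductionOn with
    | h l =>
      rcases (key.1 l).down with ⟨x, hx⟩ | hn
      · exact (h x hx).elim
      · exact Set.mem_iUnion.2 hn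

/-- The universe of `HF(M)`: the hereditarily finite sets over `M`. The elements of `M` occur as
members of these sets, but do not themselves belong to the universe. -/
def HF (M : Type u) : Type u := {a : Finsets M // IsSet a}

/-- The relation symbols of the language of `HF(M)`: membership, a copy of every relation symbol
of `L`, and for every function (or constant) symbol of `L` a symbol for its graph. -/
inductive HFRel (L : FirstOrder.Language.{v, w}) : ℕ → Type (max v w)
  | mem : HFRel L 2
  | rel {n : ℕ} (R : L.Relations n) : HFRel L n
  | graph {n : ℕ} (f : L.Functions n) : HFRel L (n + 1)

/-- The (relational) language of `HF(M)`, for an `L`-structure `M`. -/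
abbrev hfLang (L : FirstOrder.Language.{v, w}) : FirstOrder.Language.{0, max v w} := ⟨fun _ => Empty, HFRel L⟩

/-- `HF(M)` as a structure: a symbol `σ` of `L` holds of `({x₀}, {x₁}, …)` if and only if `σ` holds
of `(x₀, x₁, …)` in `M`, and it holds of no other tuples of sets. -/
instance hfStructure (L : FirstOrder.Language.{v, w}) [L.Structure M] : (hfLang L).Structure (HF M) where
  funMap f := Empty.elim f
  RelMap {_} R :=
    match R with
    | .mem => fun a => Mem (a 0).1 (a 1).1
    | .rel R => fun a => ∃ x, (∀ i, (a i).1 = singletonAtom (x i)) ∧ Structure.RelMap R x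
    | .graph f => fun a => ∃ x, (∀ i, (a i).1 = singletonAtom (x i)) ∧
        Structure.funMap f (Fin.init x) = x (Fin.last _)

/-! ### Σ-formulas -/

variable {L : FirstOrder.Language.{v, w}} {α : Type}

/-- The symbol `∈` of the language of `HF(M)`. -/
def memSymb : (hfLang L).Relations 2 := HFRel.mem

/-- The formula `x ∈ t`, for a new variable `x` (numbered `n`). -/
def newMem {n : ℕ} (t : (hfLang L).Term (α ⊕ Fin n)) : (hfLang L).BoundedFormula α (n + 1) :=
  Relations.boundedFormula₂ memSymb
    (Term.var (Sum.inr (Fin.last n))) (t.relabel (Sum.map id Fin.castSucc))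

/-- `∃ x ∈ t, φ`. -/
def exMem {n : ℕ} (t : (hfLang L).Term (α ⊕ Fin n)) (φ : (hfLang L).BoundedFormula α (n + 1)) :
    (hfLang L).BoundedFormula α n := ∃' (newMem t ⊓ φ)

/-- `∀ x ∈ t, φ`. -/
def allMem {n : ℕ} (t : (hfLang L).Term (α ⊕ Fin n)) (φ : (hfLang L).BoundedFormula α (n + 1)) :
    (hfLang L).BoundedFormula α n := ∀' (newMem t ⟹ φ)

/-- The `Δ₀`-formulas: built from atomic formulas with propositional connectives and bounded
quantifiers. -/
inductive IsDelta0 : ∀ {n : ℕ}, (hfLang L).BoundedFormula α n → Prop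
  | atomic {n : ℕ} {φ : (hfLang L).BoundedFormula α n} : φ.IsAtomic → IsDelta0 φ
  | falsum {n : ℕ} : IsDelta0 (⊥ : (hfLang L).BoundedFormula α n)
  | imp {n : ℕ} {φ ψ : (hfLang L).BoundedFormula α n} :
      IsDelta0 φ → IsDelta0 ψ → IsDelta0 (φ ⟹ ψ)
  | and {n : ℕ} {φ ψ : (hfLang L).BoundedFormula α n} :
      IsDelta0 φ → IsDelta0 ψ → IsDelta0 (φ ⊓ ψ)
  | or {n : ℕ} {φ ψ : (hfLang L).BoundedFormula α n} :
      IsDelta0 φ → IsDelta0 ψ → IsDelta0 (φ ⊔ ψ)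
  | exMem {n : ℕ} (t : (hfLang L).Term (α ⊕ Fin n))
      {φ : (hfLang L).BoundedFormula α (n + 1)} : IsDelta0 φ → IsDelta0 (exMem t φ)
  | allMem {n : ℕ} (t : (hfLang L).Term (α ⊕ Fin n))
      {φ : (hfLang L).BoundedFormula α (n + 1)} : IsDelta0 φ → IsDelta0 (allMem t φ)

/-- The `Σ`-formulas: the least class that contains the `Δ₀`-formulas and is closed under
conjunction, disjunction, bounded quantifiers and existential quantifiers. -/
inductive IsSigma : ∀ {n : ℕ}, (hfLang L).BoundedFormula α n → Prop
  | delta0 {n : ℕ} {φ : (hfLang L).BoundedFormula α n} : IsDelta0 φ → IsSigma φ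
  | and {n : ℕ} {φ ψ : (hfLang L).BoundedFormula α n} :
      IsSigma φ → IsSigma ψ → IsSigma (φ ⊓ ψ)
  | or {n : ℕ} {φ ψ : (hfLang L).BoundedFormula α n} :
      IsSigma φ → IsSigma ψ → IsSigma (φ ⊔ ψ)
  | exMem {n : ℕ} (t : (hfLang L).Term (α ⊕ Fin n))
      {φ : (hfLang L).BoundedFormula α (n + 1)} : IsSigma φ → IsSigma (exMem t φ)
  | allMem {n : ℕ} (t : (hfLang L).Term (α ⊕ Fin n))
      {φ : (hfLang L).BoundedFormula α (n + 1)} : IsSigma φ → IsSigma (allMem t φ)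
  | ex {n : ℕ} {φ : (hfLang L).BoundedFormula α (n + 1)} : IsSigma φ → IsSigma (∃' φ)

/-- `Σ`-formulas in `m` parameter variables and `k` further free variables. -/
def SigmaFormula (L : FirstOrder.Language.{v, w}) (m k : ℕ) : Type (max v w) :=
  {φ : (hfLang L).Formula (Fin m ⊕ Fin k) // IsSigma φ}

/-- The `k`-ary relation on `HF(M)` defined by a `Σ`-formula with the parameters `p`. -/
def SigmaFormula.defSet [L.Structure M] {m k : ℕ} (φ : SigmaFormula L m k) (p : Fin m → HF M) :
    Set (Fin k → HF M) := {x | φ.1.Realize (Sum.elim p x)}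

/-- The structure `N`, in a relational language `L'`, is `Σ`-definable (with finitely many
parameters) over `HF(M)`, where `M` is an `L`-structure: it is isomorphic to the quotient of
`(Ψ₀, Φ_R : R ∈ L')` by a congruence relation `Ψ₁`, where `Ψ₀`, `Ψ₁`, all the `Φ_R`, and the
relative complements of `Ψ₁` and of all the `Φ_R`, are defined by `Σ`-formulas. -/
def SigmaDefinable (L : FirstOrder.Language.{v, w}) (M : Type u) [L.Structure M]
    (L' : FirstOrder.Language.{v', w'}) [L'.IsRelational] (N : Type u') [L'.Structure N] : Prop :=
  ∃ (m : ℕ) (p : Fin m → HF M) (Ψ₀ : SigmaFormula L m 1) (Ψ₁ Ψ₁' : SigmaFormula L m 2)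
    (Φ Φ' : ∀ k : ℕ, L'.Relations k → SigmaFormula L m k) (D : Set (HF M)),
    D = {a | (fun _ => a) ∈ Ψ₀.defSet p} ∧ D.Nonempty ∧
    Ψ₁'.defSet p = {x | ∀ i, x i ∈ D} \ Ψ₁.defSet p ∧
    (∀ (k : ℕ) (R : L'.Relations k),
      (Φ' k R).defSet p = {x | ∀ i, x i ∈ D} \ (Φ k R).defSet p) ∧
    ∃ (s : Setoid D) (P : L'.Prestructure s),
      (∀ a b : D, s a b ↔ ![a.1, b.1] ∈ Ψ₁.defSet p) ∧
      (∀ (k : ℕ) (R : L'.Relations k) (x : Fin k → D),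
        P.toStructure.RelMap R x ↔ (fun i => (x i).1) ∈ (Φ k R).defSet p) ∧
      Nonempty (N ≃[L'] Quotient s)

end HFSets

/-! ### The ordered field of real numbers as a structure -/

/-- The function and constant symbols `0`, `1`, `+`, `·` of ordered fields. -/
inductive OrdFieldFun : ℕ → Type
  | zero : OrdFieldFun 0
  | one : OrdFieldFun 0
  | add : OrdFieldFun 2
  | mul : OrdFieldFun 2

/-- The relation symbol `<` of ordered fields. -/
inductive OrdFieldRel : ℕ → Type
  | lt : OrdFieldRel 2

/-- The language `{0, 1, +, ·, <}` of ordered fields. -/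
abbrev ordFieldLang : FirstOrder.Language.{0, 0} := ⟨OrdFieldFun, OrdFieldRel⟩

/-- The ordered field of real numbers. -/
noncomputable instance realOrdField : ordFieldLang.Structure ℝ where
  funMap {_} f :=
    match f with
    | .zero => fun _ => 0
    | .one => fun _ => 1
    | .add => fun x => x 0 + x 1
    | .mul => fun x => x 0 * x 1
  RelMap {_} R :=
    match R with
    | .lt => fun x => x 0 < x 1

/-! ### Blum–Shub–Smale machines over the real numbers -/

namespace BSS

/-- The state space `ℝ_∞`, the bi-infinite direct sum of copies of `ℝ` indexed by `ℤ`. -/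
abbrev Tape : Type := ℤ →₀ ℝ

/-- The input map: `(x₁, …, xₙ)` is written at the places `1, …, n`, and its length is
recorded in unary, by ones at the `n` places `0, -1, …, 1 - n`. All other places are `0`. -/
noncomputable def inputTape (z : List ℝ) : Tape :=
  Finsupp.onFinset (Finset.Ioc (-(z.length : ℤ)) z.length)
    (fun i => if 0 < i then z.getD (i - 1).toNat 0 else if -(z.length : ℤ) < i then 1 else 0)
    (by
      intro i hi
      rw [Finset.mem_Ioc]
      split_ifs at hi with h1 h2
      · refine ⟨by omega, ?_⟩
        by_contra h
        exact hi (List.getD_eq_default _ _ (by omega))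
      · omega
      · exact (hi rfl).elim)

/-- The output map: if exactly `n` consecutive places `0, -1, …, 1 - n` (from `0` downwards) hold
ones, then the output is `(x₁, …, xₙ)`. -/
noncomputable def outputTape (x : Tape) : List ℝ :=
  List.ofFn fun i : Fin (sInf {k : ℕ | x (-(k : ℤ)) ≠ 1}) => x ((i : ℤ) + 1)

/-- The left shift, `(σ_l x)ᵢ = xᵢ₊₁`. -/
noncomputable def shiftL (x : Tape) : Tape := Finsupp.equivMapDomain (Equiv.subRight 1) x

/-- The right shift, `(σ_r x)ᵢ = xᵢ₋₁`. -/
noncomputable def shiftR (x : Tape) : Tape := Finsupp.equivMapDomain (Equiv.addRight 1) x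

theorem shiftL_apply (x : Tape) (i : ℤ) : shiftL x i = x (i + 1) := rfl

theorem shiftR_apply (x : Tape) (i : ℤ) : shiftR x i = x (i - 1) := by
  simp [shiftR, Finsupp.equivMapDomain_apply, sub_eq_add_neg]

/-- The rational map `ℝ_∞ → ℝ_∞` that changes the finitely many places `i ∈ S`, where it writes the
value of the rational function `num i / den i` of the old entries. -/
noncomputable def ratMap (S : Finset ℤ) (num den : ℤ → MvPolynomial ℤ ℝ) (x : Tape) : Tape :=
  Finsupp.onFinset (x.support ∪ S)
    (fun i => if i ∈ S then MvPolynomial.eval x (num i) / MvPolynomial.eval x (den i) else x i)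
    (by
      intro i hi
      rw [Finset.mem_union]
      split_ifs at hi with h
      · exact Or.inr h
      · exact Or.inl (Finsupp.mem_support_iff.2 hi))

/-- A node (other than the input node) of a machine with set of nodes `Q`, together with the nodes
to which its outgoing edges lead. -/
inductive Node (Q : Type) : Type
  | computation (S : Finset ℤ) (num den : ℤ → MvPolynomial ℤ ℝ) (next : Q)
  | branch (h : MvPolynomial ℤ ℝ) (next₀ next₁ : Q)
  | shiftLeft (next : Q)
  | shiftRight (next : Q)
  | output

/-- A Blum–Shub–Smale machine over `ℝ`: a finite directed graph of nodes. The input node is not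
listed: it has no incoming edge, applies the input map, and its only outgoing edge leads to
`start`. -/
structure Machine where
  /-- The nodes other than the input node. -/
  Q : Type
  /-- There are finitely many nodes. -/
  finite : Finite Q
  /-- The node that follows the input node. -/
  start : Q
  /-- The kind and the outgoing edges of each node. -/
  node : Q → Node Q

/-- One step of a computation, from the node and the tape in `c` to those in `c'`. A computation
node whose denominators vanish at the current tape has no successor. -/
def Machine.Step (T : Machine) (c c' : T.Q × Tape) : Prop :=
  match T.node c.1 with
  | .computation S num den next =>
      (∀ i ∈ S, MvPolynomial.eval c.2 (den i) ≠ 0) ∧ c' = (next, ratMap S num den c.2)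
  | .branch h next₀ next₁ =>
      (0 ≤ MvPolynomial.eval c.2 h ∧ c' = (next₁, c.2)) ∨
      (MvPolynomial.eval c.2 h < 0 ∧ c' = (next₀, c.2))
  | .shiftLeft next => c' = (next, shiftL c.2)
  | .shiftRight next => c' = (next, shiftR c.2)
  | .output => False

/-- `φ_T(z) = y`: the computation of `T` on the input `z` reaches an output node, with output
`y`. -/
def Machine.Computes (T : Machine) (z y : List ℝ) : Prop :=
  ∃ c : T.Q × Tape, Relation.ReflTransGen T.Step (T.start, inputTape z) c ∧
    T.node c.1 = Node.output ∧ y = outputTape c.2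

/-- A set of finite sequences of real numbers is `ℝ`-computable if its characteristic function is
computed by a machine. -/
def RComputableSet (S : Set (List ℝ)) : Prop :=
  ∃ T : Machine, ∀ z : List ℝ, (z ∈ S → T.Computes z [1]) ∧ (z ∉ S → T.Computes z [0])

/-! ### `ℝ`-computable structures -/

/-- The code in `ℝ^∞` of the atomic sentence formed by the symbol number `c` and the names `as`
(finite sequences of real numbers): the number `c`, followed by the names, each of them preceded by
its length. -/
def atomCode (c : ℕ) (as : List (List ℝ)) : List ℝ :=
  (c : ℝ) :: as.flatMap fun a => (a.length : ℝ) :: a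

/-- The atomic diagram of a structure whose elements are named by the members of `D ⊆ ℝ^∞`: the set
of (the codes of) all atomic sentences `a = b` and `R(a₁, …, aₖ)` that hold in it. Here `s` is the
interpretation of equality between names; it has the symbol number `0`. -/
def atomicDiagram {L' : FirstOrder.Language.{v, w}} [Encodable (Σ k, L'.Relations k)] (D : Set (List ℝ))
    (s : Setoid D) (P : L'.Prestructure s) : Set (List ℝ) :=
  {l | ∃ a b : D, s a b ∧ l = atomCode 0 [a.1, b.1]} ∪
  {l | ∃ (k : ℕ) (R : L'.Relations k) (x : Fin k → D), P.toStructure.RelMap R x ∧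
    l = atomCode (Encodable.encode (⟨k, R⟩ : Σ k, L'.Relations k) + 1)
      (List.ofFn fun i => (x i).1)}

/-- The structure `N`, in a relational language, has an isomorphic copy that is `ℝ`-computable: a
structure whose elements are named by the members of a set `D ⊆ ℝ^∞` and whose atomic diagram,
equality between names included, is an `ℝ`-computable set. -/
def HasRComputableCopy (L' : FirstOrder.Language.{v, w}) [L'.IsRelational] [Encodable (Σ k, L'.Relations k)]
    (N : Type u') [L'.Structure N] : Prop :=
  ∃ (D : Set (List ℝ)) (s : Setoid D) (P : L'.Prestructure s),
    RComputableSet (atomicDiagram D s P) ∧ Nonempty (N ≃[L'] Quotient s)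

end BSS

/-! ### Matching the positions of points relative to finite sets -/

/-! Effectiveness plays almost no role: a real constant of a machine can carry any countable amount
of information, so computability over `ℝ` reduces to a topological condition.

From Σ-definability to computability. Give the space of valuations `ℕ → ℝ` the topology generated by
the sets `{p ≥ 0}`, `p` a polynomial with integer coefficients. It has a countable base and also
contains `{p > 0}`, the union of the sets `{n p ≥ 1}`. Every element of `HF(ℝ)` is the value of a
finite term in real variables. For fixed terms, a Δ₀-formula defines a clopen set of valuations,
because the members of the value of a term are the values of its finitely many immediate subterms. A
Σ-formula defines an open set (`IsSigma.polyOpen`): the witness of an unbounded existential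
quantifier has some shape `t` in finitely many fresh variables, so the quantifier is a union, over
all `t`, of projections along finitely many coordinates. That projections of open sets are open
(`PolyOpen.exists_update`) is the algebraic core. It follows from the Cohen–Hörmander argument
`hasSignDiagram`: the order pattern of the zeros and signs of finitely many polynomials in `y`
depends only on the signs of finitely many polynomials in their coefficients.

Call a finite set of polynomial inequalities, with a prescribed length and a verdict, a correct test
for `A` if the verdict holds for all sequences that pass. If `A` and its complement are both open on
sequences of each length, every sequence passes some correct test. There are only countably many
tests, so all correct ones are written one after another into the digits of a single real constant,
and one fixed interpreter runs them until one is passed (`rComputableSet_of_lOpen`). Names for the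
elements of a Σ-definable set `D` are built from the same openness (`exists_naming`): a name
consists of a number for a term and for finitely many inequalities that force its value into `D`,
followed by the values of the variables. Names that are not of this kind denote a default element.
The formulas for the predicates and for their complements then make the atomic diagram and its
complement open.

From computability to Σ-definability. A halting computation is certified by a finite set of triples
(time, cell, content), each justified by the initial configuration or by triples one time unit
earlier. Since the set is finite, going back in time must end at time `0`, so every justified triple
is true (`of_justified`); conversely a finite window of cells suffices for finitely many steps
(`exists_certificate`). Existence of a certificate is a Σ-property: one existential quantifier over
`HF(ℝ)` and then quantifiers bounded by the certificate. Applied to both outputs of the machine that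
decides the atomic diagram, this gives formulas for all predicates and their complements. The domain
consists of the hereditarily finite sets that represent names, and representations of equal elements
are identified by the congruence. -/

/-- `y` lies relative to the points of `Z` as `y'` lies relative to their images under `e`. -/
def SamePosition (Z : Finset ℝ) (e : ℝ → ℝ) (y y' : ℝ) : Prop :=
  ∀ z ∈ Z, (z < y ↔ e z < y') ∧ (y < z ↔ y' < e z)

namespace SamePosition

variable {Z : Finset ℝ} {e : ℝ → ℝ} {y y' : ℝ}

theorem eq_of_mem (h : SamePosition Z e y y') (hy : y ∈ Z) : y' = e y := by
  have := h y hy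
  simp only [lt_irrefl, false_iff, not_lt] at this
  exact le_antisymm this.1 this.2

theorem refl_of_mem (he : StrictMonoOn e Z) (hy : y ∈ Z) : SamePosition Z e y (e y) :=
  fun _ hz => ⟨(he.lt_iff_lt hz hy).symm, (he.lt_iff_lt hy hz).symm⟩

theorem convex_left {x₁ x₂ x : ℝ} (h₁ : SamePosition Z e x₁ y') (h₂ : SamePosition Z e x₂ y')
    (hx₁ : x₁ ≤ x) (hx₂ : x ≤ x₂) : SamePosition Z e x y' := fun z hz =>
  ⟨⟨fun h => (h₂ z hz).1.1 (h.trans_le hx₂), fun h => ((h₁ z hz).1.2 h).trans_le hx₁⟩,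
    ⟨fun h => (h₁ z hz).2.1 (hx₁.trans_lt h), fun h => hx₂.trans_lt ((h₂ z hz).2.2 h)⟩⟩

theorem convex_right {x₁ x₂ x : ℝ} (h₁ : SamePosition Z e y x₁) (h₂ : SamePosition Z e y x₂)
    (hx₁ : x₁ ≤ x) (hx₂ : x ≤ x₂) : SamePosition Z e y x := fun z hz =>
  ⟨⟨fun h => ((h₁ z hz).1.1 h).trans_le hx₁, fun h => (h₂ z hz).1.2 (h.trans_le hx₂)⟩,
    ⟨fun h => hx₂.trans_lt ((h₂ z hz).2.1 h), fun h => (h₁ z hz).2.2 (hx₁.trans_lt h)⟩⟩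

theorem reflect (h : SamePosition Z e y y') :
    SamePosition (Z.image (fun x => -x)) (fun x => -e (-x)) (-y) (-y') := by
  intro z hz
  obtain ⟨x, hx, rfl⟩ := Finset.mem_image.1 hz
  have := h x hx
  simp only [neg_neg, neg_lt_neg_iff]
  exact ⟨this.2, this.1⟩

theorem exists_right (he : StrictMonoOn e Z) (y : ℝ) : ∃ y', SamePosition Z e y y' := by
  by_cases hy : y ∈ Z
  · exact ⟨e y, refl_of_mem he hy⟩
  · obtain ⟨m, h₁, h₂⟩ := Order.exists_between_finsets ((Z.filter (· < y)).image e)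
      ((Z.filter (y < ·)).image e) (by
        intro a ha b hb
        simp only [Finset.mem_image, Finset.mem_filter] at ha hb
        obtain ⟨a, ⟨ha, ha'⟩, rfl⟩ := ha
        obtain ⟨b, ⟨hb, hb'⟩, rfl⟩ := hb
        exact he ha hb (ha'.trans hb'))
    replace h₁ : ∀ z ∈ Z, z < y → e z < m := fun z hz h =>
      h₁ _ (Finset.mem_image_of_mem _ (Finset.mem_filter.2 ⟨hz, h⟩))
    replace h₂ : ∀ z ∈ Z, y < z → m < e z := fun z hz h =>
      h₂ _ (Finset.mem_image_of_mem _ (Finset.mem_filter.2 ⟨hz, h⟩))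
    refine ⟨m, fun z hz => ?_⟩
    rcases lt_trichotomy z y with h | h | h
    · have := h₁ z hz h
      exact ⟨iff_of_true h this, iff_of_false h.not_gt this.not_gt⟩
    · exact absurd (h ▸ hz) hy
    · have := h₂ z hz h
      exact ⟨iff_of_false h.not_gt this.not_gt, iff_of_true h this⟩

theorem _root_.StrictMonoOn.reflect (he : StrictMonoOn e Z) :
    StrictMonoOn (fun x => -e (-x)) (Z.image (fun x => -x) : Finset ℝ) := by
  intro a ha b hb hab
  obtain ⟨a, ha', rfl⟩ := Finset.mem_image.1 (Finset.mem_coe.1 ha)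
  obtain ⟨b, hb', rfl⟩ := Finset.mem_image.1 (Finset.mem_coe.1 hb)
  simpa using he hb' ha' (neg_lt_neg_iff.1 hab)

/-- The part of a gap of `Z` to the left of a point, and the corresponding part of the gap of
`e '' Z`. -/
theorem left_end (he : StrictMonoOn e Z) (h : SamePosition Z e y y') (hy : y ∉ Z) :
    (∃ z ∈ Z, z < y ∧ e z < y' ∧ (∀ x, z < x → x ≤ y → SamePosition Z e x y') ∧
      ∀ x', e z < x' → x' ≤ y' → SamePosition Z e y x') ∨
    ((∀ x ≤ y, SamePosition Z e x y') ∧ ∀ x' ≤ y', SamePosition Z e y x') := by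
  have hne : ∀ w ∈ Z, w < y ∨ y < w := fun w hw =>
    lt_or_gt_of_ne (fun h' => hy (h' ▸ hw))
  by_cases hZ : (Z.filter (· < y)).Nonempty
  · left
    obtain ⟨z, hz, hmax⟩ := Finset.exists_max_image _ id hZ
    simp only [Finset.mem_filter, id_eq, and_imp] at hz hmax
    refine ⟨z, hz.1, hz.2, (h z hz.1).1.1 hz.2, fun x hx hxy w hw => ?_, fun x hx hxy w hw => ?_⟩
    · rcases hne w hw with h' | h'
      · have h1 := (h w hw).1.1 h'
        have h2 := (hmax w hw h').trans_lt hx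
        exact ⟨iff_of_true (by assumption) (by assumption), iff_of_false (lt_asymm (by assumption)) (lt_asymm (by assumption))⟩
      · have h1 := (h w hw).2.1 h'
        have h2 := hxy.trans_lt h'
        exact ⟨iff_of_false (lt_asymm (by assumption)) (lt_asymm (by assumption)), iff_of_true (by assumption) (by assumption)⟩
    · rcases hne w hw with h' | h'
      · have h1 := ((he.le_iff_le hw hz.1).2 (hmax w hw h')).trans_lt hx
        exact ⟨iff_of_true (by assumption) (by assumption), iff_of_false (lt_asymm (by assumption)) (lt_asymm (by assumption))⟩
      · have h1 := hxy.trans_lt ((h w hw).2.1 h')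
        exact ⟨iff_of_false (lt_asymm (by assumption)) (lt_asymm (by assumption)), iff_of_true (by assumption) (by assumption)⟩
  · right
    have hgt : ∀ w ∈ Z, y < w := fun w hw => (hne w hw).resolve_left fun h' =>
      hZ ⟨w, Finset.mem_filter.2 ⟨hw, h'⟩⟩
    refine ⟨fun x hx w hw => ?_, fun x hx w hw => ?_⟩
    · have h1 := hgt w hw
      have h2 := (h w hw).2.1 h1
      have h3 := hx.trans_lt h1
      exact ⟨iff_of_false (lt_asymm (by assumption)) (lt_asymm (by assumption)), iff_of_true (by assumption) (by assumption)⟩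
    · have h1 := hgt w hw
      have h2 := hx.trans_lt ((h w hw).2.1 h1)
      exact ⟨iff_of_false (lt_asymm (by assumption)) (lt_asymm (by assumption)), iff_of_true (by assumption) (by assumption)⟩

end SamePosition

/-! ### Signs of two functions on corresponding gaps between finitely many points -/

/-- The derivatives of `f` and `g` have matching signs, and so have `f` and `g` themselves on `Z`
and in the limit `-∞`. -/
structure MatchLeft (Z : Finset ℝ) (e : ℝ → ℝ) (f g : ℝ → ℝ) : Prop where
  mono : StrictMonoOn e Z
  diff_left : Differentiable ℝ f
  diff_right : Differentiable ℝ g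
  deriv_pos_iff : ∀ y y', SamePosition Z e y y' → (0 < deriv f y ↔ 0 < deriv g y')
  sign_eq : ∀ z ∈ Z, SignType.sign (f z) = SignType.sign (g (e z))
  atBot : (Filter.Tendsto f Filter.atBot Filter.atTop ∧ Filter.Tendsto g Filter.atBot Filter.atTop) ∨
    (Filter.Tendsto f Filter.atBot Filter.atBot ∧ Filter.Tendsto g Filter.atBot Filter.atBot)

theorem strictMonoOn_Icc_of_deriv_pos {f : ℝ → ℝ} (hf : Differentiable ℝ f) {a b : ℝ}
    (h : ∀ x, a < x → x < b → 0 < deriv f x) : StrictMonoOn f (Set.Icc a b) :=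
  strictMonoOn_of_deriv_pos (convex_Icc a b) hf.continuous.continuousOn (by
    rw [interior_Icc]; exact fun x hx => h x hx.1 hx.2)

theorem strictMonoOn_Iic_of_deriv_pos {f : ℝ → ℝ} (hf : Differentiable ℝ f) {b : ℝ}
    (h : ∀ x, x < b → 0 < deriv f x) : StrictMonoOn f (Set.Iic b) :=
  strictMonoOn_of_deriv_pos (convex_Iic b) hf.continuous.continuousOn (by
    rw [interior_Iic]; exact fun x hx => h x hx)

theorem not_tendsto_atBot_atTop_of_strictMonoOn {f : ℝ → ℝ} {b : ℝ}
    (h : StrictMonoOn f (Set.Iic b)) : ¬ Filter.Tendsto f Filter.atBot Filter.atTop := by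
  intro ht
  obtain ⟨x, hx, hxb⟩ := ((ht.eventually_gt_atTop (f b)).and (Filter.eventually_le_atBot b)).exists
  exact absurd (h.monotoneOn hxb (le_refl b) hxb) (not_le.2 hx)

namespace MatchLeft

variable {Z : Finset ℝ} {e : ℝ → ℝ} {f g : ℝ → ℝ} {y y' : ℝ}

theorem deriv_left (H : MatchLeft Z e f g) (h : SamePosition Z e y y') (hd : 0 < deriv f y)
    {x : ℝ} (hx : SamePosition Z e x y') : 0 < deriv f x :=
  (H.deriv_pos_iff _ _ hx).2 ((H.deriv_pos_iff _ _ h).1 hd)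

theorem deriv_right (H : MatchLeft Z e f g) (hd : 0 < deriv f y)
    {x : ℝ} (hx : SamePosition Z e y x) : 0 < deriv g x :=
  (H.deriv_pos_iff _ _ hx).1 hd

/-- On the gap both functions increase. Positivity of `f` on the part left of `y` gives `f ≥ 0` at
the left end by continuity, so `g ≥ 0` at the corresponding end, and `g` increases strictly from
there to `y'`. If the gap is unbounded to the left, an increasing `f` must tend to `-∞` there, which
contradicts positivity. -/
theorem pos_right (H : MatchLeft Z e f g) (h : SamePosition Z e y y') (hy : y ∉ Z)
    (hd : 0 < deriv f y) (hpos : ∀ x ≤ y, SamePosition Z e x y' → 0 < f x) : 0 < g y' := by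
  rcases h.left_end H.mono hy with ⟨z, hz, hzy, hzy', h₁, h₂⟩ | ⟨h₁, h₂⟩
  · have hg := strictMonoOn_Icc_of_deriv_pos H.diff_right (a := e z) (b := y')
      fun x hx hx' => H.deriv_right hd (h₂ x hx hx'.le)
    have hfz : 0 ≤ f z := by
      refine ge_of_tendsto (x := nhdsWithin z (Set.Ioi z))
        ((H.diff_left.continuous.tendsto z).mono_left nhdsWithin_le_nhds) ?_
      filter_upwards [Ioc_mem_nhdsGT hzy] with x hx
      exact (hpos x hx.2 (h₁ x hx.1 hx.2)).le
    have hgz : 0 ≤ g (e z) := by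
      have := H.sign_eq z hz
      rcases hfz.lt_or_eq with hf | hf
      · rw [sign_pos hf, eq_comm, sign_eq_one_iff] at this
        exact this.le
      · rw [← hf, sign_zero, eq_comm, sign_eq_zero_iff] at this
        exact this.ge
    exact hgz.trans_lt (hg ⟨le_refl _, hzy'.le⟩ ⟨hzy'.le, le_refl _⟩ hzy')
  · have hf := strictMonoOn_Iic_of_deriv_pos H.diff_left (b := y)
      fun x hx => H.deriv_left h hd (h₁ x hx.le)
    rcases H.atBot with h' | h'
    · exact absurd h'.1 (not_tendsto_atBot_atTop_of_strictMonoOn hf)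
    · obtain ⟨x, hx, hxb⟩ := ((h'.1.eventually_lt_atBot 0).and
        (Filter.eventually_le_atBot y)).exists
      exact absurd (hpos x hxb (h₁ x hxb)) (not_lt.2 hx.le)

/-- Since `f` increases strictly, `f x ≤ 0` makes `f` strictly negative at the left end of the gap.
The sign carries over to `g`, and by continuity `g` is still negative just inside its own gap. In an
unbounded gap the limit `-∞` of `g` does the same. -/
theorem exists_neg_right (H : MatchLeft Z e f g) (h : SamePosition Z e y y') (hy : y ∉ Z)
    (hd : 0 < deriv f y) {x : ℝ} (hx : x ≤ y) (hxs : SamePosition Z e x y') (hfx : f x ≤ 0) :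
    ∃ x' ≤ y', SamePosition Z e y x' ∧ g x' < 0 := by
  rcases h.left_end H.mono hy with ⟨z, hz, hzy, hzy', h₁, h₂⟩ | ⟨h₁, h₂⟩
  · have hf := strictMonoOn_Icc_of_deriv_pos H.diff_left (a := z) (b := y)
      fun x hx hx' => H.deriv_left h hd (h₁ x hx hx'.le)
    have hzx : z < x := (hxs z hz).1.2 hzy'
    have hfz : f z < 0 := (hf ⟨le_refl _, hzy.le⟩ ⟨hzx.le, hx⟩ hzx).trans_le hfx
    have hgz : g (e z) < 0 := by
      have := H.sign_eq z hz
      rwa [sign_neg hfz, eq_comm, sign_eq_neg_one_iff] at this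
    obtain ⟨x', hx', hx''⟩ := ((((H.diff_right.continuous.tendsto (e z)).mono_left
      nhdsWithin_le_nhds).eventually_lt_const hgz).and (Ioc_mem_nhdsGT hzy')).exists
    exact ⟨x', hx''.2, h₂ x' hx''.1 hx''.2, hx'⟩
  · have hf := strictMonoOn_Iic_of_deriv_pos H.diff_left (b := y)
      fun x hx => H.deriv_left h hd (h₁ x hx.le)
    rcases H.atBot with h' | h'
    · exact absurd h'.1 (not_tendsto_atBot_atTop_of_strictMonoOn hf)
    · obtain ⟨x, hx, hxb⟩ := ((h'.2.eventually_lt_atBot 0).and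
        (Filter.eventually_le_atBot y')).exists
      exact ⟨x, hxb, h₂ x hxb, hx⟩

end MatchLeft

/-- As `MatchLeft`, but in both limits `±∞`. -/
structure MatchDeriv (Z : Finset ℝ) (e : ℝ → ℝ) (f g : ℝ → ℝ) : Prop extends
    MatchLeft Z e f g where
  atTop : (Filter.Tendsto f Filter.atTop Filter.atTop ∧ Filter.Tendsto g Filter.atTop Filter.atTop) ∨
    (Filter.Tendsto f Filter.atTop Filter.atBot ∧ Filter.Tendsto g Filter.atTop Filter.atBot)

/-- The substitution `f ↦ -f(-·)` exchanges the two ends of a gap and keeps the sign of the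
derivative, so every statement about left ends yields one about right ends. -/
theorem MatchDeriv.reflect {Z : Finset ℝ} {e : ℝ → ℝ} {f g : ℝ → ℝ} (H : MatchDeriv Z e f g) :
    MatchLeft (Z.image (fun x => -x)) (fun x => -e (-x)) (fun x => -f (-x)) (fun x => -g (-x)) where
  mono := H.mono.reflect
  diff_left := (H.diff_left.comp differentiable_neg).neg
  diff_right := (H.diff_right.comp differentiable_neg).neg
  deriv_pos_iff y y' h := by
    have := h.reflect
    simp only [neg_neg, Finset.image_image, Function.comp_def, Finset.image_id'] at this
    have := H.deriv_pos_iff _ _ this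
    simpa [deriv.fun_neg, deriv_comp_neg] using this
  sign_eq z hz := by
    obtain ⟨x, hx, rfl⟩ := Finset.mem_image.1 hz
    simp only [neg_neg, Left.sign_neg, H.sign_eq x hx]
  atBot := by
    rcases H.atTop with h | h
    · exact Or.inr ⟨Filter.tendsto_neg_atTop_atBot.comp (h.1.comp Filter.tendsto_neg_atBot_atTop),
        Filter.tendsto_neg_atTop_atBot.comp (h.2.comp Filter.tendsto_neg_atBot_atTop)⟩
    · exact Or.inl ⟨Filter.tendsto_neg_atBot_atTop.comp (h.1.comp Filter.tendsto_neg_atBot_atTop),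
        Filter.tendsto_neg_atBot_atTop.comp (h.2.comp Filter.tendsto_neg_atBot_atTop)⟩

theorem SamePosition.of_reflect {Z : Finset ℝ} {e : ℝ → ℝ} {y y' : ℝ}
    (h : SamePosition (Z.image (fun x => -x)) (fun x => -e (-x)) y y') :
    SamePosition Z e (-y) (-y') := by
  have := h.reflect
  simpa only [neg_neg, Finset.image_image, Function.comp_def, Finset.image_id'] using this

namespace MatchDeriv

variable {Z : Finset ℝ} {e : ℝ → ℝ} {f g : ℝ → ℝ} {y y' : ℝ}

theorem neg_right (H : MatchDeriv Z e f g) (h : SamePosition Z e y y') (hy : y ∉ Z)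
    (hd : 0 < deriv f y) (hneg : ∀ x, y ≤ x → SamePosition Z e x y' → f x < 0) : g y' < 0 := by
  have := H.reflect.pos_right h.reflect (by simpa using hy)
    (by simpa [deriv.fun_neg, deriv_comp_neg] using hd) (fun x hx hxs => by
      have := hneg (-x) (le_neg.1 hx) (by simpa using hxs.of_reflect)
      simpa using this)
  simpa using this

theorem exists_pos_right (H : MatchDeriv Z e f g) (h : SamePosition Z e y y') (hy : y ∉ Z)
    (hd : 0 < deriv f y) {x : ℝ} (hx : y ≤ x) (hxs : SamePosition Z e x y') (hfx : 0 ≤ f x) :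
    ∃ x', y' ≤ x' ∧ SamePosition Z e y x' ∧ 0 < g x' := by
  obtain ⟨x', h₁, h₂, h₃⟩ := H.reflect.exists_neg_right h.reflect (by simpa using hy)
    (by simpa [deriv.fun_neg, deriv_comp_neg] using hd) (x := -x) (neg_le_neg hx) hxs.reflect
    (by simpa using hfx)
  exact ⟨-x', le_neg.1 h₁, by simpa using h₂.of_reflect, by simpa using h₃⟩

/-- A zero of `f` in a gap is matched by a zero of `g` in the corresponding gap. -/
theorem exists_zero_of_pos (H : MatchDeriv Z e f g) (hy : y ∉ Z) (hd : 0 < deriv f y)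
    (h0 : f y = 0) : ∃ y', SamePosition Z e y y' ∧ g y' = 0 := by
  obtain ⟨y', h⟩ := SamePosition.exists_right H.mono y
  obtain ⟨a, ha, ha', hga⟩ := H.exists_neg_right h hy hd le_rfl h h0.le
  obtain ⟨b, hb, hb', hgb⟩ := H.exists_pos_right h hy hd le_rfl h h0.ge
  obtain ⟨c, hc, hgc⟩ := intermediate_value_Icc (ha.trans hb) H.diff_right.continuous.continuousOn
    ⟨hga.le, hgb.le⟩
  exact ⟨c, ha'.convex_right hb' hc.1 hc.2, hgc⟩

/-- If every zero `ζ` of `f` in a gap of `Z` is matched by a zero `e' ζ` of `g`, then the signs of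
`f` and `g` match. -/
theorem sign_eq_of_pos (H : MatchDeriv Z e f g) {e' : ℝ → ℝ}
    (hζ : ∀ ζ, ζ ∉ Z → f ζ = 0 → SamePosition Z e ζ (e' ζ) ∧ g (e' ζ) = 0)
    (h : SamePosition Z e y y') (hy : y ∉ Z) (hd : 0 < deriv f y)
    (hs : ∀ ζ, ζ ∉ Z → f ζ = 0 → (ζ < y ↔ e' ζ < y') ∧ (y < ζ ↔ y' < e' ζ)) :
    SignType.sign (f y) = SignType.sign (g y') := by
  have hnot : ∀ x, SamePosition Z e x y' → x ∉ Z := fun x hx hxZ => by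
    have h₁ := hx.eq_of_mem hxZ
    have h₂ := h x hxZ
    rw [← h₁] at h₂
    simp only [lt_irrefl, iff_false, not_lt] at h₂
    exact hy (le_antisymm h₂.1 h₂.2 ▸ hxZ)
  have hsame : ∀ ζ x', SamePosition Z e ζ y' → SamePosition Z e ζ x' → SamePosition Z e y x' :=
    fun ζ x' h₁ h₂ z hz => ⟨(h z hz).1.trans ((h₁ z hz).1.symm.trans (h₂ z hz).1),
      (h z hz).2.trans ((h₁ z hz).2.symm.trans (h₂ z hz).2)⟩
  rcases lt_trichotomy (f y) 0 with hf | hf | hf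
  · rw [sign_neg hf, eq_comm, sign_eq_neg_one_iff]
    -- Either `f` has a zero `ζ` further right in the gap, and monotonicity of `g` up to its zero
    -- `e' ζ` makes `g y'` negative; or `f` stays negative up to the right end, and the comparison
    -- of ends decides.
    by_cases hx : ∃ x, y ≤ x ∧ SamePosition Z e x y' ∧ 0 ≤ f x
    · obtain ⟨x, hyx, hxs, hfx⟩ := hx
      obtain ⟨ζ, hζI, hζ0⟩ := intermediate_value_Icc hyx H.diff_left.continuous.continuousOn
        ⟨hf.le, hfx⟩
      have hζs : SamePosition Z e ζ y' := h.convex_left hxs hζI.1 hζI.2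
      have hyζ : y < ζ := lt_of_le_of_ne hζI.1 (by rintro rfl; exact hf.ne hζ0)
      obtain ⟨h₁, h₂⟩ := hζ ζ (hnot ζ hζs) hζ0
      have h₃ := (hs ζ (hnot ζ hζs) hζ0).2.1 hyζ
      have hg := strictMonoOn_Icc_of_deriv_pos H.diff_right (a := y') (b := e' ζ) fun x hx hx' =>
        H.deriv_right hd (h.convex_right (hsame ζ _ hζs h₁) hx.le hx'.le)
      simpa [h₂] using hg ⟨le_refl _, h₃.le⟩ ⟨h₃.le, le_refl _⟩ h₃
    · push Not at hx
      exact H.neg_right h hy hd hx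
  · obtain ⟨h₁, h₂⟩ := hζ y hy hf
    have := hs y hy hf
    simp only [lt_irrefl, false_iff, not_lt] at this
    rw [hf, le_antisymm this.1 this.2, h₂]
  · rw [sign_pos hf, eq_comm, sign_eq_one_iff]
    by_cases hx : ∃ x, x ≤ y ∧ SamePosition Z e x y' ∧ f x ≤ 0
    · obtain ⟨x, hyx, hxs, hfx⟩ := hx
      obtain ⟨ζ, hζI, hζ0⟩ := intermediate_value_Icc hyx H.diff_left.continuous.continuousOn
        ⟨hfx, hf.le⟩
      have hζs : SamePosition Z e ζ y' := hxs.convex_left h hζI.1 hζI.2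
      have hyζ : ζ < y := lt_of_le_of_ne hζI.2 (by rintro rfl; exact hf.ne' hζ0)
      obtain ⟨h₁, h₂⟩ := hζ ζ (hnot ζ hζs) hζ0
      have h₃ := (hs ζ (hnot ζ hζs) hζ0).1.1 hyζ
      have hg := strictMonoOn_Icc_of_deriv_pos H.diff_right (a := e' ζ) (b := y') fun x hx hx' =>
        H.deriv_right hd ((hsame ζ _ hζs h₁).convex_right h hx.le hx'.le)
      simpa [h₂] using hg ⟨le_refl _, h₃.le⟩ ⟨h₃.le, le_refl _⟩ h₃
    · push Not at hx
      exact H.pos_right h hy hd hx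

end MatchDeriv

/-- Reduces gaps where the functions decrease to gaps where they increase. The extra hypothesis is
needed because `MatchLeft` records only where derivatives are positive. -/
theorem MatchDeriv.neg {Z : Finset ℝ} {e : ℝ → ℝ} {f g : ℝ → ℝ} (H : MatchDeriv Z e f g)
    (hd : ∀ y y', SamePosition Z e y y' → (deriv f y < 0 ↔ deriv g y' < 0)) :
    MatchDeriv Z e (fun x => -f x) (fun x => -g x) where
  mono := H.mono
  diff_left := H.diff_left.neg
  diff_right := H.diff_right.neg
  deriv_pos_iff y y' h := by simpa [deriv.fun_neg] using hd y y' h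
  sign_eq z hz := by simp only [Left.sign_neg, H.sign_eq z hz]
  atBot := H.atBot.symm.imp
    (fun h => ⟨Filter.tendsto_neg_atBot_atTop.comp h.1, Filter.tendsto_neg_atBot_atTop.comp h.2⟩)
    (fun h => ⟨Filter.tendsto_neg_atTop_atBot.comp h.1, Filter.tendsto_neg_atTop_atBot.comp h.2⟩)
  atTop := H.atTop.symm.imp
    (fun h => ⟨Filter.tendsto_neg_atBot_atTop.comp h.1, Filter.tendsto_neg_atBot_atTop.comp h.2⟩)
    (fun h => ⟨Filter.tendsto_neg_atTop_atBot.comp h.1, Filter.tendsto_neg_atTop_atBot.comp h.2⟩)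

/-- The zeros of `f` can be added to `Z`, so that the signs of `f` and `g` match. -/
theorem MatchDeriv.exists_extend {Z : Finset ℝ} {e : ℝ → ℝ} {f g : ℝ → ℝ} (H : MatchDeriv Z e f g)
    (hd : ∀ y y', SamePosition Z e y y' → (deriv f y < 0 ↔ deriv g y' < 0))
    (hcrit : ∀ y ∉ Z, deriv f y ≠ 0) (F : Finset ℝ) (hF : ∀ x, x ∈ F ↔ f x = 0) :
    ∃ e' : ℝ → ℝ, StrictMonoOn e' (Z ∪ F : Finset ℝ) ∧ (∀ z ∈ Z, e' z = e z) ∧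
      ∀ y y', SamePosition (Z ∪ F) e' y y' → SignType.sign (f y) = SignType.sign (g y') := by
  have H' := H.neg hd
  have hex : ∀ ζ, ∃ y', ζ ∉ Z → f ζ = 0 → SamePosition Z e ζ y' ∧ g y' = 0 := by
    intro ζ
    by_cases h : ζ ∉ Z ∧ f ζ = 0
    · obtain ⟨h, h0⟩ := h
      rcases lt_or_gt_of_ne (hcrit ζ h) with h' | h'
      · obtain ⟨y', h₁, h₂⟩ := H'.exists_zero_of_pos h (by simpa [deriv.fun_neg] using h')
          (by simpa using h0)
        exact ⟨y', fun _ _ => ⟨h₁, by simpa using h₂⟩⟩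
      · obtain ⟨y', h₁, h₂⟩ := H.exists_zero_of_pos h h' h0
        exact ⟨y', fun _ _ => ⟨h₁, h₂⟩⟩
    · exact ⟨0, fun h₁ h₂ => absurd ⟨h₁, h₂⟩ h⟩
  choose c hc using hex
  -- Old points keep their images; a new zero of `f` goes to a chosen zero of `g` in the
  -- corresponding gap.
  let e' : ℝ → ℝ := fun x => if x ∈ Z then e x else c x
  have he : ∀ z ∈ Z, e' z = e z := fun z hz => if_pos hz
  have hc' : ∀ ζ, ζ ∉ Z → f ζ = 0 → SamePosition Z e ζ (e' ζ) ∧ g (e' ζ) = 0 := by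
    intro ζ h h0
    rw [show e' ζ = c ζ from if_neg h]
    exact hc ζ h h0
  have hF' : ∀ x ∈ Z ∪ F, x ∈ Z ∨ (x ∉ Z ∧ f x = 0) := by
    intro x hx
    by_cases h : x ∈ Z
    · exact Or.inl h
    · exact Or.inr ⟨h, (hF x).1 ((Finset.mem_union.1 hx).resolve_left h)⟩
  refine ⟨e', ?_, he, ?_⟩
  · intro a ha b hb hab
    rcases hF' a ha with ha | ⟨ha, ha'⟩ <;> rcases hF' b hb with hb | ⟨hb, hb'⟩
    · rw [he a ha, he b hb]
      exact H.mono ha hb hab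
    · rw [he a ha]
      exact ((hc' b hb hb').1 a ha).1.1 hab
    · rw [he b hb]
      exact ((hc' a ha ha').1 b hb).2.1 hab
    -- Rolle: between two new zeros lies a critical point, which belongs to `Z` by `hcrit`. Its
    -- image separates the images of the two zeros, so their order is preserved.
    · obtain ⟨x, hx, hx'⟩ := exists_deriv_eq_zero hab H.diff_left.continuous.continuousOn
        (ha'.trans hb'.symm)
      have hxZ : x ∈ Z := by
        by_contra h
        exact hcrit x h hx'
      exact (((hc' a ha ha').1 x hxZ).2.1 hx.1).trans (((hc' b hb hb').1 x hxZ).1.1 hx.2)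
  · intro y y' h
    have hZ : SamePosition Z e y y' := fun z hz => by
      have := h z (Finset.mem_union_left _ hz)
      rwa [he z hz] at this
    by_cases hy : y ∈ Z
    · rw [hZ.eq_of_mem hy]
      exact H.sign_eq y hy
    · have hs : ∀ ζ, ζ ∉ Z → f ζ = 0 → (ζ < y ↔ e' ζ < y') ∧ (y < ζ ↔ y' < e' ζ) :=
        fun ζ _ h0 => h ζ (Finset.mem_union_right _ ((hF ζ).2 h0))
      rcases lt_or_gt_of_ne (hcrit y hy) with h' | h'
      · have := H'.sign_eq_of_pos (e' := e') (fun ζ h₁ h₂ => by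
          simpa using hc' ζ h₁ (by simpa using h₂)) hZ hy (by simpa [deriv.fun_neg] using h')
          (fun ζ h₁ h₂ => hs ζ h₁ (by simpa using h₂))
        simpa [Left.sign_neg] using this
      · exact H.sign_eq_of_pos hc' hZ hy h' hs

namespace SamePosition

variable {Z : Finset ℝ} {e : ℝ → ℝ} {y y' : ℝ}

theorem exists_left (he : StrictMonoOn e Z) (y' : ℝ) : ∃ y, SamePosition Z e y y' := by
  by_cases hy : ∃ y ∈ Z, e y = y'
  · obtain ⟨y, hy, rfl⟩ := hy
    exact ⟨y, refl_of_mem he hy⟩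
  · obtain ⟨m, h₁, h₂⟩ := Order.exists_between_finsets (Z.filter (e · < y'))
      (Z.filter (y' < e ·)) (by
        intro a ha b hb
        simp only [Finset.mem_filter] at ha hb
        exact (he.lt_iff_lt ha.1 hb.1).1 (ha.2.trans hb.2))
    refine ⟨m, fun z hz => ?_⟩
    rcases lt_trichotomy (e z) y' with h | h | h
    · have := h₁ z (Finset.mem_filter.2 ⟨hz, h⟩)
      exact ⟨iff_of_true this h, iff_of_false this.not_gt h.not_gt⟩
    · exact absurd ⟨z, hz, h⟩ hy
    · have := h₂ z (Finset.mem_filter.2 ⟨hz, h⟩)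
      exact ⟨iff_of_false this.not_gt h.not_gt, iff_of_true this h⟩

theorem mono {Z₀ : Finset ℝ} (h : SamePosition Z e y y') (hZ : Z₀ ⊆ Z) : SamePosition Z₀ e y y' :=
  fun z hz => h z (hZ hz)

theorem eventually (h : SamePosition Z e y y') (hy : y ∉ Z) :
    ∀ᶠ x in nhds y, SamePosition Z e x y' := by
  refine (Filter.eventually_all_finset Z).2 fun z hz => ?_
  rcases lt_or_gt_of_ne (fun h' : y = z => hy (h' ▸ hz)) with h' | h'
  · filter_upwards [eventually_lt_nhds h'] with x hx
    have := (h z hz).2.1 h'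
    exact ⟨iff_of_false hx.not_gt this.not_gt, iff_of_true hx this⟩
  · filter_upwards [eventually_gt_nhds h'] with x hx
    have := (h z hz).1.1 h'
    exact ⟨iff_of_true hx this, iff_of_false hx.not_gt this.not_gt⟩

/-- Outside `Z`, points near `y` have the same position as `y`, hence the same sign of `f`. A zero
there would make `f` vanish on a neighbourhood. -/
theorem root_mem {f : Polynomial ℝ} {g : ℝ → ℝ} (he : StrictMonoOn e Z) (hf : f ≠ 0)
    (h : ∀ y y', SamePosition Z e y y' → SignType.sign (f.eval y) = SignType.sign (g y'))
    (h0 : f.eval y = 0) : y ∈ Z := by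
  by_contra hy
  obtain ⟨y', hs⟩ := exists_right he y
  refine hf (Polynomial.eq_zero_of_infinite_isRoot f
    (infinite_of_mem_nhds y (Filter.mem_of_superset (hs.eventually hy) fun x hx => ?_)))
  have h₁ := h x y' hx
  rw [← h y y' hs, h0, sign_zero, sign_eq_zero_iff] at h₁
  exact h₁

/-- Matching of signs is preserved when points that are not zeros are removed from `Z`. -/
theorem sign_eq_of_subset {f g : Polynomial ℝ} (he : StrictMonoOn e Z)
    (h : ∀ y y', SamePosition Z e y y' → SignType.sign (f.eval y) = SignType.sign (g.eval y'))
    {Z₀ : Finset ℝ} (hZ : Z₀ ⊆ Z) (hZ₀ : f ≠ 0 → ∀ z ∈ Z, f.eval z = 0 → z ∈ Z₀)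
    (hs : SamePosition Z₀ e y y') : SignType.sign (f.eval y) = SignType.sign (g.eval y') := by
  by_cases hf : f = 0
  -- Every `y'` is matched with some point on the left, so `f = 0` forces `g` to vanish at `y'`,
  -- whatever points were removed.
  · obtain ⟨x, hx⟩ := exists_left he y'
    have := h x y' hx
    simp only [hf, Polynomial.eval_zero] at this ⊢
    exact this
  by_cases hy : y ∈ Z₀
  · rw [hs.eq_of_mem hy]
    exact h y _ (refl_of_mem he (hZ hy))
  obtain ⟨w, hw⟩ := exists_right he y
  rw [h y w hw]
  -- In the coarser gap of `y` the polynomial `g` has no zero: it would correspond to a zero of `f`,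
  -- which lies in `Z` and was therefore kept in `Z₀`. By the intermediate value theorem `g` then
  -- has constant sign on this gap, which contains both `w` and `y'`.
  have hne : ∀ x', SamePosition Z₀ e y x' → g.eval x' ≠ 0 := by
    intro x' hx' h0
    obtain ⟨x, hx⟩ := exists_left he x'
    have h₁ := h x x' hx
    rw [h0, sign_zero, sign_eq_zero_iff] at h₁
    have h₂ := root_mem he hf h h₁
    have h₃ := hZ₀ hf x h₂ h₁
    have h₄ := hx.eq_of_mem h₂
    have h₅ := hx' x h₃
    rw [h₄] at h₅
    simp only [lt_irrefl, iff_false, not_lt] at h₅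
    exact hy (le_antisymm h₅.1 h₅.2 ▸ h₃)
  have hw₀ := hw.mono hZ
  have key : ∀ {a b : ℝ}, a ≤ b → SamePosition Z₀ e y a → SamePosition Z₀ e y b →
      SignType.sign (g.eval a) = SignType.sign (g.eval b) := by
    intro a b hab ha hb
    have hcont : ContinuousOn (fun x => g.eval x) (Set.Icc a b) := g.continuous.continuousOn
    rcases lt_or_gt_of_ne (hne a ha) with h₁ | h₁ <;> rcases lt_or_gt_of_ne (hne b hb) with h₂ | h₂
    · rw [sign_neg h₁, sign_neg h₂]
    · obtain ⟨c, hc, hc'⟩ := intermediate_value_Icc hab hcont ⟨h₁.le, h₂.le⟩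
      exact absurd hc' (hne c (ha.convex_right hb hc.1 hc.2))
    · obtain ⟨c, hc, hc'⟩ := intermediate_value_Icc' hab hcont ⟨h₂.le, h₁.le⟩
      exact absurd hc' (hne c (ha.convex_right hb hc.1 hc.2))
    · rw [sign_pos h₁, sign_pos h₂]
  rcases le_total w y' with hle | hle
  · exact key hle hw₀ hs
  · exact (key hle hs hw₀).symm

end SamePosition

/-! ### Sign diagrams of parametric polynomials -/

open Polynomial in
/-- Division with remainder by a polynomial of formal degree `k` and formal leading
coefficient `a`. -/
theorem exists_pseudo_rem {R : Type u} [CommRing R] (a : R) {k : ℕ} {g : R[X]}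
    (hg : g.natDegree < k) (p : R[X]) :
    ∃ (m : ℕ) (s r : R[X]), C (a ^ m) * p = (C a * X ^ k + g) * s + r ∧ r.natDegree < k := by
  induction hn : p.natDegree using Nat.strong_induction_on generalizing p with
  | _ n ih =>
    subst hn
    rcases lt_or_ge p.natDegree k with h | h
    · exact ⟨0, 0, p, by simp, h⟩
    · set n := p.natDegree with hn
      set c := p.leadingCoeff
      have hp : p.eraseLead + C c * X ^ n = p := p.eraseLead_add_C_mul_X_pow
      -- This is `a p` minus the multiple `c X^(n-k)` of the divisor, written with the two terms of
      -- degree `n` already cancelled. No assumption `a ≠ 0` is needed.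
      have hlt : (C a * p.eraseLead - C c * X ^ (n - k) * g).natDegree < n := by
        refine lt_of_le_of_lt (natDegree_sub_le _ _) (max_lt ?_ ?_)
        · refine lt_of_le_of_lt (natDegree_C_mul_le _ _) ?_
          have := p.eraseLead_natDegree_le
          omega
        · refine lt_of_le_of_lt natDegree_mul_le ?_
          have := natDegree_C_mul_X_pow_le c (n - k)
          omega
      obtain ⟨m, s, r, h₁, h₂⟩ := ih _ hlt _ rfl
      refine ⟨m + 1, s + C (a ^ m) * C c * X ^ (n - k), r, ?_, h₂⟩
      have hX : (X : R[X]) ^ n = X ^ (n - k) * X ^ k := by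
        rw [← pow_add]; congr 1; omega
      have e : C (a ^ (m + 1)) * p = C (a ^ m) * (C a * p.eraseLead - C c * X ^ (n - k) * g) +
          C (a ^ m) * C c * X ^ (n - k) * (C a * X ^ k + g) := by
        conv_lhs => rw [← hp]
        rw [hX, pow_succ, C_mul]
        ring
      rw [e, h₁]
      ring

section SignDiagram

open Polynomial

variable {R : Type u} [CommRing R]

/-- The sign diagrams of a finite set of polynomials with coefficients in `R` agree for two
homomorphisms `R → ℝ`. -/
def SignsMatch (P : Finset R[X]) (φ ψ : R →+* ℝ) : Prop :=
  ∃ (Z : Finset ℝ) (e : ℝ → ℝ), StrictMonoOn e Z ∧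
    (∀ z ∈ Z, ∃ p ∈ P, p.map φ ≠ 0 ∧ (p.map φ).eval z = 0) ∧
    ∀ y y', SamePosition Z e y y' → ∀ p ∈ P,
      SignType.sign ((p.map φ).eval y) = SignType.sign ((p.map ψ).eval y')

theorem SignsMatch.mono {P Q : Finset R[X]} {φ ψ : R →+* ℝ} (hQ : SignsMatch Q φ ψ)
    (h : P ⊆ Q) : SignsMatch P φ ψ := by
  classical
  obtain ⟨Z, e, he, -, hZ⟩ := hQ
  refine ⟨Z.filter fun z => ∃ p ∈ P, p.map φ ≠ 0 ∧ (p.map φ).eval z = 0, e, ?_, ?_, ?_⟩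
  · exact he.mono (Finset.coe_subset.2 (Finset.filter_subset _ _))
  · intro z hz
    exact (Finset.mem_filter.1 hz).2
  · intro y y' hy p hp
    exact SamePosition.sign_eq_of_subset he (fun y y' h' => hZ y y' h' p (h hp))
      (Finset.filter_subset _ _)
      (fun hf z hz h0 => Finset.mem_filter.2 ⟨hz, p, hp, hf, h0⟩) hy

/-- A finite set of polynomials with coefficients in `R`, such that for homomorphisms `R → ℝ` the
signs of finitely many elements of `R` determine the sign diagram of these polynomials. -/
def HasSignDiagram (P : Finset R[X]) : Prop :=
  ∃ C : Finset R, ∀ φ ψ : R →+* ℝ, (∀ c ∈ C, SignType.sign (φ c) = SignType.sign (ψ c)) →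
    SignsMatch P φ ψ

theorem sign_map_coeff_eq {p : R[X]} {φ ψ : R →+* ℝ}
    (h : ∀ c ∈ p.coeffs, SignType.sign (φ c) = SignType.sign (ψ c)) (n : ℕ) :
    SignType.sign (φ (p.coeff n)) = SignType.sign (ψ (p.coeff n)) := by
  by_cases h0 : p.coeff n = 0
  · simp [h0]
  · exact h _ (coeff_mem_coeffs h0)

/-- The signs of the coefficients tell which of them vanish after specialization. -/
theorem natDegree_map_eq {p : R[X]} {φ ψ : R →+* ℝ}
    (h : ∀ c ∈ p.coeffs, SignType.sign (φ c) = SignType.sign (ψ c)) :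
    (p.map φ).natDegree = (p.map ψ).natDegree := by
  have key : (p.map φ).support = (p.map ψ).support := by
    ext n
    have := sign_map_coeff_eq h n
    rw [mem_support_iff, mem_support_iff, coeff_map, coeff_map, ← sign_ne_zero, this, sign_ne_zero]
  simp only [natDegree, degree, key]

theorem tendsto_atBot_of_natDegree_pos (f : ℝ[X]) (hf : 0 < f.natDegree) :
    (0 < f.leadingCoeff * (-1) ^ f.natDegree → Filter.Tendsto (fun x => f.eval x) Filter.atBot Filter.atTop) ∧
    (f.leadingCoeff * (-1) ^ f.natDegree < 0 → Filter.Tendsto (fun x => f.eval x) Filter.atBot Filter.atBot) := by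
  have hd : (f.comp (-X)).natDegree = f.natDegree := by
    rw [natDegree_comp, natDegree_neg, natDegree_X, mul_one]
  have hl : (f.comp (-X)).leadingCoeff = f.leadingCoeff * (-1) ^ f.natDegree := by
    rw [leadingCoeff_comp (by simp)]; simp
  have hdeg : 0 < (f.comp (-X)).degree := natDegree_pos_iff_degree_pos.1 (hd ▸ hf)
  have e : (fun x => f.eval x) = (fun x => (f.comp (-X)).eval x) ∘ fun x => -x := by
    ext x; simp
  rw [e, ← hl]
  exact ⟨fun h => (tendsto_atTop_of_leadingCoeff_nonneg _ hdeg h.le).comp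
      Filter.tendsto_neg_atBot_atTop,
    fun h => (tendsto_atBot_of_leadingCoeff_nonpos _ hdeg h.le).comp
      Filter.tendsto_neg_atBot_atTop⟩

/-- The behaviour of a nonconstant polynomial at `±∞` is determined by its degree and the sign of
its leading coefficient; everything else in `MatchDeriv` is assumed directly. -/
theorem matchDeriv_of_sign_eq {Z : Finset ℝ} {e : ℝ → ℝ} {f g : ℝ[X]} (he : StrictMonoOn e Z)
    (hf : 0 < f.natDegree) (hfg : f.natDegree = g.natDegree)
    (hl : SignType.sign f.leadingCoeff = SignType.sign g.leadingCoeff)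
    (hd : ∀ y y', SamePosition Z e y y' →
      SignType.sign (f.derivative.eval y) = SignType.sign (g.derivative.eval y'))
    (hZ : ∀ z ∈ Z, SignType.sign (f.eval z) = SignType.sign (g.eval (e z))) :
    MatchDeriv Z e (fun x => f.eval x) (fun x => g.eval x) where
  mono := he
  diff_left := f.differentiable
  diff_right := g.differentiable
  deriv_pos_iff y y' h := by
    rw [Polynomial.deriv, Polynomial.deriv, ← sign_eq_one_iff, hd y y' h, sign_eq_one_iff]
  sign_eq := hZ
  atBot := by
    have hne : f.leadingCoeff * (-1) ^ f.natDegree ≠ 0 :=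
      mul_ne_zero (leadingCoeff_ne_zero.2 (by rintro rfl; simp at hf)) (by simp)
    have hs : SignType.sign (f.leadingCoeff * (-1) ^ f.natDegree) =
        SignType.sign (g.leadingCoeff * (-1) ^ g.natDegree) := by
      rw [sign_mul, sign_mul, hl, hfg]
    rcases lt_or_gt_of_ne hne with h | h
    · refine Or.inr ⟨(tendsto_atBot_of_natDegree_pos f hf).2 h,
        (tendsto_atBot_of_natDegree_pos g (hfg ▸ hf)).2 ?_⟩
      rwa [← sign_eq_neg_one_iff, ← hs, sign_eq_neg_one_iff]
    · refine Or.inl ⟨(tendsto_atBot_of_natDegree_pos f hf).1 h,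
        (tendsto_atBot_of_natDegree_pos g (hfg ▸ hf)).1 ?_⟩
      rwa [← sign_eq_one_iff, ← hs, sign_eq_one_iff]
  atTop := by
    have hne : f.leadingCoeff ≠ 0 := leadingCoeff_ne_zero.2 (by rintro rfl; simp at hf)
    have hf' := natDegree_pos_iff_degree_pos.1 hf
    have hg' := natDegree_pos_iff_degree_pos.1 (hfg ▸ hf)
    rcases lt_or_gt_of_ne hne with h | h
    · refine Or.inr ⟨tendsto_atBot_of_leadingCoeff_nonpos _ hf' h.le,
        tendsto_atBot_of_leadingCoeff_nonpos _ hg' (le_of_lt ?_)⟩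
      rwa [← sign_eq_neg_one_iff, ← hl, sign_eq_neg_one_iff]
    · refine Or.inl ⟨tendsto_atTop_of_leadingCoeff_nonneg _ hf' h.le,
        tendsto_atTop_of_leadingCoeff_nonneg _ hg' (le_of_lt ?_)⟩
      rwa [← sign_eq_one_iff, ← hl, sign_eq_one_iff]

/-- The truncation of a polynomial to formal degree `k`. -/
theorem map_trunc (q : R[X]) (φ : R →+* ℝ) {k : ℕ} (hk : (q.map φ).natDegree ≤ k) :
    (C (q.coeff k) * X ^ k + ∑ i ∈ Finset.range k, C (q.coeff i) * X ^ i).map φ = q.map φ := by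
  rw [add_comm, ← Finset.sum_range_succ, Polynomial.map_sum,
    (q.map φ).as_sum_range' (k + 1) (Nat.lt_succ_of_le hk)]
  refine Finset.sum_congr rfl fun i _ => ?_
  simp [← C_mul_X_pow_eq_monomial]

theorem natDegree_sum_range_lt (q : R[X]) {k : ℕ} (hk : 1 ≤ k) :
    (∑ i ∈ Finset.range k, C (q.coeff i) * X ^ i).natDegree < k := by
  refine lt_of_le_of_lt (natDegree_sum_le_of_forall_le (n := k - 1) _ _ fun i hi => ?_) (by omega)
  rw [Finset.mem_range] at hi
  exact (natDegree_C_mul_X_pow_le _ _).trans (by omega)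

open Classical in
/-- The step of the Cohen–Hörmander algorithm: the sign diagram of `p` together with a family `A`
that contains the derivative of `p` is determined by the signs of the polynomials in `A` and of
the remainders of `p`. -/
theorem SignsMatch.insert {p : R[X]} {A B : Finset R[X]} {φ ψ : R →+* ℝ}
    (hp : 0 < p.natDegree) (hA : p.derivative ∈ A)
    (hB : ∀ q ∈ A, ∀ k, 1 ≤ k → k ≤ q.natDegree → ∃ (m : ℕ) (s r : R[X]), r ∈ B ∧
      C (q.coeff k ^ m) * p =
        (C (q.coeff k) * X ^ k + ∑ i ∈ Finset.range k, C (q.coeff i) * X ^ i) * s + r)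
    (hAB : SignsMatch (A ∪ B) φ ψ)
    (hlead : SignType.sign (φ p.leadingCoeff) = SignType.sign (ψ p.leadingCoeff))
    (hlead0 : φ p.leadingCoeff ≠ 0)
    (hcoeff : ∀ q ∈ A, ∀ c ∈ q.coeffs, SignType.sign (φ c) = SignType.sign (ψ c)) :
    SignsMatch (insert p A) φ ψ := by
  have hlead0' : ψ p.leadingCoeff ≠ 0 := by
    rwa [← sign_ne_zero, ← hlead, sign_ne_zero]
  obtain ⟨Z₁, e, he, -, hZ₁⟩ := hAB
  -- Only zeros of polynomials in `A` are kept as points. The remainders in `B` serve to read off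
  -- the sign of `p` at these points, not to subdivide the line.
  set Z := Z₁.filter fun z => ∃ p ∈ A, p.map φ ≠ 0 ∧ (p.map φ).eval z = 0 with hZdef
  have hZsub : Z ⊆ Z₁ := Finset.filter_subset _ _
  have heZ : StrictMonoOn e Z := he.mono (Finset.coe_subset.2 hZsub)
  have hZ : ∀ y y', SamePosition Z e y y' → ∀ p ∈ A,
      SignType.sign ((p.map φ).eval y) = SignType.sign ((p.map ψ).eval y') := by
    intro y y' hy p hp
    exact SamePosition.sign_eq_of_subset he
      (fun y y' h' => hZ₁ y y' h' p (Finset.mem_union_left _ hp)) hZsub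
      (fun hf z hz h0 => Finset.mem_filter.2 ⟨hz, p, hp, hf, h0⟩) hy
  have hzsign : ∀ z ∈ Z, SignType.sign ((p.map φ).eval z) =
      SignType.sign ((p.map ψ).eval (e z)) := by
    intro z hz
    obtain ⟨hz₁, q, hq, hq0, hqz⟩ := Finset.mem_filter.1 hz
    have hqz' : (q.map ψ).eval (e z) = 0 := by
      have := hZ z (e z) (SamePosition.refl_of_mem heZ hz) q hq
      rwa [hqz, sign_zero, eq_comm, sign_eq_zero_iff] at this
    -- `k` is the true degree of `q` after specialization, possibly smaller than `q.natDegree`. This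
    -- is why `B` has to contain the remainders modulo all truncations of `q`.
    set k := (q.map φ).natDegree with hk
    have hk' : k = (q.map ψ).natDegree := natDegree_map_eq (hcoeff q hq)
    have hk1 : 1 ≤ k := by
      by_contra h
      have h0 : (q.map φ).natDegree = 0 := by omega
      rw [eq_C_of_natDegree_eq_zero h0, eval_C] at hqz
      rw [eq_C_of_natDegree_eq_zero h0, hqz, C_0] at hq0
      exact hq0 rfl
    obtain ⟨m, s, r, hr, hrem⟩ := hB q hq k hk1 natDegree_map_le
    -- At a zero of `q` the division identity becomes `a^m p = r`, with `a` the leading coefficient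
    -- of the specialized `q`. As the sign of `a` is known and nonzero, the sign of `r` gives that
    -- of `p`.
    have hrel : ∀ χ : R →+* ℝ, (q.map χ).natDegree = k → ∀ x, (q.map χ).eval x = 0 →
        χ (q.coeff k) ^ m * (p.map χ).eval x = (r.map χ).eval x := by
      intro χ hχ x hx
      have := congrArg (fun t => (t.map χ).eval x) hrem
      simp only [Polynomial.map_mul] at this
      rw [Polynomial.map_add, Polynomial.map_mul, map_trunc q χ hχ.le, eval_add, eval_mul,
        eval_mul, hx] at this
      simpa using this
    have h₁ := hrel φ rfl z hqz
    have h₂ := hrel ψ hk'.symm (e z) hqz'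
    have hc := sign_map_coeff_eq (hcoeff q hq) k
    have hc0 : φ (q.coeff k) ≠ 0 := by
      rw [← coeff_map]
      exact leadingCoeff_ne_zero.2 hq0
    have hrs := hZ₁ z (e z) (SamePosition.refl_of_mem he hz₁) r (Finset.mem_union_right _ hr)
    rw [← h₁, ← h₂, sign_mul, sign_mul, sign_pow, sign_pow, hc] at hrs
    refine mul_left_cancel₀ (pow_ne_zero m ?_) hrs
    rw [← hc]
    exact sign_ne_zero.2 hc0
  have hdeg : (p.map φ).natDegree = p.natDegree := natDegree_map_of_leadingCoeff_ne_zero _ hlead0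
  have hdeg' : (p.map ψ).natDegree = p.natDegree := natDegree_map_of_leadingCoeff_ne_zero _ hlead0'
  have hdsign : ∀ y y', SamePosition Z e y y' → SignType.sign ((p.map φ).derivative.eval y) =
      SignType.sign ((p.map ψ).derivative.eval y') := by
    intro y y' h
    rw [derivative_map, derivative_map]
    exact hZ y y' h _ hA
  have H := matchDeriv_of_sign_eq heZ (hdeg ▸ hp) (hdeg.trans hdeg'.symm) (by
    rwa [leadingCoeff_map_of_leadingCoeff_ne_zero _ hlead0,
      leadingCoeff_map_of_leadingCoeff_ne_zero _ hlead0']) hdsign hzsign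
  have hp0 : p.map φ ≠ 0 := by
    intro h
    rw [h] at hdeg
    simp at hdeg
    omega
  have hd0 : (p.map φ).derivative ≠ 0 := by
    intro h
    have := derivative_eq_zero.1 h
    omega
  obtain ⟨e', he', hee', hsign⟩ := H.exists_extend
    (fun y y' h => by
      rw [Polynomial.deriv, Polynomial.deriv, ← sign_eq_neg_one_iff, hdsign y y' h,
        sign_eq_neg_one_iff])
    (fun y hy h0 => hy (SamePosition.root_mem heZ hd0 hdsign (by rwa [Polynomial.deriv] at h0)))
    (p.map φ).roots.toFinset (by
      intro x
      rw [Multiset.mem_toFinset, mem_roots hp0, IsRoot.def])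
  refine ⟨_, e', he', fun z hz => ?_, fun y y' h q hq => ?_⟩
  · rcases Finset.mem_union.1 hz with hz | hz
    · obtain ⟨q, hq, h⟩ := (Finset.mem_filter.1 hz).2
      exact ⟨q, Finset.mem_insert_of_mem hq, h⟩
    · rw [Multiset.mem_toFinset, mem_roots hp0, IsRoot.def] at hz
      exact ⟨p, Finset.mem_insert_self _ _, hp0, hz⟩
  · rcases Finset.mem_insert.1 hq with rfl | hq
    · exact hsign y y' h
    · refine hZ y y' (fun z hz => ?_) q hq
      have := h z (Finset.mem_union_left _ hz)
      rwa [hee' z hz] at this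

open Classical in
-- If the leading coefficient of `p` vanishes under the homomorphism, `p` may be replaced by its
-- lower terms, which is covered by `h₁`. Otherwise `SignsMatch.insert` applies to `A` with the
-- derivative of `p` added, and `h₂` supplies the diagram with the derivative and the remainders.
-- All new polynomials have degree below that of `p`; for the remainders this uses `hA`. The leading
-- coefficient itself is among the recorded elements, so both homomorphisms fall into the same case.
theorem HasSignDiagram.insert_of_natDegree_pos {p : R[X]} {A : Finset R[X]}
    (hp : 0 < p.natDegree)
    (h₁ : ∀ q : R[X], q.natDegree < p.natDegree → HasSignDiagram (insert q A))
    (hA : ∀ q ∈ A, q.natDegree ≤ p.natDegree)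
    (h₂ : ∀ B : Finset R[X], (∀ r ∈ B, r.natDegree < p.natDegree) → HasSignDiagram (A ∪ B)) :
    HasSignDiagram (insert p A) := by
  have hrem : ∀ (q : R[X]) (k : ℕ), ∃ (m : ℕ) (s r : R[X]), 1 ≤ k →
      C (q.coeff k ^ m) * p =
        (C (q.coeff k) * X ^ k + ∑ i ∈ Finset.range k, C (q.coeff i) * X ^ i) * s + r ∧
      r.natDegree < k := by
    intro q k
    by_cases hk : 1 ≤ k
    · obtain ⟨m, s, r, h, h'⟩ := exists_pseudo_rem (q.coeff k) (natDegree_sum_range_lt q hk) p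
      exact ⟨m, s, r, fun _ => ⟨h, h'⟩⟩
    · exact ⟨0, 0, 0, fun h => absurd h hk⟩
  choose m s r hr using hrem
  set A' := insert p.derivative A with hA'
  set B := A'.biUnion fun q => (Finset.Icc 1 q.natDegree).image fun k => r q k with hBdef
  have hlt : p.eraseLead.natDegree < p.natDegree := by
    have := p.eraseLead_natDegree_le
    omega
  have hlt' : p.derivative.natDegree < p.natDegree := natDegree_derivative_lt hp.ne'
  have hA'd : ∀ q ∈ A', q.natDegree ≤ p.natDegree := by
    intro q hq
    rcases Finset.mem_insert.1 hq with rfl | hq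
    · exact hlt'.le
    · exact hA q hq
  have hB : ∀ q ∈ insert p.derivative B, q.natDegree < p.natDegree := by
    intro q hq
    rcases Finset.mem_insert.1 hq with rfl | hq
    · exact hlt'
    · obtain ⟨q', hq', hq⟩ := Finset.mem_biUnion.1 hq
      obtain ⟨k, hk, rfl⟩ := Finset.mem_image.1 hq
      rw [Finset.mem_Icc] at hk
      exact ((hr q' k hk.1).2.trans_le hk.2).trans_le (hA'd q' hq')
  obtain ⟨C₁, hC₁⟩ := h₁ _ hlt
  obtain ⟨C₂, hC₂⟩ := h₂ _ hB
  refine ⟨insert p.leadingCoeff (C₁ ∪ C₂ ∪ A'.biUnion fun q => q.coeffs), fun φ ψ h => ?_⟩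
  have hlead := h _ (Finset.mem_insert_self _ _)
  by_cases h0 : φ p.leadingCoeff = 0
  · obtain ⟨Z, e, he, hZ, hs⟩ := hC₁ φ ψ fun c hc => h c (by simp [hc])
    have hmap : ∀ χ : R →+* ℝ, χ p.leadingCoeff = 0 → p.eraseLead.map χ = p.map χ := by
      intro χ hχ
      conv_rhs => rw [← p.eraseLead_add_C_mul_X_pow, Polynomial.map_add, Polynomial.map_mul, map_C,
        hχ]
      simp
    have h0' : ψ p.leadingCoeff = 0 := by
      rwa [h0, sign_zero, eq_comm, sign_eq_zero_iff] at hlead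
    refine ⟨Z, e, he, fun z hz => ?_, fun y y' hy q hq => ?_⟩
    · obtain ⟨q, hq, hq'⟩ := hZ z hz
      rcases Finset.mem_insert.1 hq with rfl | hq
      · exact ⟨p, Finset.mem_insert_self _ _, by rwa [hmap φ h0] at hq'⟩
      · exact ⟨q, Finset.mem_insert_of_mem hq, hq'⟩
    · rcases Finset.mem_insert.1 hq with rfl | hq
      · rw [← hmap φ h0, ← hmap ψ h0']
        exact hs y y' hy _ (Finset.mem_insert_self _ _)
      · exact hs y y' hy q (Finset.mem_insert_of_mem hq)
  · refine (SignsMatch.insert (A := A') (B := B) hp (Finset.mem_insert_self _ _) ?_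
      ((hC₂ φ ψ fun c hc => h c (by simp [hc])).mono ?_) hlead h0 ?_).mono ?_
    · intro q hq k hk hk'
      refine ⟨m q k, s q k, r q k, Finset.mem_biUnion.2 ⟨q, hq, Finset.mem_image.2 ⟨k, ?_, rfl⟩⟩,
        (hr q k hk).1⟩
      exact Finset.mem_Icc.2 ⟨hk, hk'⟩
    · rw [hA', Finset.insert_union, Finset.union_insert]
    · intro q hq c hc
      exact h c (Finset.mem_insert_of_mem (Finset.mem_union_right _
        (Finset.mem_biUnion.2 ⟨q, hq, hc⟩)))
    · exact Finset.insert_subset_insert _ (Finset.subset_insert _ _)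

open Classical in
-- A constant polynomial adds no points; its sign is recorded as one more element of the ring.
theorem HasSignDiagram.insert_C {A : Finset R[X]} (hA : HasSignDiagram A) (a : R) :
    HasSignDiagram (insert (C a) A) := by
  obtain ⟨C₁, hC₁⟩ := hA
  refine ⟨insert a C₁, fun φ ψ h => ?_⟩
  obtain ⟨Z, e, he, hZ, hs⟩ := hC₁ φ ψ fun c hc => h c (Finset.mem_insert_of_mem hc)
  refine ⟨Z, e, he, fun z hz => ?_, fun y y' hy q hq => ?_⟩
  · obtain ⟨q, hq, hq'⟩ := hZ z hz
    exact ⟨q, Finset.mem_insert_of_mem hq, hq'⟩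
  · rcases Finset.mem_insert.1 hq with rfl | hq
    · simpa using h a (Finset.mem_insert_self _ _)
    · exact hs y y' hy q hq

theorem hasSignDiagram_empty : HasSignDiagram (∅ : Finset R[X]) :=
  ⟨∅, fun _ _ _ => ⟨∅, id, fun _ h => by simp at h, by simp, by simp⟩⟩

/-- Every finite set of polynomials has sign diagrams that depend on the signs of finitely many
elements of the coefficient ring only. -/
theorem hasSignDiagram (P : Finset R[X]) : HasSignDiagram P := by
  classical
  have key : ∀ (d : ℕ) (P : Finset R[X]), (∀ p ∈ P, p.natDegree < d) → HasSignDiagram P := by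
    intro d
    induction d with
    | zero =>
      intro P hP
      rw [Finset.eq_empty_of_forall_notMem fun p hp => absurd (hP p hp) (Nat.not_lt_zero _)]
      exact hasSignDiagram_empty
    | succ d ih =>
      -- Inner induction on the number of polynomials of top degree `d`. One step removes one of
      -- them at the price of arbitrarily many polynomials of smaller degree, so `A` has to vary.
      have step : ∀ B : Finset R[X], (∀ p ∈ B, p.natDegree = d) → ∀ A : Finset R[X],
          (∀ p ∈ A, p.natDegree < d) → HasSignDiagram (A ∪ B) := by
        intro B
        induction B using Finset.induction_on with
        | empty =>
          intro _ A hA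
          rw [Finset.union_empty]
          exact ih A hA
        | insert p B hpB ihB =>
          intro hB A hA
          have hp := hB p (Finset.mem_insert_self _ _)
          have hB' : ∀ q ∈ B, q.natDegree = d := fun q hq => hB q (Finset.mem_insert_of_mem hq)
          rw [Finset.union_insert]
          rcases Nat.eq_zero_or_pos d with hd | hd
          · rw [eq_C_of_natDegree_eq_zero (hp.trans hd)]
            exact (ihB hB' A hA).insert_C _
          · refine HasSignDiagram.insert_of_natDegree_pos (by omega) (fun q hq => ?_)
              (fun q hq => ?_) fun B' hB'' => ?_
            · rw [← Finset.insert_union]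
              refine ihB hB' _ fun q' hq' => ?_
              rcases Finset.mem_insert.1 hq' with rfl | hq'
              · omega
              · exact hA _ hq'
            · rcases Finset.mem_union.1 hq with hq | hq
              · exact (hA q hq).le.trans hp.ge
              · exact (hB' q hq).le.trans hp.ge
            · rw [Finset.union_right_comm]
              refine ihB hB' _ fun q' hq' => ?_
              rcases Finset.mem_union.1 hq' with hq' | hq'
              · exact hA _ hq'
              · exact (hB'' q' hq').trans_eq hp
      intro P hP
      rw [← Finset.filter_union_filter_not_eq (fun p : R[X] => p.natDegree < d) P]
      refine step _ (fun p hp => ?_) _ fun p hp => (Finset.mem_filter.1 hp).2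
      have := Finset.mem_filter.1 hp
      have h' := hP p this.1
      omega
  exact key (P.sup natDegree + 1) P fun p hp => Nat.lt_succ_of_le (Finset.le_sup hp)

end SignDiagram

/-! ### Polynomially open sets -/

section PolyOpen

open MvPolynomial

variable {ι : Type u} {κ : Type v}

/-- The predicates that define open sets in the topology generated by the sets `{x | 0 ≤ p x}`,
where `p` is a polynomial with integer coefficients. -/
def PolyOpen (P : (ι → ℝ) → Prop) : Prop :=
  ∀ x, P x → ∃ F : Finset (MvPolynomial ι ℤ), (∀ p ∈ F, 0 ≤ aeval x p) ∧
    ∀ y, (∀ p ∈ F, 0 ≤ aeval y p) → P y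

namespace PolyOpen

variable {P Q : (ι → ℝ) → Prop}

theorem congr (h : ∀ x, P x ↔ Q x) (hP : PolyOpen P) : PolyOpen Q := by
  rwa [show Q = P from funext fun x => propext (h x).symm]

theorem const (p : Prop) : PolyOpen fun _ : ι → ℝ => p :=
  fun _ hp => ⟨∅, by simp, fun _ _ => hp⟩

theorem and (hP : PolyOpen P) (hQ : PolyOpen Q) : PolyOpen fun x => P x ∧ Q x := by
  classical
  rintro x ⟨h₁, h₂⟩
  obtain ⟨F, hF, hF'⟩ := hP x h₁
  obtain ⟨G, hG, hG'⟩ := hQ x h₂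
  refine ⟨F ∪ G, fun p hp => (Finset.mem_union.1 hp).elim (hF p) (hG p), fun y hy => ⟨hF' y ?_, hG' y ?_⟩⟩
  · exact fun p hp => hy p (Finset.mem_union_left _ hp)
  · exact fun p hp => hy p (Finset.mem_union_right _ hp)

theorem exists' {α : Sort*} {P : α → (ι → ℝ) → Prop} (h : ∀ a, PolyOpen (P a)) :
    PolyOpen fun x => ∃ a, P a x := by
  rintro x ⟨a, ha⟩
  obtain ⟨F, hF, hF'⟩ := h a x ha
  exact ⟨F, hF, fun y hy => ⟨a, hF' y hy⟩⟩

theorem or (hP : PolyOpen P) (hQ : PolyOpen Q) : PolyOpen fun x => P x ∨ Q x := by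
  rintro x (h | h)
  · obtain ⟨F, hF, hF'⟩ := hP x h
    exact ⟨F, hF, fun y hy => Or.inl (hF' y hy)⟩
  · obtain ⟨F, hF, hF'⟩ := hQ x h
    exact ⟨F, hF, fun y hy => Or.inr (hF' y hy)⟩

theorem exists_mem {α : Type*} {s : Set α} {P : α → (ι → ℝ) → Prop}
    (h : ∀ a ∈ s, PolyOpen (P a)) : PolyOpen fun x => ∃ a ∈ s, P a x := by
  refine exists' fun a => ?_
  by_cases ha : a ∈ s
  · exact (h a ha).congr (by simp [ha])
  · exact (const False).congr (by simp [ha])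

theorem forall_mem {α : Type*} {s : Set α} (hs : s.Finite) {P : α → (ι → ℝ) → Prop}
    (h : ∀ a ∈ s, PolyOpen (P a)) : PolyOpen fun x => ∀ a ∈ s, P a x := by
  induction s, hs using Set.Finite.induction_on with
  | empty => exact (const True).congr (by simp)
  | @insert a s _ _ ih =>
    exact ((h a (Set.mem_insert _ _)).and (ih fun b hb => h b (Set.mem_insert_of_mem _ hb))).congr
      (by simp)

theorem nonneg (p : MvPolynomial ι ℤ) : PolyOpen fun x => 0 ≤ aeval x p :=
  fun _ hx => ⟨{p}, by simpa using hx, fun y hy => by simpa using hy⟩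

/-- By the Archimedean property `p x > 0` is witnessed by an inequality `n p - 1 ≥ 0`, which still
has integer coefficients and in turn forces positivity. -/
theorem pos (p : MvPolynomial ι ℤ) : PolyOpen fun x => 0 < aeval x p := by
  intro x hx
  obtain ⟨n, hn⟩ := exists_nat_gt (1 / aeval x p)
  rw [div_lt_iff₀ hx] at hn
  refine ⟨{C (n : ℤ) * p - 1}, by simpa using hn.le, fun y hy => ?_⟩
  have hy' : 1 ≤ (n : ℝ) * aeval y p := by simpa using hy
  by_contra h
  have := mul_nonpos_of_nonneg_of_nonpos (Nat.cast_nonneg (α := ℝ) n) (not_lt.1 h)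
  linarith

theorem le (p q : MvPolynomial ι ℤ) : PolyOpen fun x => aeval x p ≤ aeval x q :=
  (nonneg (q - p)).congr (by simp)

theorem lt (p q : MvPolynomial ι ℤ) : PolyOpen fun x => aeval x p < aeval x q :=
  (pos (q - p)).congr (by simp)

theorem eq (p q : MvPolynomial ι ℤ) : PolyOpen fun x => aeval x p = aeval x q :=
  ((le p q).and (le q p)).congr fun _ => le_antisymm_iff.symm

theorem ne (p q : MvPolynomial ι ℤ) : PolyOpen fun x => aeval x p ≠ aeval x q :=
  ((lt p q).or (lt q p)).congr fun _ => ne_iff_lt_or_gt.symm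

theorem sign_eq (p : MvPolynomial ι ℤ) (s : SignType) :
    PolyOpen fun x => SignType.sign (aeval x p) = s := by
  cases s
  · exact (eq p 0).congr (by simp)
  · exact (lt p 0).congr fun x => by simpa using sign_eq_neg_one_iff.symm
  · exact (pos p).congr fun x => by simpa using sign_eq_one_iff.symm

theorem comp_rename (hP : PolyOpen P) (r : ι → κ) : PolyOpen fun x : κ → ℝ => P (x ∘ r) := by
  classical
  intro x hx
  obtain ⟨F, hF, hF'⟩ := hP _ hx
  refine ⟨F.image (rename r), ?_, fun y hy => hF' _ fun p hp => ?_⟩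
  · intro p hp
    obtain ⟨p, hp', rfl⟩ := Finset.mem_image.1 hp
    rw [aeval_rename]
    exact hF p hp'
  · have := hy _ (Finset.mem_image_of_mem _ hp)
    rwa [aeval_rename] at this

/-- The projection of a polynomially open set along a coordinate is polynomially open. -/
theorem exists_update [DecidableEq ι] (hP : PolyOpen P) (k : ι) :
    PolyOpen fun x => ∃ y : ℝ, P (Function.update x k y) := by
  classical
  rintro x ⟨y, hy⟩
  obtain ⟨F, hF, hF'⟩ := hP _ hy
  -- Reads a polynomial as a polynomial in the variable `k` over the ring of polynomials. The
  -- variable `k` no longer occurs in the coefficients.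
  let T : MvPolynomial ι ℤ →ₐ[ℤ] Polynomial (MvPolynomial ι ℤ) :=
    aeval fun i => if i = k then Polynomial.X else Polynomial.C (X i)
  have hT : ∀ (x : ι → ℝ) (y : ℝ) (p : MvPolynomial ι ℤ),
      ((T p).map (aeval x : MvPolynomial ι ℤ →ₐ[ℤ] ℝ).toRingHom).eval y =
        aeval (Function.update x k y) p := by
    intro x y p
    induction p using MvPolynomial.induction_on with
    | C a =>
      simp [T]
    | add p q hp hq =>
      rw [map_add, Polynomial.map_add, Polynomial.eval_add, hp, hq, map_add]
    | mul_X p i hp =>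
      rw [map_mul, Polynomial.map_mul, Polynomial.eval_mul, hp, map_mul]
      congr 1
      by_cases h : i = k
      · subst h; simp [T]
      · simp [T, h]
  obtain ⟨C, hC⟩ := hasSignDiagram (F.image T)
  -- The points whose sign vector on `C` equals that of `x` form an open set. On it the sign diagram
  -- is that of `x`, so the witness `y` can be moved to a `y'` in the same position, where the
  -- polynomials of `F` have the same signs.
  have hopen : PolyOpen fun x' : ι → ℝ => ∀ c ∈ (C : Set (MvPolynomial ι ℤ)),
      SignType.sign (aeval x' c) = SignType.sign (aeval x c) :=
    forall_mem C.finite_toSet fun c _ => sign_eq c _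
  obtain ⟨G, hG, hG'⟩ := hopen x fun _ _ => rfl
  refine ⟨G, hG, fun x' hx' => ?_⟩
  obtain ⟨Z, e, he, -, hZ⟩ := hC (aeval x : MvPolynomial ι ℤ →ₐ[ℤ] ℝ).toRingHom
    (aeval x' : MvPolynomial ι ℤ →ₐ[ℤ] ℝ).toRingHom fun c hc => (hG' x' hx' c hc).symm
  obtain ⟨y', hyy'⟩ := SamePosition.exists_right he y
  refine ⟨y', hF' _ fun p hp => ?_⟩
  have := hZ y y' hyy' (T p) (Finset.mem_image_of_mem _ hp)
  rw [hT, hT] at this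
  have h0 := hF p hp
  rcases h0.lt_or_eq with h | h
  · rw [sign_pos h, eq_comm, sign_eq_one_iff] at this
    exact this.le
  · rw [← h, sign_zero, eq_comm, sign_eq_zero_iff] at this
    exact this.ge

end PolyOpen

/-- Both the predicate and its negation are polynomially open. -/
def PolyClopen (P : (ι → ℝ) → Prop) : Prop := PolyOpen P ∧ PolyOpen fun x => ¬ P x

namespace PolyClopen

variable {P Q : (ι → ℝ) → Prop}

theorem congr (h : ∀ x, P x ↔ Q x) (hP : PolyClopen P) : PolyClopen Q := by
  rwa [show Q = P from funext fun x => propext (h x).symm]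

theorem const (p : Prop) : PolyClopen fun _ : ι → ℝ => p := ⟨.const _, .const _⟩

theorem not (hP : PolyClopen P) : PolyClopen fun x => ¬ P x :=
  ⟨hP.2, hP.1.congr fun _ => not_not.symm⟩

theorem and (hP : PolyClopen P) (hQ : PolyClopen Q) : PolyClopen fun x => P x ∧ Q x :=
  ⟨hP.1.and hQ.1, (hP.2.or hQ.2).congr fun _ => not_and_or.symm⟩

theorem or (hP : PolyClopen P) (hQ : PolyClopen Q) : PolyClopen fun x => P x ∨ Q x :=
  ⟨hP.1.or hQ.1, (hP.2.and hQ.2).congr fun _ => not_or.symm⟩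

theorem imp (hP : PolyClopen P) (hQ : PolyClopen Q) : PolyClopen fun x => P x → Q x :=
  (hP.not.or hQ).congr fun _ => imp_iff_not_or.symm

theorem exists_mem {α : Type*} {s : Set α} (hs : s.Finite) {P : α → (ι → ℝ) → Prop}
    (h : ∀ a ∈ s, PolyClopen (P a)) : PolyClopen fun x => ∃ a ∈ s, P a x :=
  ⟨.exists_mem fun a ha => (h a ha).1,
    (PolyOpen.forall_mem hs fun a ha => (h a ha).2).congr fun x => by push Not; rfl⟩

theorem forall_mem {α : Type*} {s : Set α} (hs : s.Finite) {P : α → (ι → ℝ) → Prop}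
    (h : ∀ a ∈ s, PolyClopen (P a)) : PolyClopen fun x => ∀ a ∈ s, P a x :=
  ⟨.forall_mem hs fun a ha => (h a ha).1,
    (PolyOpen.exists_mem fun a ha => (h a ha).2).congr fun x => by push Not; rfl⟩

theorem lt (p q : MvPolynomial ι ℤ) : PolyClopen fun x => aeval x p < aeval x q :=
  ⟨.lt p q, (PolyOpen.le q p).congr fun _ => not_lt.symm⟩

theorem eq (p q : MvPolynomial ι ℤ) : PolyClopen fun x => aeval x p = aeval x q :=
  ⟨.eq p q, .ne p q⟩

end PolyClopen

end PolyOpen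

/-! ### Hereditarily finite sets as values of terms -/

namespace Lists'

variable {α : Type u} {β : Type v} {γ : Type w}

/-- Replaces the atoms of a prelist by their images under `f`. -/
def map (f : α → β) : ∀ {b : Bool}, Lists' α b → Lists' β b
  | _, atom a => atom (f a)
  | _, nil => nil
  | _, cons' a l => cons' (map f a) (map f l)

theorem map_map (g : β → γ) (f : α → β) {b : Bool} (l : Lists' α b) :
    map g (map f l) = map (g ∘ f) l := by
  induction l with
  | atom a => rfl
  | nil => rfl
  | cons' a l iha ihl => simp [map, iha, ihl]

theorem toList_map (f : α → β) {b : Bool} (l : Lists' α b) :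
    (map f l).toList = l.toList.map fun a => ⟨a.1, map f a.2⟩ := by
  induction l with
  | atom a => rfl
  | nil => rfl
  | @cons' c a l _ ihl => exact congrArg (List.cons (⟨c, map f a⟩ : Lists β)) ihl

theorem exists_mem_toList_map (f : α → β) {b : Bool} (l : Lists' α b) {P : Lists β → Prop} :
    (∃ a ∈ (map f l).toList, P a) ↔ ∃ a ∈ l.toList, P ⟨a.1, map f a.2⟩ := by
  rw [toList_map]
  constructor
  · rintro ⟨a, ha, h⟩
    obtain ⟨b, hb, rfl⟩ := List.mem_map.1 ha
    exact ⟨b, hb, h⟩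
  · rintro ⟨a, ha, h⟩
    exact ⟨_, List.mem_map.2 ⟨a, ha, rfl⟩, h⟩

theorem forall_mem_toList_map (f : α → β) {b : Bool} (l : Lists' α b) {P : Lists β → Prop} :
    (∀ a ∈ (map f l).toList, P a) ↔ ∀ a ∈ l.toList, P ⟨a.1, map f a.2⟩ := by
  rw [toList_map]
  constructor
  · exact fun h a ha => h _ (List.mem_map.2 ⟨a, ha, rfl⟩)
  · intro h a ha
    obtain ⟨b, hb, rfl⟩ := List.mem_map.1 ha
    exact h b hb

/-- The atoms that occur in a prelist. -/
def atoms : ∀ {b : Bool}, Lists' α b → Set α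
  | _, atom a => {a}
  | _, nil => ∅
  | _, cons' a l => atoms a ∪ atoms l

theorem finite_atoms {b : Bool} (l : Lists' α b) : l.atoms.Finite := by
  induction l with
  | atom a => exact Set.finite_singleton a
  | nil => exact Set.finite_empty
  | cons' a l iha ihl => exact iha.union ihl

theorem map_congr {f g : α → β} {b : Bool} {l : Lists' α b} (h : ∀ a ∈ l.atoms, f a = g a) :
    map f l = map g l := by
  induction l with
  | atom a => simp [map, h a rfl]
  | nil => rfl
  | cons' a l iha ihl =>
    simp only [map]
    rw [iha fun x hx => h x (Or.inl hx), ihl fun x hx => h x (Or.inr hx)]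

/-- Every prelist of elements of `β` arises from a prelist of natural numbers `≥ K`. -/
theorem exists_map_eq [Nonempty β] {b : Bool} (l : Lists' β b) (K : ℕ) :
    ∃ (K' : ℕ) (t : Lists' ℕ b) (y : ℕ → β), K ≤ K' ∧ (∀ i ∈ t.atoms, K ≤ i ∧ i < K') ∧
      map y t = l := by
  induction l generalizing K with
  | atom a => exact ⟨K + 1, atom K, fun _ => a, by omega, by simp [atoms], rfl⟩
  | nil => exact ⟨K, nil, fun _ => Classical.arbitrary β, le_rfl, by simp [atoms], rfl⟩
  | cons' a l iha ihl =>
    obtain ⟨K₁, t₁, y₁, h₁, h₁', rfl⟩ := iha K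
    obtain ⟨K₂, t₂, y₂, h₂, h₂', rfl⟩ := ihl K₁
    -- The variables of head and tail come from disjoint intervals, so the two valuations can be
    -- glued at `K₁`.
    refine ⟨K₂, cons' t₁ t₂, fun i => if i < K₁ then y₁ i else y₂ i, h₁.trans h₂, ?_, ?_⟩
    · rintro i (hi | hi)
      · have := h₁' i hi; omega
      · have := h₂' i hi; omega
    · simp only [map]
      congr 1
      · exact map_congr fun i hi => if_pos (h₁' i hi).2
      · exact map_congr fun i hi => if_neg (by have := h₂' i hi; omega)

/-- A code for a prelist of natural numbers. -/
def code : ∀ {b : Bool}, Lists' ℕ b → ℕ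
  | _, atom n => Nat.pair 0 n
  | _, nil => Nat.pair 1 0
  | _, cons' a l => Nat.pair 2 (Nat.pair (code a) (code l))

theorem code_injective : ∀ {b b' : Bool} (l : Lists' ℕ b) (l' : Lists' ℕ b'),
    code l = code l' → (⟨b, l⟩ : Lists ℕ) = ⟨b', l'⟩ := by
  intro b b' l
  induction l generalizing b' with
  | atom n =>
    intro l' h
    cases l' <;> simp_all [code, Nat.pair_eq_pair]
  | nil =>
    intro l' h
    cases l' <;> simp_all [code, Nat.pair_eq_pair]
  | cons' a l iha ihl =>
    intro l' h
    cases l' with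
    | atom => simp [code, Nat.pair_eq_pair] at h
    | nil => simp [code, Nat.pair_eq_pair] at h
    | cons' a' l' =>
      simp only [code, Nat.pair_eq_pair, true_and] at h
      have h₁ := iha a' h.1
      have h₂ := ihl l' h.2
      cases h₁
      cases h₂
      rfl

instance (b : Bool) : Countable (Lists' ℕ b) :=
  Function.Injective.countable (f := code) fun l l' h => by
    have := code_injective l l' h
    cases this
    rfl

end Lists'

namespace HFSets

variable {M : Type u} {α : Type v}

theorem mem_mk_iff (a : Lists M) (l : Lists' M true) :
    Mem (Quotient.mk _ a) (Quotient.mk _ (Lists.of' l)) ↔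
      ∃ a' ∈ l.toList, (Quotient.mk _ a : Finsets M) = Quotient.mk _ a' := by
  change (∃ a' ∈ l.toList, Lists.Equiv a a') ↔ _
  exact exists_congr fun a' => and_congr_right fun _ => (Quotient.eq (r := Lists.instSetoidLists)).symm

theorem mk_of'_eq_iff (l l' : Lists' M true) :
    (Quotient.mk _ (Lists.of' l) : Finsets M) = Quotient.mk _ (Lists.of' l') ↔
      (∀ a ∈ l.toList, ∃ a' ∈ l'.toList, (Quotient.mk _ a : Finsets M) = Quotient.mk _ a') ∧
      (∀ a' ∈ l'.toList, ∃ a ∈ l.toList, (Quotient.mk _ a' : Finsets M) = Quotient.mk _ a) := by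
  rw [Quotient.eq (r := Lists.instSetoidLists)]
  refine Lists.Equiv.antisymm_iff.trans (and_congr ?_ ?_)
  · exact Lists'.subset_def.trans (forall₂_congr fun a _ => mem_mk_iff a l')
  · exact Lists'.subset_def.trans (forall₂_congr fun a _ => mem_mk_iff a l)

theorem not_mem_atom (a : Finsets M) (x : M) : ¬ Mem a (atom x) := by
  induction a using Quotient.inductionOn with
  | h a => exact fun h => h

/-- The hereditarily finite set given by a prelist of atoms. -/
def ofLists (l : Lists' M true) : HF M := ⟨Quotient.mk _ (Lists.of' l), isSet_of' l⟩

theorem exists_ofLists (a : HF M) : ∃ l, ofLists l = a := by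
  obtain ⟨a, ha⟩ := a
  induction a using Quotient.inductionOn with
  | h a =>
    obtain ⟨b, a⟩ := a
    cases b
    · cases a with
      | atom x => exact (ha x rfl).elim
    · exact ⟨a, rfl⟩

theorem atom_injective : Function.Injective (atom : M → Finsets M) := by
  intro x y h
  have := (Lists.equiv_atom (a := x) (l := Lists.atom y)).1 (Quotient.exact h)
  cases this
  rfl

theorem isSet_mk (a : Lists M) : IsSet (Quotient.mk _ a : Finsets M) ↔ a.1 = true := by
  obtain ⟨b, a⟩ := a
  cases b
  · cases a with
    | atom x => exact iff_of_false (fun h => h x rfl) Bool.false_ne_true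
  · exact iff_of_true (isSet_of' a) rfl

theorem finite_mem (a : Finsets M) : {b | Mem b a}.Finite := by
  induction a using Quotient.inductionOn with
  | h a =>
    obtain ⟨c, a⟩ := a
    cases c
    · exact Set.finite_empty.subset fun b => by
        cases a with
        | atom x => exact not_mem_atom b x
    · refine (a.toList.finite_toSet.image (fun x => (Quotient.mk _ x : Finsets M))).subset ?_
      intro b hb
      induction b using Quotient.inductionOn with
      | h b =>
        obtain ⟨a', h, h'⟩ := (mem_mk_iff b a).1 hb
        exact ⟨a', h, h'.symm⟩

theorem finite_mem_hf (a : HF M) : {b : HF M | Mem b.1 a.1}.Finite :=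
  (finite_mem a.1).preimage Subtype.val_injective.injOn

/-- Every finite set of hereditarily finite sets is the set of those members of a hereditarily
finite set that are sets. -/
theorem exists_hf_of_finite (s : Set (HF M)) (hs : s.Finite) :
    ∃ a : HF M, ∀ b : HF M, Mem b.1 a.1 ↔ b ∈ s := by
  induction s, hs using Set.Finite.induction_on with
  | empty =>
    refine ⟨ofLists Lists'.nil, fun b => ?_⟩
    obtain ⟨l, rfl⟩ := exists_ofLists b
    exact (mem_mk_iff _ _).trans (by simp)
  | @insert c s _ _ ih =>
    obtain ⟨a, ha⟩ := ih
    obtain ⟨l, rfl⟩ := exists_ofLists a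
    obtain ⟨k, rfl⟩ := exists_ofLists c
    refine ⟨ofLists (Lists'.cons (Lists.of' k) l), fun b => ?_⟩
    rw [Set.mem_insert_iff, ← ha b]
    obtain ⟨b, rfl⟩ := exists_ofLists b
    have h := mem_mk_iff (Lists.of' b) (Lists'.cons (Lists.of' k) l)
    rw [Lists'.toList_cons] at h
    refine h.trans ?_
    rw [List.exists_mem_cons_iff]
    refine or_congr ?_ (mem_mk_iff (Lists.of' b) l).symm
    exact ⟨fun h => Subtype.ext h, fun h => congrArg Subtype.val h⟩

/-- The singleton `{x}` as an element of `HF(M)`. -/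
def singleton (x : M) : HF M := ⟨singletonAtom x, isSet_singletonAtom x⟩

theorem mem_singletonAtom (a : Finsets M) (x : M) : Mem a (singletonAtom x) ↔ a = atom x := by
  induction a using Quotient.inductionOn with
  | h a =>
    refine (mem_mk_iff a _).trans ?_
    rw [Lists'.toList_cons, Lists'.toList, List.exists_mem_cons_iff]
    exact ⟨fun h => h.resolve_right (by simp), Or.inl⟩

theorem singleton_injective : Function.Injective (singleton : M → HF M) := by
  intro x y h
  have h₁ : singletonAtom x = singletonAtom y := congrArg Subtype.val h
  have h₂ := (mem_singletonAtom (atom x) x).2 rfl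
  rw [h₁, mem_singletonAtom] at h₂
  exact atom_injective h₂

/-! ### Terms for hereditarily finite sets over the real numbers -/

section Terms

variable {ι : Type}

/-- The value of a prelist of variables under a valuation. -/
def evalLists (x : ι → ℝ) (a : Lists ι) : Finsets ℝ := Quotient.mk _ ⟨a.1, a.2.map x⟩

/-- The value of a proper prelist of variables under a valuation. -/
def evalHF (x : ι → ℝ) (t : Lists' ι true) : HF ℝ := ofLists (t.map x)

theorem evalHF_val (x : ι → ℝ) (t : Lists' ι true) :
    (evalHF x t).1 = evalLists x (Lists.of' t) := rfl

theorem evalHF_congr {x y : ι → ℝ} {t : Lists' ι true} (h : ∀ i ∈ t.atoms, x i = y i) :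
    evalHF x t = evalHF y t := by rw [evalHF, evalHF, Lists'.map_congr h]

theorem evalHF_map {κ : Type} (x : ι → ℝ) (r : κ → ι) (t : Lists' κ true) :
    evalHF x (t.map r) = evalHF (x ∘ r) t := by rw [evalHF, evalHF, Lists'.map_map]

theorem mem_evalLists_iff (a : Finsets ℝ) (x : ι → ℝ) (t : Lists' ι true) :
    Mem a (evalLists x (Lists.of' t)) ↔ ∃ t' ∈ t.toList, a = evalLists x t' := by
  induction a using Quotient.inductionOn with
  | h a =>
    refine (mem_mk_iff a (t.map x)).trans ?_
    exact Lists'.exists_mem_toList_map x t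

theorem mem_evalHF_iff (a : HF ℝ) (x : ι → ℝ) (t : Lists' ι true) :
    Mem a.1 (evalHF x t).1 ↔ ∃ t' : Lists' ι true, Lists.of' t' ∈ t.toList ∧ a = evalHF x t' := by
  rw [evalHF_val, mem_evalLists_iff]
  constructor
  · rintro ⟨⟨b, t'⟩, h, h'⟩
    have := a.2
    rw [h'] at this
    have hb : b = true := (isSet_mk _).1 this
    subst hb
    exact ⟨t', h, Subtype.ext h'⟩
  · rintro ⟨t', h, rfl⟩
    exact ⟨_, h, rfl⟩

/-- The first of the atoms that are members of a prelist, or `d` if there is none. -/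
def firstAtom (d : ι) : ∀ {b : Bool}, Lists' ι b → ι
  | _, .atom a => a
  | _, .nil => d
  | _, .cons' a _ => firstAtom d a

/-- If the value is `{y}`, every member of `t` has the value `y`, in particular the first one, which
must then be a variable. So a variable carrying the real number can be found from `t` alone, without
knowing the valuation. -/
theorem eq_firstAtom (d : ι) {x : ι → ℝ} {t : Lists' ι true} {y : ℝ}
    (h : evalHF x t = singleton y) : y = x (firstAtom d t) := by
  have h' : ∀ a, Mem a (evalLists x (Lists.of' t)) ↔ a = atom y := fun a => by
    rw [← mem_singletonAtom, ← evalHF_val, h]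
    rfl
  cases t with
  | nil =>
    have := (h' (atom y)).2 rfl
    rw [mem_evalLists_iff] at this
    simp at this
  | @cons' b a l =>
    have := (h' (evalLists x ⟨b, a⟩)).1 ((mem_evalLists_iff _ _ _).2 ⟨⟨b, a⟩, List.mem_cons_self, rfl⟩)
    cases b
    · cases a with
      | atom i => exact (atom_injective this).symm
    · exact ((isSet_mk _).2 rfl y this).elim

/-- By extensionality, equality of two values unwinds to a finite Boolean combination of equalities
between variables. Both inclusions recurse to a member of `a`, so induction on the size of `a` is
enough. -/
theorem polyClopen_evalLists_eq (a b : Lists ι) :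
    PolyClopen fun x => evalLists x a = evalLists x b := by
  have key : ∀ (n : ℕ) (a b : Lists ι), sizeOf a.2 ≤ n →
      PolyClopen fun x => evalLists x a = evalLists x b := by
    intro n
    induction n with
    | zero =>
      rintro ⟨_, a⟩ b h
      cases a <;> simp at h
    | succ n ih =>
      rintro ⟨c, a⟩ ⟨d, b⟩ h
      cases c <;> cases d
      · cases a with
        | atom i =>
          cases b with
          | atom j =>
            refine (PolyClopen.eq (MvPolynomial.X i) (MvPolynomial.X j)).congr fun x => ?_
            rw [MvPolynomial.aeval_X, MvPolynomial.aeval_X]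
            exact atom_injective.eq_iff.symm
      · cases a with
        | atom i =>
          exact (PolyClopen.const False).congr fun x =>
            ⟨False.elim, fun h => (isSet_of' (b.map x) (x i) h.symm).elim⟩
      · cases b with
        | atom j =>
          exact (PolyClopen.const False).congr fun x =>
            ⟨False.elim, fun h => (isSet_of' (a.map x) (x j) h).elim⟩
      · have hsz : ∀ {c : Bool} (l : Lists' ι c), ∀ a' ∈ l.toList, sizeOf a'.2 < sizeOf l := by
          intro c l
          induction l with
          | atom => simp
          | nil => simp
          | cons' e l _ ihl =>
            intro a' ha'
            rcases List.mem_cons.1 ha' with rfl | ha'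
            · simp only [Lists'.cons'.sizeOf_spec]; omega
            · have := ihl a' ha'
              simp only [Lists'.cons'.sizeOf_spec]; omega
        have ih' : ∀ a' ∈ {a' | a' ∈ a.toList}, ∀ b' : Lists ι,
            PolyClopen fun x => evalLists x a' = evalLists x b' := fun a' ha' b' =>
          ih a' b' (by have := hsz a a' ha'; simp only at h; omega)
        refine ((PolyClopen.forall_mem a.toList.finite_toSet fun a' ha' =>
          PolyClopen.exists_mem b.toList.finite_toSet fun b' _ => ih' a' ha' b').and
          (PolyClopen.forall_mem b.toList.finite_toSet fun b' _ =>
            PolyClopen.exists_mem a.toList.finite_toSet fun a' ha' =>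
              ih' a' ha' b')).congr fun x => ?_
        refine Iff.trans ?_ (mk_of'_eq_iff (a.map x) (b.map x)).symm
        simp only [Lists'.exists_mem_toList_map, Lists'.forall_mem_toList_map]
        exact and_congr Iff.rfl (forall₂_congr fun b' _ => exists_congr fun a' =>
          and_congr_right fun _ => eq_comm)
  exact key _ a b le_rfl

theorem polyClopen_evalHF_eq (s t : Lists' ι true) :
    PolyClopen fun x => evalHF x s = evalHF x t :=
  (polyClopen_evalLists_eq (Lists.of' s) (Lists.of' t)).congr fun _ =>
    ⟨fun h => Subtype.ext h, fun h => congrArg Subtype.val h⟩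

theorem finite_mem_toList (t : Lists' ι true) :
    {t' : Lists' ι true | Lists.of' t' ∈ t.toList}.Finite :=
  t.toList.finite_toSet.preimage (f := Lists.of') (by
    intro a _ b _ h
    cases h
    rfl)

end Terms

end HFSets

/-! ### Sets defined by Σ-formulas are polynomially open -/

namespace HFSets

section Realize

variable {L : FirstOrder.Language.{v, w}} {M : Type u} [L.Structure M] {α : Type} {n : ℕ}

theorem exists_term_eq_var (t : (hfLang L).Term (α ⊕ Fin n)) : ∃ i, t = Term.var i := by
  cases t with
  | var i => exact ⟨i, rfl⟩
  | func f => exact f.elim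

theorem realize_newMem (t : (hfLang L).Term (α ⊕ Fin n)) (v : α → HF M) (xs : Fin n → HF M)
    (a : HF M) : (newMem t).Realize v (Fin.snoc xs a) ↔
      Mem a.1 (t.realize (Sum.elim v xs)).1 := by
  obtain ⟨i, rfl⟩ := exists_term_eq_var t
  rw [newMem, BoundedFormula.realize_rel₂]
  change Mem _ _ ↔ _
  rcases i with i | i <;> simp

theorem realize_exMem (t : (hfLang L).Term (α ⊕ Fin n)) (φ : (hfLang L).BoundedFormula α (n + 1))
    (v : α → HF M) (xs : Fin n → HF M) : (exMem t φ).Realize v xs ↔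
      ∃ a : HF M, Mem a.1 (t.realize (Sum.elim v xs)).1 ∧ φ.Realize v (Fin.snoc xs a) := by
  simp only [exMem, BoundedFormula.realize_ex, BoundedFormula.realize_inf, realize_newMem]

theorem realize_allMem (t : (hfLang L).Term (α ⊕ Fin n)) (φ : (hfLang L).BoundedFormula α (n + 1))
    (v : α → HF M) (xs : Fin n → HF M) : (allMem t φ).Realize v xs ↔
      ∀ a : HF M, Mem a.1 (t.realize (Sum.elim v xs)).1 → φ.Realize v (Fin.snoc xs a) := by
  simp only [allMem, BoundedFormula.realize_all, BoundedFormula.realize_imp, realize_newMem]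

end Realize

open MvPolynomial in
-- A symbol of the field holds of the values of terms iff each value is a singleton, which is a
-- clopen condition, and a polynomial relation holds between the variables given by `firstAtom`.
theorem polyClopen_relMap {n : ℕ} (R : (hfLang ordFieldLang).Relations n)
    (t : Fin n → Lists' ℕ true) :
    PolyClopen fun x : ℕ → ℝ => Structure.RelMap R fun i => evalHF x (t i) := by
  have key : ∀ (k : ℕ) (t : Fin k → Lists' ℕ true) (P : (Fin k → ℝ) → Prop),
      (PolyClopen fun x : ℕ → ℝ => P fun i => x (firstAtom 0 (t i))) →
      PolyClopen fun x : ℕ → ℝ =>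
        ∃ y : Fin k → ℝ, (∀ i, (evalHF x (t i)).1 = singletonAtom (y i)) ∧ P y := by
    intro k t P hP
    refine (PolyClopen.and (PolyClopen.forall_mem (s := Set.univ) Set.finite_univ fun i _ =>
      polyClopen_evalHF_eq (t i)
        (Lists'.cons (Lists.atom (firstAtom 0 (t i))) Lists'.nil)) hP).congr fun x => ?_
    constructor
    · rintro ⟨h, hx⟩
      exact ⟨_, fun i => congrArg Subtype.val (h i trivial), hx⟩
    · rintro ⟨y, h, hy⟩
      have h' : ∀ i, y i = x (firstAtom 0 (t i)) := fun i =>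
        eq_firstAtom 0 (Subtype.ext (h i) : evalHF x (t i) = singleton (y i))
      obtain rfl : y = fun i => x (firstAtom 0 (t i)) := funext h'
      exact ⟨fun i _ => Subtype.ext (h i), hy⟩
  cases R with
  | mem =>
    refine (PolyClopen.exists_mem (finite_mem_toList (t 1)) fun t' _ =>
      polyClopen_evalHF_eq (t 0) t').congr fun x => ?_
    exact (mem_evalHF_iff _ _ _).symm
  | rel R =>
    cases R with
    | lt =>
      refine key 2 t (fun y => y 0 < y 1) ?_
      exact (PolyClopen.lt (X (firstAtom 0 (t 0))) (X (firstAtom 0 (t 1)))).congr (by simp)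
  | graph f =>
    cases f with
    | zero =>
      refine key 1 t (fun y => 0 = y 0) ?_
      exact (PolyClopen.eq 0 (X (firstAtom 0 (t 0)))).congr (by simp)
    | one =>
      refine key 1 t (fun y => 1 = y 0) ?_
      exact (PolyClopen.eq 1 (X (firstAtom 0 (t 0)))).congr (by simp)
    | add =>
      refine key 3 t (fun y => y 0 + y 1 = y 2) ?_
      exact (PolyClopen.eq (X (firstAtom 0 (t 0)) + X (firstAtom 0 (t 1)))
        (X (firstAtom 0 (t 2)))).congr (by simp)
    | mul =>
      refine key 3 t (fun y => y 0 * y 1 = y 2) ?_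
      exact (PolyClopen.eq (X (firstAtom 0 (t 0)) * X (firstAtom 0 (t 1)))
        (X (firstAtom 0 (t 2)))).congr (by simp)

variable {α : Type}

theorem snoc_evalHF {n : ℕ} (x : ℕ → ℝ) (σ : Fin n → Lists' ℕ true) (t : Lists' ℕ true) :
    (Fin.snoc (fun i => evalHF x (σ i)) (evalHF x t) : Fin (n + 1) → HF ℝ) =
      fun i => evalHF x ((Fin.snoc σ t : Fin (n + 1) → Lists' ℕ true) i) := by
  ext1 i
  refine Fin.lastCases ?_ (fun i => ?_) i <;> simp

theorem realize_term_eq_evalHF {n : ℕ} (t : (hfLang ordFieldLang).Term (α ⊕ Fin n))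
    (τ : α → Lists' ℕ true) (σ : Fin n → Lists' ℕ true) :
    ∃ s : Lists' ℕ true, ∀ x : ℕ → ℝ,
      t.realize (Sum.elim (fun a => evalHF x (τ a)) fun i => evalHF x (σ i)) = evalHF x s := by
  obtain ⟨i, rfl⟩ := exists_term_eq_var t
  exact ⟨Sum.elim τ σ i, fun x => by rcases i with i | i <;> rfl⟩

theorem exists_mem_evalHF_iff {n : ℕ} {φ : (hfLang ordFieldLang).BoundedFormula α (n + 1)}
    (s : Lists' ℕ true) (τ : α → Lists' ℕ true) (σ : Fin n → Lists' ℕ true) (x : ℕ → ℝ) :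
    (∃ a : HF ℝ, Mem a.1 (evalHF x s).1 ∧
      φ.Realize (fun a => evalHF x (τ a)) (Fin.snoc (fun i => evalHF x (σ i)) a)) ↔
    ∃ t ∈ {t | Lists.of' t ∈ s.toList}, φ.Realize (fun a => evalHF x (τ a))
      fun i => evalHF x ((Fin.snoc σ t : Fin (n + 1) → Lists' ℕ true) i) := by
  constructor
  · rintro ⟨a, ha, h⟩
    obtain ⟨t, ht, rfl⟩ := (mem_evalHF_iff _ _ _).1 ha
    exact ⟨t, ht, snoc_evalHF x σ t ▸ h⟩
  · rintro ⟨t, ht, h⟩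
    exact ⟨evalHF x t, (mem_evalHF_iff _ _ _).2 ⟨t, ht, rfl⟩, (snoc_evalHF x σ t).symm ▸ h⟩

theorem forall_mem_evalHF_iff {n : ℕ} {φ : (hfLang ordFieldLang).BoundedFormula α (n + 1)}
    (s : Lists' ℕ true) (τ : α → Lists' ℕ true) (σ : Fin n → Lists' ℕ true) (x : ℕ → ℝ) :
    (∀ a : HF ℝ, Mem a.1 (evalHF x s).1 →
      φ.Realize (fun a => evalHF x (τ a)) (Fin.snoc (fun i => evalHF x (σ i)) a)) ↔
    ∀ t ∈ {t | Lists.of' t ∈ s.toList}, φ.Realize (fun a => evalHF x (τ a))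
      fun i => evalHF x ((Fin.snoc σ t : Fin (n + 1) → Lists' ℕ true) i) := by
  have := (exists_mem_evalHF_iff (φ := ∼φ) s τ σ x).not
  simpa only [BoundedFormula.realize_not, not_exists, not_and, not_not] using this

/-- A quantifier bounded by the value of a term ranges over the values of its finitely many
immediate subterms that are proper lists. It is thus a finite disjunction or conjunction, and
clopenness survives. -/
theorem IsDelta0.polyClopen {n : ℕ} {φ : (hfLang ordFieldLang).BoundedFormula α n}
    (hφ : IsDelta0 φ) (τ : α → Lists' ℕ true) (σ : Fin n → Lists' ℕ true) :
    PolyClopen fun x : ℕ → ℝ =>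
      φ.Realize (fun a => evalHF x (τ a)) fun i => evalHF x (σ i) := by
  induction hφ with
  | atomic h =>
    cases h with
    | equal t₁ t₂ =>
      obtain ⟨s₁, h₁⟩ := realize_term_eq_evalHF t₁ τ σ
      obtain ⟨s₂, h₂⟩ := realize_term_eq_evalHF t₂ τ σ
      refine (polyClopen_evalHF_eq s₁ s₂).congr fun x => ?_
      rw [BoundedFormula.realize_bdEqual, h₁, h₂]
    | rel R ts =>
      choose s hs using fun i => realize_term_eq_evalHF (ts i) τ σ
      refine (polyClopen_relMap R s).congr fun x => ?_
      rw [BoundedFormula.realize_rel]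
      simp only [hs]
  | falsum => exact .const False
  | imp _ _ ih₁ ih₂ => exact (ih₁ σ).imp (ih₂ σ)
  | and _ _ ih₁ ih₂ => exact ((ih₁ σ).and (ih₂ σ)).congr fun x => BoundedFormula.realize_inf.symm
  | or _ _ ih₁ ih₂ => exact ((ih₁ σ).or (ih₂ σ)).congr fun x => BoundedFormula.realize_sup.symm
  | exMem t _ ih =>
    obtain ⟨s, hs⟩ := realize_term_eq_evalHF t τ σ
    refine (PolyClopen.exists_mem (finite_mem_toList s) fun t' _ => ih (Fin.snoc σ t')).congr
      fun x => ?_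
    rw [realize_exMem, hs, exists_mem_evalHF_iff]
  | allMem t _ ih =>
    obtain ⟨s, hs⟩ := realize_term_eq_evalHF t τ σ
    refine (PolyClopen.forall_mem (finite_mem_toList s) fun t' _ => ih (Fin.snoc σ t')).congr
      fun x => ?_
    rw [realize_allMem, hs, forall_mem_evalHF_iff]

/-- Projection along finitely many coordinates. -/
theorem _root_.PolyOpen.exists_agree {P : (ℕ → ℝ) → Prop} (hP : PolyOpen P) (K K' : ℕ) :
    PolyOpen fun x => ∃ y : ℕ → ℝ, (∀ i, i < K ∨ K' ≤ i → y i = x i) ∧ P y := by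
  induction K' with
  | zero =>
    refine hP.congr fun x => ⟨fun h => ⟨x, fun _ _ => rfl, h⟩, ?_⟩
    rintro ⟨y, hy, h⟩
    rwa [← funext fun i => hy i (Or.inr (Nat.zero_le i))]
  | succ k ih =>
    by_cases hk : K ≤ k
    · refine (ih.exists_update k).congr fun x => ⟨?_, ?_⟩
      · rintro ⟨z, y, hy, h⟩
        refine ⟨y, fun i hi => ?_, h⟩
        rw [hy i (by omega), Function.update_of_ne (by omega)]
      · rintro ⟨y, hy, h⟩
        refine ⟨y k, y, fun i hi => ?_, h⟩
        by_cases hik : i = k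
        · subst hik; simp
        · rw [Function.update_of_ne hik, hy i (by omega)]
    · refine hP.congr fun x => ⟨fun h => ⟨x, fun _ _ => rfl, h⟩, ?_⟩
      rintro ⟨y, hy, h⟩
      rwa [← funext fun i => hy i (by omega)]

theorem exists_bound_atoms {ι : Type} [Finite ι] (τ : ι → Lists' ℕ true) :
    ∃ K, ∀ a, ∀ i ∈ (τ a).atoms, i < K := by
  obtain ⟨K, hK⟩ := (Set.finite_iUnion fun a => (τ a).finite_atoms).bddAbove
  exact ⟨K + 1, fun a i hi => Nat.lt_succ_of_le (hK (Set.mem_iUnion.2 ⟨a, hi⟩))⟩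

theorem exists_evalHF_eq (a : HF ℝ) (K : ℕ) : ∃ (K' : ℕ) (t : Lists' ℕ true) (y : ℕ → ℝ),
    K ≤ K' ∧ (∀ i ∈ t.atoms, K ≤ i ∧ i < K') ∧ evalHF y t = a := by
  obtain ⟨l, rfl⟩ := exists_ofLists a
  obtain ⟨K', t, y, h, h', rfl⟩ := l.exists_map_eq K
  exact ⟨K', t, y, h, h', rfl⟩

/-- For the unbounded quantifier, a witness is the value of some term `t` whose variables lie in an
interval `[K, K')` above all variables in use. For fixed `t` and `K'` this is a projection along
these coordinates, and the union over all pairs `(K', t)` is open. Openness of the complement is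
lost here. -/
theorem IsSigma.polyOpen [Finite α] {n : ℕ} {φ : (hfLang ordFieldLang).BoundedFormula α n}
    (hφ : IsSigma φ) (τ : α → Lists' ℕ true) (σ : Fin n → Lists' ℕ true) :
    PolyOpen fun x : ℕ → ℝ =>
      φ.Realize (fun a => evalHF x (τ a)) fun i => evalHF x (σ i) := by
  induction hφ with
  | delta0 h => exact (h.polyClopen τ σ).1
  | and _ _ ih₁ ih₂ => exact ((ih₁ σ).and (ih₂ σ)).congr fun x => BoundedFormula.realize_inf.symm
  | or _ _ ih₁ ih₂ => exact ((ih₁ σ).or (ih₂ σ)).congr fun x => BoundedFormula.realize_sup.symm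
  | exMem t _ ih =>
    obtain ⟨s, hs⟩ := realize_term_eq_evalHF t τ σ
    refine (PolyOpen.exists_mem (s := {t' | Lists.of' t' ∈ s.toList})
      fun t' _ => ih (Fin.snoc σ t')).congr fun x => ?_
    rw [realize_exMem, hs, exists_mem_evalHF_iff]
  | allMem t _ ih =>
    obtain ⟨s, hs⟩ := realize_term_eq_evalHF t τ σ
    refine (PolyOpen.forall_mem (finite_mem_toList s) fun t' _ => ih (Fin.snoc σ t')).congr
      fun x => ?_
    rw [realize_allMem, hs, forall_mem_evalHF_iff]
  | @ex n φ _ ih =>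
    obtain ⟨K₁, hK₁⟩ := exists_bound_atoms τ
    obtain ⟨K₂, hK₂⟩ := exists_bound_atoms σ
    set K := max K₁ K₂ with hK
    refine (PolyOpen.exists' fun q : ℕ × Lists' ℕ true =>
      (ih (Fin.snoc σ q.2)).exists_agree K q.1).congr fun x => ?_
    have hτ : ∀ y : ℕ → ℝ, (∀ i, i < K → y i = x i) →
        (fun a => evalHF y (τ a)) = fun a => evalHF x (τ a) := fun y hy =>
      funext fun a => evalHF_congr fun i hi => hy i ((hK₁ a i hi).trans_le (le_max_left _ _))
    have hσ : ∀ y : ℕ → ℝ, (∀ i, i < K → y i = x i) →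
        (fun a => evalHF y (σ a)) = fun a => evalHF x (σ a) := fun y hy =>
      funext fun a => evalHF_congr fun i hi => hy i ((hK₂ a i hi).trans_le (le_max_right _ _))
    rw [BoundedFormula.realize_ex]
    constructor
    · rintro ⟨⟨K', t⟩, y, hy, h⟩
      have hy' : ∀ i, i < K → y i = x i := fun i hi => hy i (Or.inl hi)
      refine ⟨evalHF y t, ?_⟩
      rw [← snoc_evalHF, hτ y hy', hσ y hy'] at h
      exact h
    · rintro ⟨a, h⟩
      obtain ⟨K', t, y, hKK', ht, rfl⟩ := exists_evalHF_eq a K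
      set y' : ℕ → ℝ := fun i => if K ≤ i ∧ i < K' then y i else x i with hy'
      have hyx : ∀ i, i < K → y' i = x i := fun i hi => if_neg (by omega)
      refine ⟨(K', t), y', fun i hi => if_neg (by dsimp only at hi; omega), ?_⟩
      rw [← snoc_evalHF, hτ y' hyx, hσ y' hyx,
        show evalHF y' t = evalHF y t from evalHF_congr fun i hi => if_pos (ht i hi)]
      exact h

end HFSets

/-! ### A machine that interprets a stream of instructions -/

namespace BSS

open MvPolynomial

/-- The registers of the interpreter: the position `pos` on the tape, a product `prod`, a sum `sum`
and a flag `flag`. -/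
structure Regs where
  pos : ℤ
  prod : ℝ
  sum : ℝ
  flag : ℝ

/-- The effect of the first seven instructions on the registers, where `X` is the tape. -/
noncomputable def exec (X : ℤ → ℝ) : Fin 9 → Regs → Regs
  | 0, st => { st with pos := st.pos + 1 }
  | 1, st => { st with pos := st.pos - 1 }
  | 2, st => { st with prod := 1 }
  | 3, st => { st with prod := st.prod * X (st.pos + 1) }
  | 4, st => { st with sum := st.sum + st.prod }
  | 5, st => { st with sum := st.sum - st.prod }
  | 6, st => { st with sum := 0, flag := if 0 ≤ st.sum then st.flag else 0 }
  | _, st => st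

/-- The effect of a list of instructions. -/
noncomputable def execList (X : ℤ → ℝ) (w : List (Fin 9)) (st : Regs) : Regs :=
  w.foldl (fun st d => exec X d st) st

theorem execList_append (X : ℤ → ℝ) (w w' : List (Fin 9)) (st : Regs) :
    execList X (w ++ w') st = execList X w' (execList X w st) := List.foldl_append

/-! #### Compilation of polynomials -/

theorem execList_replicate_zero (X : ℤ → ℝ) (n : ℕ) (st : Regs) :
    execList X (List.replicate n 0) st = { st with pos := st.pos + n } := by
  induction n generalizing st with
  | zero => simp [execList]
  | succ n ih =>
    rw [List.replicate_succ]
    refine (ih _).trans ?_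
    simp only [exec, Nat.cast_succ]
    congr 1
    ring

theorem execList_replicate_one (X : ℤ → ℝ) (n : ℕ) (st : Regs) :
    execList X (List.replicate n 1) st = { st with pos := st.pos - n } := by
  induction n generalizing st with
  | zero => simp [execList]
  | succ n ih =>
    rw [List.replicate_succ]
    refine (ih _).trans ?_
    simp only [exec, Nat.cast_succ]
    congr 1
    ring

theorem execList_replicate_four (X : ℤ → ℝ) (n : ℕ) (st : Regs) :
    execList X (List.replicate n 4) st = { st with sum := st.sum + n * st.prod } := by
  induction n generalizing st with
  | zero => simp [execList]
  | succ n ih =>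
    rw [List.replicate_succ]
    refine (ih _).trans ?_
    simp only [exec, Nat.cast_succ]
    congr 1
    ring

theorem execList_replicate_five (X : ℤ → ℝ) (n : ℕ) (st : Regs) :
    execList X (List.replicate n 5) st = { st with sum := st.sum - n * st.prod } := by
  induction n generalizing st with
  | zero => simp [execList]
  | succ n ih =>
    rw [List.replicate_succ]
    refine (ih _).trans ?_
    simp only [exec, Nat.cast_succ]
    congr 1
    ring

/-- Programs without verdicts. -/
def Plain (w : List (Fin 9)) : Prop := ∀ d ∈ w, d < 7

theorem Plain.append {w w' : List (Fin 9)} (h : Plain w) (h' : Plain w') : Plain (w ++ w') :=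
  fun d hd => (List.mem_append.1 hd).elim (h d) (h' d)

theorem plain_replicate {d : Fin 9} (hd : d < 7) (n : ℕ) : Plain (List.replicate n d) :=
  fun _ h => List.eq_of_mem_replicate h ▸ hd

theorem exists_walk (i j : ℤ) : ∃ w, Plain w ∧ ∀ (X : ℤ → ℝ) (st : Regs), st.pos = i →
    execList X w st = { st with pos := j } := by
  rcases le_total i j with h | h
  · obtain ⟨n, rfl⟩ := Int.le.dest h
    refine ⟨List.replicate n 0, plain_replicate (by decide) n, fun X st hst => ?_⟩
    rw [execList_replicate_zero, hst]
  · obtain ⟨n, hn⟩ := Int.le.dest h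
    refine ⟨List.replicate n 1, plain_replicate (by decide) n, fun X st hst => ?_⟩
    rw [execList_replicate_one, hst, ← hn]
    simp

/-- There is a program that multiplies by the value of `p`. -/
def Mulable (p : MvPolynomial ℤ ℤ) : Prop :=
  ∃ w, Plain w ∧ ∀ (X : ℤ → ℝ) (st : Regs), st.pos = 0 →
    execList X w st = { st with prod := st.prod * aeval X p }

theorem mulable_one : Mulable 1 := ⟨[], by simp [Plain], fun X st _ => by simp [execList]⟩

theorem Mulable.mul {p q : MvPolynomial ℤ ℤ} (hp : Mulable p) (hq : Mulable q) :
    Mulable (p * q) := by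
  obtain ⟨w, hw, h⟩ := hp
  obtain ⟨w', hw', h'⟩ := hq
  refine ⟨w ++ w', hw.append hw', fun X st h0 => ?_⟩
  rw [execList_append, h X st h0]
  refine (h' X { st with prod := st.prod * aeval X p } h0).trans ?_
  rw [map_mul, mul_assoc]

theorem mulable_X (i : ℤ) : Mulable (X i) := by
  -- The multiplication instruction reads the cell to the right of the position, hence `i - 1`.
  obtain ⟨w₁, hw₁, h₁⟩ := exists_walk 0 (i - 1)
  obtain ⟨w₂, hw₂, h₂⟩ := exists_walk (i - 1) 0
  refine ⟨w₁ ++ ([3] ++ w₂), hw₁.append (Plain.append (by simp [Plain]) hw₂), fun Y st h0 => ?_⟩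
  rw [execList_append, execList_append, h₁ Y st h0, h₂ Y _ rfl, aeval_X]
  simp [execList, exec, h0]

theorem mulable_monomial (u : ℤ →₀ ℕ) : Mulable (monomial u 1) := by
  rw [monomial_eq, C_1, one_mul, Finsupp.prod]
  refine Finset.prod_induction _ Mulable (fun _ _ => Mulable.mul) mulable_one fun i _ => ?_
  induction u i with
  | zero => simpa using mulable_one
  | succ n ih =>
    rw [pow_succ]
    exact ih.mul (mulable_X i)

/-- Integer coefficients are realized by repeated addition or subtraction of the product register,
so a finite word over the instruction alphabet suffices and no constants are needed. The product
register is left with an unspecified value. -/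
theorem exists_add_program (p : MvPolynomial ℤ ℤ) :
    ∃ w, Plain w ∧ ∀ (X : ℤ → ℝ) (st : Regs), st.pos = 0 →
      ∃ m, execList X w st = { st with prod := m, sum := st.sum + aeval X p } := by
  induction p using MvPolynomial.induction_on' with
  | monomial u a =>
    obtain ⟨w, hw, h⟩ := mulable_monomial u
    have ha : ∀ X : ℤ → ℝ, aeval X (monomial u a) = a * aeval X (monomial u (1 : ℤ)) := fun X => by
      simp [aeval_monomial]
    rcases Int.eq_nat_or_neg a with ⟨n, rfl | rfl⟩
    · refine ⟨[2] ++ (w ++ List.replicate n 4), Plain.append (by simp [Plain])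
        (hw.append (plain_replicate (by decide) n)), fun X st h0 => ?_⟩
      refine ⟨aeval X (monomial u (1 : ℤ)), ?_⟩
      rw [execList_append, execList_append, h X (execList X [2] st) h0, execList_replicate_four, ha]
      simp [execList, exec]
    · refine ⟨[2] ++ (w ++ List.replicate n 5), Plain.append (by simp [Plain])
        (hw.append (plain_replicate (by decide) n)), fun X st h0 => ?_⟩
      refine ⟨aeval X (monomial u (1 : ℤ)), ?_⟩
      rw [execList_append, execList_append, h X (execList X [2] st) h0, execList_replicate_five, ha]
      simp [execList, exec, sub_eq_add_neg]
  | add p q hp hq =>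
    obtain ⟨w, hw, h⟩ := hp
    obtain ⟨w', hw', h'⟩ := hq
    refine ⟨w ++ w', hw.append hw', fun X st h0 => ?_⟩
    obtain ⟨m, hm⟩ := h X st h0
    obtain ⟨m', hm'⟩ := h' X (execList X w st) (by rw [hm]; exact h0)
    refine ⟨m', ?_⟩
    rw [execList_append, hm', hm, map_add, add_assoc]

open Classical in
/-- There is a program that tests whether the values of all `p ∈ F` are non-negative. -/
theorem exists_test_program (F : List (MvPolynomial ℤ ℤ)) :
    ∃ w, Plain w ∧ ∀ (X : ℤ → ℝ) (st : Regs), st.pos = 0 → st.sum = 0 →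
      ∃ m, execList X w st =
        { st with prod := m, flag := if ∀ p ∈ F, 0 ≤ aeval X p then st.flag else 0 } := by
  induction F with
  | nil => exact ⟨[], by simp [Plain], fun X st _ _ => ⟨st.prod, by simp [execList]⟩⟩
  | cons p F ih =>
    obtain ⟨w, hw, h⟩ := exists_add_program p
    obtain ⟨w', hw', h'⟩ := ih
    refine ⟨w ++ ([6] ++ w'), hw.append (Plain.append (by simp [Plain]) hw'), fun X st h0 h1 => ?_⟩
    obtain ⟨m, hm⟩ := h X st h0
    obtain ⟨m', hm'⟩ := h' X (exec X 6 (execList X w st)) (by rw [hm]; exact h0) rfl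
    refine ⟨m', ?_⟩
    rw [execList_append, execList_append]
    refine hm'.trans ?_
    rw [hm]
    simp only [exec, h1, zero_add, List.forall_mem_cons]
    by_cases hp : 0 ≤ aeval X p <;> by_cases hF : ∀ q ∈ F, 0 ≤ aeval X q <;> simp [hp, hF]

end BSS

/-! ### The interpreter as a Blum–Shub–Smale machine -/

namespace BSS

open MvPolynomial

/-- A computation node that performs finitely many simultaneous polynomial assignments. -/
noncomputable def assign {Q : Type} (l : List (ℤ × MvPolynomial ℤ ℝ)) (next : Q) : Node Q :=
  .computation (l.map Prod.fst).toFinset (fun i => (l.lookup i).getD 0) (fun _ => 1) next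

/-- The effect of `assign` on the tape. -/
noncomputable def assignTape (l : List (ℤ × MvPolynomial ℤ ℝ)) (x : Tape) : Tape :=
  ratMap (l.map Prod.fst).toFinset (fun i => (l.lookup i).getD 0) (fun _ => 1) x

theorem assignTape_apply (l : List (ℤ × MvPolynomial ℤ ℝ)) (x : Tape) (i : ℤ) :
    assignTape l x i = ((l.lookup i).map (eval x)).getD (x i) := by
  have h : assignTape l x i = if i ∈ (l.map Prod.fst).toFinset then
    eval x ((l.lookup i).getD 0) / eval x (1 : MvPolynomial ℤ ℝ) else x i := rfl
  rw [h]
  have key : i ∈ (l.map Prod.fst).toFinset ↔ (l.lookup i).isSome := by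
    induction l with
    | nil => simp
    | cons a l ih =>
      rw [List.map_cons, List.toFinset_cons, Finset.mem_insert, ih rfl, List.lookup_cons]
      by_cases h : i = a.1
      · simp [h]
      · rw [beq_eq_false_iff_ne.2 h, or_iff_right h]
  by_cases hi : i ∈ (l.map Prod.fst).toFinset
  · rw [if_pos hi]
    obtain ⟨p, hp⟩ := Option.isSome_iff_exists.1 (key.1 hi)
    simp [hp]
  · rw [if_neg hi]
    have := mt key.2 hi
    rw [Option.not_isSome_iff_eq_none] at this
    simp [this]

theorem assignTape_nil (x : Tape) (i : ℤ) : assignTape [] x i = x i := by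
  simp [assignTape_apply]

theorem assignTape_cons (j : ℤ) (p : MvPolynomial ℤ ℝ) (l : List (ℤ × MvPolynomial ℤ ℝ)) (x : Tape)
    (i : ℤ) : assignTape ((j, p) :: l) x i = if i = j then eval x p else assignTape l x i := by
  rw [assignTape_apply, assignTape_apply, List.lookup_cons]
  by_cases h : i = j
  · simp [h]
  · rw [if_neg h, beq_eq_false_iff_ne.2 h]

/-- The nodes of the interpreter. -/
inductive UNode : Type
  | start | mark | walk | look | init | fetch | moveRight | moveLeft | test | clear | fail | reset
  | halt
  | dec (d : Fin 9)
  | exe (d : Fin 9)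
  | verdict (b : Bool)
  | out (b : Bool)

theorem UNode.finite : Finite UNode := by
  let f : (Fin 13 × Fin 9) ⊕ ((Fin 9 ⊕ Fin 9) ⊕ (Bool ⊕ Bool)) → UNode := fun
    | .inl (0, _) => start | .inl (1, _) => mark | .inl (2, _) => walk | .inl (3, _) => look
    | .inl (4, _) => init | .inl (5, _) => fetch | .inl (6, _) => moveRight
    | .inl (7, _) => moveLeft | .inl (8, _) => test | .inl (9, _) => clear | .inl (10, _) => fail
    | .inl (11, _) => reset | .inl (12, _) => halt
    | .inr (.inl (.inl d)) => dec d | .inr (.inl (.inr d)) => exe d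
    | .inr (.inr (.inl b)) => verdict b | .inr (.inr (.inr b)) => out b
  refine Finite.of_surjective f fun q => ?_
  cases q with
  | start => exact ⟨.inl (0, 0), rfl⟩
  | mark => exact ⟨.inl (1, 0), rfl⟩
  | walk => exact ⟨.inl (2, 0), rfl⟩
  | look => exact ⟨.inl (3, 0), rfl⟩
  | init => exact ⟨.inl (4, 0), rfl⟩
  | fetch => exact ⟨.inl (5, 0), rfl⟩
  | moveRight => exact ⟨.inl (6, 0), rfl⟩
  | moveLeft => exact ⟨.inl (7, 0), rfl⟩
  | test => exact ⟨.inl (8, 0), rfl⟩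
  | clear => exact ⟨.inl (9, 0), rfl⟩
  | fail => exact ⟨.inl (10, 0), rfl⟩
  | reset => exact ⟨.inl (11, 0), rfl⟩
  | halt => exact ⟨.inl (12, 0), rfl⟩
  | dec d => exact ⟨.inr (.inl (.inl d)), rfl⟩
  | exe d => exact ⟨.inr (.inl (.inr d)), rfl⟩
  | verdict b => exact ⟨.inr (.inr (.inl b)), rfl⟩
  | out b => exact ⟨.inr (.inr (.inr b)), rfl⟩

/-- The node that executes an instruction. -/
noncomputable def exeNode : Fin 9 → Node UNode
  -- To move along the tape, the registers swap places with a neighbouring cell: they are written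
  -- one place further on, the displaced cell is put on their other side, and a shift brings them
  -- back to the places `-3, …, 0`. The instruction number is subtracted from the stream register in
  -- every case; here it is `0`.
  | 0 => assign [(-3, X 1), (-2, X (-3)), (-1, X (-2)), (0, X (-1)), (1, X 0)] .moveRight
  | 1 => assign [(-4, X (-3) - 1), (-3, X (-2)), (-2, X (-1)), (-1, X 0), (0, X (-4))] .moveLeft
  | 2 => assign [(-3, X (-3) - C 2), (-2, 1)] .fetch
  | 3 => assign [(-3, X (-3) - C 3), (-2, X (-2) * X 1)] .fetch
  | 4 => assign [(-3, X (-3) - C 4), (-1, X (-1) + X (-2))] .fetch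
  | 5 => assign [(-3, X (-3) - C 5), (-1, X (-1) - X (-2))] .fetch
  | 6 => assign [(-3, X (-3) - C 6)] .test
  | 7 => assign [(-3, X (-3) - C 7)] (.verdict true)
  | 8 => assign [(-3, X (-3) - C 8)] (.verdict false)

/-- The values written when the interpreter is initialized: the registers at the places
`-3, …, 0`, and the parameters `r` to the left of them. -/
noncomputable def initVal (ω : ℝ) (r : ℕ → ℝ) (i : ℤ) : ℝ :=
  if i = -3 then ω else if i = 0 then 1 else if i ≤ -4 then r (-4 - i).toNat else 0

/-- The interpreter for the stream of instructions coded by the real number `ω`, with parameters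
`r`. -/
noncomputable def interpreter (ω : ℝ) (r : ℕ → ℝ) (K : ℕ) (b₀ : Bool) : Machine where
  Q := UNode
  finite := UNode.finite
  start := .start
  node
    | .start => .branch (X 0 - C (1 / 2)) (.out b₀) .mark
    | .mark => assign [(0, 0)] .walk
    | .walk => .shiftRight .look
    | .look => .branch (X 0 - C (1 / 2)) .init .walk
    | .init => .computation (Finset.Icc (-3 - K) 0) (fun i => C (initVal ω r i)) (fun _ => 1) .fetch
    | .fetch => assign [(-3, C 10 * X (-3))] (.dec 0)
    -- After multiplication by `10` the stream register is the next digit plus a remainder in `[0,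
    -- 1)`. The digit is found by comparing with `1, 2, …` in turn.
    | .dec d => .branch (X (-3) - C ((d : ℕ) + 1 : ℝ)) (.exe d) (.dec (d + 1))
    | .exe d => exeNode d
    | .moveRight => .shiftLeft .fetch
    | .moveLeft => .shiftRight .fetch
    | .test => .branch (X (-1)) .fail .clear
    | .clear => assign [(-1, 0)] .fetch
    | .fail => assign [(-1, 0), (0, 0)] .fetch
    | .verdict b => .branch (X 0 - C (1 / 2)) .reset (.out b)
    | .reset => assign [(0, 1)] .fetch
    | .out b => assign [(-1, 0), (0, 1), (1, C (if b then 1 else 0))] .halt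
    | .halt => .output

section Steps

variable {T : Machine} {q : T.Q} {x : Tape}

theorem step_assign {l : List (ℤ × MvPolynomial ℤ ℝ)} {next : T.Q} (h : T.node q = assign l next) :
    T.Step (q, x) (next, assignTape l x) := by
  rw [Machine.Step, h]
  exact ⟨fun i _ => by simp, rfl⟩

theorem step_branch_nonneg {p : MvPolynomial ℤ ℝ} {q₀ q₁ : T.Q} (h : T.node q = .branch p q₀ q₁)
    (hp : 0 ≤ eval x p) : T.Step (q, x) (q₁, x) := by
  rw [Machine.Step, h]
  exact Or.inl ⟨hp, rfl⟩

theorem step_branch_neg {p : MvPolynomial ℤ ℝ} {q₀ q₁ : T.Q} (h : T.node q = .branch p q₀ q₁)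
    (hp : eval x p < 0) : T.Step (q, x) (q₀, x) := by
  rw [Machine.Step, h]
  exact Or.inr ⟨hp, rfl⟩

theorem step_shiftLeft {next : T.Q} (h : T.node q = .shiftLeft next) :
    T.Step (q, x) (next, shiftL x) := by
  rw [Machine.Step, h]

theorem step_shiftRight {next : T.Q} (h : T.node q = .shiftRight next) :
    T.Step (q, x) (next, shiftR x) := by
  rw [Machine.Step, h]

end Steps

/-- The tape holds the registers, and the cells of `Y` to the left and to the right of them. -/
structure Holds (Y : ℤ → ℝ) (ω : ℝ) (st : Regs) (x : Tape) : Prop where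
  stream : x (-3) = ω
  prod : x (-2) = st.prod
  sum : x (-1) = st.sum
  flag : x 0 = st.flag
  right : ∀ i, 1 ≤ i → x i = Y (st.pos + i)
  left : ∀ i, i ≤ -4 → x i = Y (st.pos + 4 + i)

section Interpreter

variable {ω₀ : ℝ} {r : ℕ → ℝ} {K : ℕ} {b₀ : Bool}

local notation "Reach" => Relation.ReflTransGen (Machine.Step (interpreter ω₀ r K b₀))

theorem reach_exe {Y : ℤ → ℝ} {ω : ℝ} {st : Regs} {x : Tape} {d : Fin 9} (hω : 0 ≤ ω) (hω' : ω < 1)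
    (h : Holds Y ((d + ω) / 10) st x) :
    ∃ x', Holds Y (d + ω) st x' ∧ Reach (UNode.fetch, x) (UNode.exe d, x') := by
  set x' := assignTape [(-3, C 10 * X (-3))] x with hx'
  have hx : ∀ i, x' i = if i = -3 then 10 * x (-3) else x i := by
    intro i
    rw [hx', assignTape_cons, assignTape_nil]
    simp
  have h' : Holds Y (d + ω) st x' := by
    refine ⟨?_, ?_, ?_, ?_, fun i hi => ?_, fun i hi => ?_⟩
    · rw [hx, if_pos rfl, h.stream]; ring
    · rw [hx, if_neg (by decide), h.prod]
    · rw [hx, if_neg (by decide), h.sum]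
    · rw [hx, if_neg (by decide), h.flag]
    · rw [hx, if_neg (by omega), h.right i hi]
    · rw [hx, if_neg (by omega), h.left i hi]
  refine ⟨x', h', ?_⟩
  have h₀ : Reach (UNode.fetch, x) (UNode.dec 0, x') := .single (step_assign rfl)
  have key : ∀ (j : ℕ) (hj : j ≤ d), Reach (UNode.fetch, x) (UNode.dec ⟨j, by omega⟩, x') := by
    intro j
    induction j with
    | zero => exact fun _ => h₀
    | succ j ih =>
      intro hj
      refine (ih (by omega)).tail ?_
      have e : (⟨j + 1, by omega⟩ : Fin 9) = ⟨j, by omega⟩ + 1 := by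
        ext
        rw [Fin.val_add_one_of_lt' (by simp only; omega)]
      rw [e]
      refine step_branch_nonneg rfl ?_
      have : ((j + 1 : ℕ) : ℝ) ≤ ((d : ℕ) : ℝ) := by exact_mod_cast hj
      simp only [map_sub, eval_X, eval_C, h'.stream]
      push_cast at this
      linarith
  refine (key d le_rfl).tail (step_branch_neg rfl ?_)
  simp only [map_sub, eval_X, eval_C, h'.stream]
  linarith

/-- One instruction consumes one digit. The strict bound `ω < 1` on the remaining stream ensures
that the decoding loop stops at the right digit. -/
theorem reach_exec {Y : ℤ → ℝ} {ω : ℝ} {st : Regs} {x : Tape} {d : Fin 9} (hd : d < 7)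
    (hω : 0 ≤ ω) (hω' : ω < 1) (h : Holds Y ((d + ω) / 10) st x) :
    ∃ x', Holds Y ω (exec Y d st) x' ∧ Reach (UNode.fetch, x) (UNode.fetch, x') := by
  obtain ⟨x₁, h₁, hr⟩ := reach_exe (r := r) (K := K) (b₀ := b₀) (ω₀ := ω₀) hω hω' h
  obtain ⟨e₃, e₂, e₁, e₀, er, el⟩ := h₁
  have hs : ∀ {l : List (ℤ × MvPolynomial ℤ ℝ)} {next : UNode}, exeNode d = assign l next →
      Reach (UNode.fetch, x) (next, assignTape l x₁) := fun h =>
    hr.tail (step_assign h)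
  have hcases : ∀ d : Fin 9, d < 7 → d = 0 ∨ d = 1 ∨ d = 2 ∨ d = 3 ∨ d = 4 ∨ d = 5 ∨ d = 6 := by
    decide
  rcases hcases d hd with rfl | rfl | rfl | rfl | rfl | rfl | rfl
  · refine ⟨_, ?_, (hs rfl).tail (step_shiftLeft rfl)⟩
    refine ⟨?_, ?_, ?_, ?_, fun i hi => ?_, fun i hi => ?_⟩ <;>
      simp only [shiftL_apply, assignTape_cons, assignTape_nil, exec]
    · simp [e₃]
    · simp [e₂]
    · simp [e₁]
    · simp [e₀]
    · rw [if_neg (by omega), if_neg (by omega), if_neg (by omega), if_neg (by omega),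
        if_neg (by omega), er _ (by omega)]
      congr 1; ring
    · by_cases hi' : i = -4
      · subst hi'
        simp [er 1 le_rfl]
      · rw [if_neg (by omega), if_neg (by omega), if_neg (by omega), if_neg (by omega),
          if_neg (by omega), el _ (by omega)]
        congr 1; ring
  · refine ⟨_, ?_, (hs rfl).tail (step_shiftRight rfl)⟩
    refine ⟨?_, ?_, ?_, ?_, fun i hi => ?_, fun i hi => ?_⟩ <;>
      simp only [shiftR_apply, assignTape_cons, assignTape_nil, exec]
    · simp [e₃]
    · simp [e₂]
    · simp [e₁]
    · simp [e₀]
    · by_cases hi' : i = 1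
      · subst hi'
        simp [el (-4) le_rfl]
      · rw [if_neg (by omega), if_neg (by omega), if_neg (by omega), if_neg (by omega),
          if_neg (by omega), er _ (by omega)]
        congr 1; ring
    · rw [if_neg (by omega), if_neg (by omega), if_neg (by omega), if_neg (by omega),
        if_neg (by omega), el _ (by omega)]
      congr 1; ring
  · refine ⟨_, ?_, hs rfl⟩
    refine ⟨?_, ?_, ?_, ?_, fun i hi => ?_, fun i hi => ?_⟩ <;>
      simp only [assignTape_cons, assignTape_nil, exec]
    · simp [e₃]
    · simp
    · simp [e₁]
    · simp [e₀]
    · rw [if_neg (by omega), if_neg (by omega), er i hi]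
    · rw [if_neg (by omega), if_neg (by omega), el i hi]
  · refine ⟨_, ?_, hs rfl⟩
    refine ⟨?_, ?_, ?_, ?_, fun i hi => ?_, fun i hi => ?_⟩ <;>
      simp only [assignTape_cons, assignTape_nil, exec]
    · simp [e₃]
    · simp [e₂, er 1 le_rfl]
    · simp [e₁]
    · simp [e₀]
    · rw [if_neg (by omega), if_neg (by omega), er i hi]
    · rw [if_neg (by omega), if_neg (by omega), el i hi]
  · refine ⟨_, ?_, hs rfl⟩
    refine ⟨?_, ?_, ?_, ?_, fun i hi => ?_, fun i hi => ?_⟩ <;>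
      simp only [assignTape_cons, assignTape_nil, exec]
    · simp [e₃]
    · simp [e₂]
    · simp [e₁, e₂]
    · simp [e₀]
    · rw [if_neg (by omega), if_neg (by omega), er i hi]
    · rw [if_neg (by omega), if_neg (by omega), el i hi]
  · refine ⟨_, ?_, hs rfl⟩
    refine ⟨?_, ?_, ?_, ?_, fun i hi => ?_, fun i hi => ?_⟩ <;>
      simp only [assignTape_cons, assignTape_nil, exec]
    · simp [e₃]
    · simp [e₂]
    · simp [e₁, e₂]
    · simp [e₀]
    · rw [if_neg (by omega), if_neg (by omega), er i hi]
    · rw [if_neg (by omega), if_neg (by omega), el i hi]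
  · have ht := hs (l := [(-3, X (-3) - C 6)]) rfl
    set x₂ := assignTape [(-3, X (-3) - C 6)] x₁ with hx₂
    have hx₂' : ∀ i, x₂ i = if i = -3 then x₁ (-3) - 6 else x₁ i := fun i => by
      rw [hx₂, assignTape_cons, assignTape_nil]; simp
    by_cases hsum : 0 ≤ st.sum
    · refine ⟨_, ?_, (ht.tail (step_branch_nonneg rfl ?_)).tail (step_assign
        (T := interpreter ω₀ r K b₀) rfl)⟩
      · refine ⟨?_, ?_, ?_, ?_, fun i hi => ?_, fun i hi => ?_⟩ <;>
          simp only [assignTape_cons, assignTape_nil, exec, hx₂', if_pos hsum]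
        · simp [e₃]
        · simp [e₂]
        · simp
        · simp [e₀]
        · rw [if_neg (by omega), if_neg (by omega), er i hi]
        · rw [if_neg (by omega), if_neg (by omega), el i hi]
      · simpa [hx₂', e₁] using hsum
    · refine ⟨_, ?_, (ht.tail (step_branch_neg rfl ?_)).tail (step_assign
        (T := interpreter ω₀ r K b₀) rfl)⟩
      · refine ⟨?_, ?_, ?_, ?_, fun i hi => ?_, fun i hi => ?_⟩ <;>
          simp only [assignTape_cons, assignTape_nil, exec, hx₂', if_neg hsum]
        · simp [e₃]
        · simp [e₂]
        · simp
        · simp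
        · rw [if_neg (by omega), if_neg (by omega), if_neg (by omega), er i hi]
        · rw [if_neg (by omega), if_neg (by omega), if_neg (by omega), el i hi]
      · simpa [hx₂', e₁] using hsum

/-- The instruction that gives a verdict. -/
def verdictInstr (b : Bool) : Fin 9 := if b then 7 else 8

/-- The output that states a verdict. -/
def verdictOutput (b : Bool) : List ℝ := [if b then 1 else 0]

theorem reach_out (b : Bool) (x : Tape) : ∃ c : UNode × Tape, Reach (UNode.out b, x) c ∧
    (interpreter ω₀ r K b₀).node c.1 = .output ∧ verdictOutput b = outputTape c.2 := by
  refine ⟨(.halt, _), .single (step_assign (T := interpreter ω₀ r K b₀) rfl), rfl, ?_⟩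
  set y := assignTape [(-1, 0), (0, 1), (1, C (if b then 1 else 0))] x with hy
  have hy0 : y 0 = 1 := by simp [hy, assignTape_cons]
  have hy1 : y (-1) = 0 := by simp [hy, assignTape_cons]
  have hy2 : y 1 = if b then 1 else 0 := by simp [hy, assignTape_cons]
  have hinf : sInf {k : ℕ | y (-(k : ℤ)) ≠ 1} = 1 := by
    apply le_antisymm
    · exact Nat.sInf_le (by simp [hy1])
    · refine le_csInf ⟨1, by simp [hy1]⟩ fun k hk => ?_
      rcases k with _ | k
      · simp [hy0] at hk
      · omega
  refine List.ext_getElem (by simp [outputTape, hinf, verdictOutput]) fun i h₁ h₂ => ?_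
  simp only [verdictOutput, List.length_cons, List.length_nil] at h₁
  obtain rfl : i = 0 := by omega
  simp [verdictOutput, outputTape, hy2]

theorem reach_verdict {Y : ℤ → ℝ} {ω : ℝ} {st : Regs} {x : Tape} {b : Bool}
    (hω : 0 ≤ ω) (hω' : ω < 1) (h : Holds Y ((verdictInstr b + ω) / 10) st x) :
    (st.flag = 1 → ∃ c : UNode × Tape, Reach (UNode.fetch, x) c ∧
      (interpreter ω₀ r K b₀).node c.1 = .output ∧ verdictOutput b = outputTape c.2) ∧
    (st.flag = 0 → ∃ x', Holds Y ω { st with flag := 1 } x' ∧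
      Reach (UNode.fetch, x) (UNode.fetch, x')) := by
  obtain ⟨x₁, h₁, hr⟩ := reach_exe (r := r) (K := K) (b₀ := b₀) (ω₀ := ω₀) hω hω' h
  obtain ⟨e₃, e₂, e₁, e₀, er, el⟩ := h₁
  obtain ⟨x₂, hx₂, ht⟩ : ∃ x₂ : Tape, (∀ i, x₂ i = if i = -3 then ω else x₁ i) ∧
      Reach (UNode.fetch, x) (UNode.verdict b, x₂) := by
    cases b
    · refine ⟨_, fun i => ?_, hr.tail (step_assign (l := [(-3, X (-3) - C 8)]) rfl)⟩
      rw [assignTape_cons, assignTape_nil]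
      simp [e₃, verdictInstr]
    · refine ⟨_, fun i => ?_, hr.tail (step_assign (l := [(-3, X (-3) - C 7)]) rfl)⟩
      rw [assignTape_cons, assignTape_nil]
      simp [e₃, verdictInstr]
  constructor
  · intro hf
    obtain ⟨c, hc, hc'⟩ := reach_out (ω₀ := ω₀) (r := r) (K := K) (b₀ := b₀) b x₂
    refine ⟨c, (ht.tail (step_branch_nonneg rfl ?_)).trans hc, hc'⟩
    simp [hx₂, e₀, hf]
    norm_num
  · intro hf
    refine ⟨_, ?_, (ht.tail (step_branch_neg rfl ?_)).tail
      (step_assign (T := interpreter ω₀ r K b₀) rfl)⟩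
    · refine ⟨?_, ?_, ?_, ?_, fun i hi => ?_, fun i hi => ?_⟩ <;>
        simp only [assignTape_cons, assignTape_nil, hx₂]
      · simp
      · simp [e₂]
      · simp [e₁]
      · simp
      · rw [if_neg (by omega), if_neg (by omega), er i hi]
      · rw [if_neg (by omega), if_neg (by omega), el i hi]
    · simp [hx₂, e₀, hf]

end Interpreter

end BSS

/-! ### Initialization of the interpreter and the real number that codes its programs -/

namespace BSS

open MvPolynomial

/-- The tape on which the interpreter works, for a nonempty input `z` and parameters `r`. -/
noncomputable def cells (r : ℕ → ℝ) (z : List ℝ) (i : ℤ) : ℝ :=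
  if i ≤ 0 then r (-i).toNat else if i < z.length then 1 else if i = z.length then 0
  else z.getD (i - z.length - 1).toNat 0

theorem inputTape_apply (z : List ℝ) (i : ℤ) : inputTape z i =
    if 0 < i then z.getD (i - 1).toNat 0 else if -(z.length : ℤ) < i then 1 else 0 := rfl

section Interpreter

variable {ω₀ : ℝ} {r : ℕ → ℝ} {K : ℕ} {b₀ : Bool}

local notation "Reach" => Relation.ReflTransGen (Machine.Step (interpreter ω₀ r K b₀))

theorem reach_start_nil : ∃ c : UNode × Tape, Reach (UNode.start, inputTape []) c ∧
    (interpreter ω₀ r K b₀).node c.1 = .output ∧ verdictOutput b₀ = outputTape c.2 := by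
  obtain ⟨c, hc, hc'⟩ := reach_out (ω₀ := ω₀) (r := r) (K := K) (b₀ := b₀) b₀ (inputTape [])
  refine ⟨c, .head (step_branch_neg rfl ?_) hc, hc'⟩
  simp [inputTape_apply]

/-- The unary length mark is converted into data: place `0` is cleared as a terminator and the tape
is shifted right until the first zero beyond the ones reaches place `0`. To the right of the
registers there are then `n - 1` ones, a zero, and the input, with `n` its length. The parameters
are written on the left; beyond the first `K` the tape is `0` there, which is why `r` must vanish.
-/
theorem reach_start {z : List ℝ} (hz : z ≠ []) (hr : ∀ i, K ≤ i → r i = 0) :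
    ∃ x, Holds (cells r z) ω₀ ⟨0, 0, 0, 1⟩ x ∧
      Reach (UNode.start, inputTape z) (UNode.fetch, x) := by
  have hn : 1 ≤ z.length := List.length_pos_iff.2 hz
  set Y : ℤ → ℝ := fun i => if i = 0 then 0 else inputTape z i with hY
  have h₁ : Reach (UNode.start, inputTape z) (UNode.walk, assignTape [(0, 0)] (inputTape z)) := by
    refine .head (step_branch_nonneg (q₁ := UNode.mark) rfl ?_)
      (.single (step_assign (T := interpreter ω₀ r K b₀) rfl))
    have : -(z.length : ℤ) < 0 := by omega
    simp only [map_sub, eval_X, eval_C, inputTape_apply]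
    rw [if_neg (by omega), if_pos (by omega)]
    norm_num
  have key : ∀ k : ℕ, k + 1 ≤ z.length → ∃ x : Tape, (∀ i, x i = Y (i - k)) ∧
      Reach (UNode.start, inputTape z) (UNode.walk, x) := by
    intro k
    induction k with
    | zero =>
      refine fun _ => ⟨_, fun i => ?_, h₁⟩
      rw [assignTape_cons, assignTape_nil]
      simp [hY]
    | succ k ih =>
      intro hk
      obtain ⟨x, hx, hreach⟩ := ih (by omega)
      refine ⟨shiftR x, fun i => ?_, (hreach.tail (step_shiftRight rfl)).tail
        (step_branch_nonneg (T := interpreter ω₀ r K b₀) rfl ?_)⟩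
      · rw [shiftR_apply, hx]
        congr 1
        push_cast
        ring
      · have : shiftR x 0 = 1 := by
          rw [shiftR_apply, hx, hY]
          simp only [inputTape_apply]
          rw [if_neg (by omega), if_neg (by omega), if_pos (by omega)]
        simp [this]
        norm_num
  obtain ⟨x, hx, hreach⟩ := key (z.length - 1) (by omega)
  have hx' : ∀ i, shiftR x i = Y (i - z.length) := fun i => by
    rw [shiftR_apply, hx]
    congr 1
    push_cast [hn]
    ring
  have h₂ : Reach (UNode.start, inputTape z) (UNode.init, shiftR x) := by
    refine (hreach.tail (step_shiftRight rfl)).tail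
      (step_branch_neg (T := interpreter ω₀ r K b₀) rfl ?_)
    have : shiftR x 0 = 0 := by
      rw [hx', hY]
      simp only [inputTape_apply]
      rw [if_neg (by omega), if_neg (by omega), if_neg (by omega)]
    simp [this]
  refine ⟨ratMap (Finset.Icc (-3 - K) 0) (fun i => C (initVal ω₀ r i)) (fun _ => 1) (shiftR x), ?_,
    h₂.tail ⟨fun i _ => by simp, rfl⟩⟩
  set y := ratMap (Finset.Icc (-3 - K) 0) (fun i => C (initVal ω₀ r i)) (fun _ => 1) (shiftR x)
  have hy : ∀ i, y i = if -3 - (K : ℤ) ≤ i ∧ i ≤ 0 then initVal ω₀ r i else Y (i - z.length) := by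
    intro i
    have : y i = if i ∈ Finset.Icc (-3 - (K : ℤ)) 0 then
        eval (shiftR x) (C (initVal ω₀ r i) : MvPolynomial ℤ ℝ) /
          eval (shiftR x) (1 : MvPolynomial ℤ ℝ) else shiftR x i := rfl
    rw [this]
    simp only [Finset.mem_Icc, hx', eval_C, map_one, div_one]
  refine ⟨?_, ?_, ?_, ?_, fun i hi => ?_, fun i hi => ?_⟩
  · rw [hy, if_pos (by omega)]; simp [initVal]
  · rw [hy, if_pos (by omega)]; simp [initVal]
  · rw [hy, if_pos (by omega)]; simp [initVal]
  · rw [hy, if_pos (by omega)]; simp [initVal]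
  · rw [hy, if_neg (by omega), hY]
    simp only [inputTape_apply, cells, zero_add]
    rw [if_neg (by omega : ¬ i ≤ 0)]
    rcases lt_trichotomy i z.length with h | h | h
    · rw [if_neg (by omega), if_neg (by omega), if_pos (by omega), if_pos h]
    · rw [if_pos (by omega), if_neg (by omega), if_pos h]
    · rw [if_neg (by omega), if_pos (by omega), if_neg (by omega), if_neg (by omega)]
  · have e : (-((0 : ℤ) + 4 + i)).toNat = (-4 - i).toNat := by congr 1; ring
    simp only [cells]
    rw [hy, if_pos (by omega : (0 : ℤ) + 4 + i ≤ 0)]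
    by_cases h : -3 - (K : ℤ) ≤ i
    · rw [if_pos (by omega), initVal, if_neg (by omega), if_neg (by omega), if_pos hi, ← e]
    · rw [if_neg (by omega), hY]
      simp only [inputTape_apply]
      rw [if_neg (by omega), if_neg (by omega), if_neg (by omega)]
      exact (hr _ (by omega)).symm

/-- The real number that codes a stream of instructions. -/
noncomputable def streamCode (d : ℕ → Fin 9) (n : ℕ) : ℝ :=
  Real.ofDigits fun i => ((d (i + n)).castSucc : Fin 10)

theorem streamCode_nonneg (d : ℕ → Fin 9) (n : ℕ) : 0 ≤ streamCode d n := Real.ofDigits_nonneg _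

theorem streamCode_eq (d : ℕ → Fin 9) (n : ℕ) :
    streamCode d n = (d n + streamCode d (n + 1)) / 10 := by
  have h := Real.ofDigits_eq_sum_add_ofDigits (fun i => ((d (i + n)).castSucc : Fin 10)) 1
  have e : (fun i => ((d (i + 1 + n)).castSucc : Fin 10)) =
      fun i => ((d (i + (n + 1))).castSucc : Fin 10) := by
    ext i; rw [add_assoc, add_comm 1 n]
  rw [streamCode, h, streamCode, e]
  simp [Real.ofDigitsTerm]
  ring

/-- Only the digits `0, …, 8` occur, so a tail of nines, and with it an ambiguous expansion, is
impossible. -/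
theorem streamCode_lt_one (d : ℕ → Fin 9) (n : ℕ) : streamCode d n < 1 := by
  rw [streamCode_eq]
  have h₁ : streamCode d (n + 1) ≤ 1 := Real.ofDigits_le_one _
  have h₂ : ((d n : ℕ) : ℝ) ≤ 8 := by
    have := (d n).isLt
    exact_mod_cast Nat.le_of_lt_succ this
  linarith

theorem reach_execList {d : ℕ → Fin 9} {Y : ℤ → ℝ} (w : List (Fin 9)) (hw : Plain w) {n : ℕ}
    (hd : ∀ t (ht : t < w.length), d (n + t) = w[t]) {st : Regs} {x : Tape}
    (h : Holds Y (streamCode d n) st x) :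
    ∃ x', Holds Y (streamCode d (n + w.length)) (execList Y w st) x' ∧
      Reach (UNode.fetch, x) (UNode.fetch, x') := by
  induction w generalizing n st x with
  | nil => exact ⟨x, h, .refl⟩
  | cons a w ih =>
    have ha : d n = a := hd 0 (by simp)
    rw [streamCode_eq, ha] at h
    obtain ⟨x₁, h₁, hr₁⟩ := reach_exec (ω₀ := ω₀) (r := r) (K := K) (b₀ := b₀)
      (hw a List.mem_cons_self) (streamCode_nonneg d (n + 1)) (streamCode_lt_one d (n + 1)) h
    obtain ⟨x₂, h₂, hr₂⟩ := ih (fun b hb => hw b (List.mem_cons_of_mem _ hb)) (n := n + 1)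
      (fun t ht => by
        have := hd (t + 1) (by simpa using ht)
        rw [add_assoc, add_comm 1 t, this, List.getElem_cons_succ]) h₁
    refine ⟨x₂, ?_, hr₁.trans hr₂⟩
    rw [List.length_cons, show n + (w.length + 1) = n + 1 + w.length by ring]
    exact h₂

end Interpreter

/-- A sequence of nonempty lists can be concatenated to a stream. -/
theorem exists_stream {α : Type} [Inhabited α] (L : ℕ → List α) (hL : ∀ k, L k ≠ []) :
    ∃ (d : ℕ → α) (pos : ℕ → ℕ), pos 0 = 0 ∧ (∀ k, pos (k + 1) = pos k + (L k).length) ∧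
      ∀ k t (ht : t < (L k).length), d (pos k + t) = (L k)[t] := by
  let P : ℕ → List α := fun k => (List.range k).flatMap L
  have hP : ∀ k, P (k + 1) = P k ++ L k := fun k => by
    simp [P, List.range_succ]
  have hlen : ∀ k, k ≤ (P k).length := by
    intro k
    induction k with
    | zero => simp
    | succ k ih =>
      rw [hP, List.length_append]
      have := List.length_pos_iff.2 (hL k)
      omega
  have hpre : ∀ k l, k ≤ l → P k <+: P l := fun k l h => by
    induction h with
    | refl => exact List.prefix_rfl
    | step _ ih => exact ih.trans (by rw [hP]; exact List.prefix_append _ _)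
  have hget : ∀ k l i, i < (P k).length → i < (P l).length → (P k)[i]? = (P l)[i]? := by
    intro k l i hk hl
    rcases le_total k l with h | h
    · obtain ⟨t, ht⟩ := hpre k l h
      rw [← ht, List.getElem?_append_left hk]
    · obtain ⟨t, ht⟩ := hpre l k h
      rw [← ht, List.getElem?_append_left hl]
  refine ⟨fun n => ((P (n + 1))[n]?).getD default, fun k => (P k).length, by simp [P], fun k => ?_,
    fun k t ht => ?_⟩
  · dsimp only
    rw [hP, List.length_append]
  · dsimp only
    rw [hget _ (k + 1) _ (Nat.lt_of_succ_le (hlen _)) (by rw [hP, List.length_append]; omega), hP,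
      List.getElem?_append_right (by omega)]
    simp [ht]

/-- A set of sequences is computable if membership and non-membership of nonempty sequences are
witnessed by programs. -/
theorem rComputableSet_of_programs (A : Set (List ℝ)) (r : ℕ → ℝ) (K : ℕ)
    (hr : ∀ i, K ≤ i → r i = 0) (V : Set (List (Fin 9) × Bool))
    (hV : ∀ p ∈ V, Plain p.1 ∧ ∀ z : List ℝ, z ≠ [] → ∀ m : ℝ, ∃ m' f : ℝ,
      execList (cells r z) p.1 ⟨0, m, 0, 1⟩ = ⟨0, m', 0, f⟩ ∧
        (f = 0 ∨ f = 1 ∧ (p.2 = true ↔ z ∈ A)))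
    (hA : ∀ z : List ℝ, z ≠ [] → ∃ p ∈ V, ∀ m : ℝ, ∃ m' : ℝ,
      execList (cells r z) p.1 ⟨0, m, 0, 1⟩ = ⟨0, m', 0, 1⟩) : RComputableSet A := by
  classical
  obtain ⟨p₀, hp₀, -⟩ := hA [0] (by simp)
  -- Words over a finite alphabet are countable, so the correct programs can be listed. The list
  -- need not be effective, since it enters the machine only through a real constant.
  obtain ⟨F, hF⟩ := (Set.to_countable V).exists_eq_range ⟨p₀, hp₀⟩
  have hFV : ∀ k, F k ∈ V := fun k => hF ▸ Set.mem_range_self k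
  obtain ⟨d, pos, h0, hpos, hd⟩ := exists_stream (fun k => (F k).1 ++ [verdictInstr (F k).2])
    (fun k => by simp)
  let b₀ : Bool := decide ([] ∈ A)
  let T := interpreter (streamCode d 0) r K b₀
  have key : ∀ z : List ℝ, ∃ c : UNode × Tape,
      Relation.ReflTransGen T.Step (UNode.start, inputTape z) c ∧ T.node c.1 = .output ∧
      verdictOutput (decide (z ∈ A)) = outputTape c.2 := by
    intro z
    by_cases hz : z = []
    · subst hz
      exact reach_start_nil
    -- If the right answer were never given, each program in the list would end with flag `0`, for
    -- flag `1` produces a correct verdict and halts. But the list contains a program that `z`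
    -- passes. The product register is not reset between programs, so `m` stays arbitrary.
    · by_contra hno
      have hrun : ∀ k, ∃ x m, Holds (cells r z) (streamCode d (pos k)) ⟨0, m, 0, 1⟩ x ∧
          Relation.ReflTransGen T.Step (UNode.start, inputTape z) (UNode.fetch, x) ∧
          ∃ m' f, execList (cells r z) (F k).1 ⟨0, m, 0, 1⟩ = ⟨0, m', 0, f⟩ ∧ f = 0 := by
        have step : ∀ k x m, Holds (cells r z) (streamCode d (pos k)) ⟨0, m, 0, 1⟩ x →
            Relation.ReflTransGen T.Step (UNode.start, inputTape z) (UNode.fetch, x) →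
            ∃ m' f x', execList (cells r z) (F k).1 ⟨0, m, 0, 1⟩ = ⟨0, m', 0, f⟩ ∧ f = 0 ∧
              Holds (cells r z) (streamCode d (pos (k + 1))) ⟨0, m', 0, 1⟩ x' ∧
              Relation.ReflTransGen T.Step (UNode.start, inputTape z) (UNode.fetch, x') := by
          intro k x m hx hreach
          obtain ⟨hplain, hexec⟩ := hV _ (hFV k)
          obtain ⟨m', f, he, hf⟩ := hexec z hz m
          obtain ⟨x₁, hx₁, hr₁⟩ := reach_execList (ω₀ := streamCode d 0) (r := r) (K := K)
            (b₀ := b₀) (F k).1 hplain (fun t ht => by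
              rw [hd k t (by simp; omega), List.getElem_append_left ht]) hx
          rw [he] at hx₁
          have hver : d (pos k + (F k).1.length) = verdictInstr (F k).2 := by
            rw [hd k _ (by simp)]
            simp
          have hpos' : pos k + (F k).1.length + 1 = pos (k + 1) := by
            rw [hpos, List.length_append, List.length_singleton, add_assoc]
          rw [streamCode_eq, hver, hpos'] at hx₁
          obtain ⟨hv₁, hv₀⟩ := reach_verdict (ω₀ := streamCode d 0) (r := r) (K := K) (b₀ := b₀)
            (streamCode_nonneg d _) (streamCode_lt_one d _) hx₁
          rcases hf with hf | ⟨hf, hf'⟩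
          · obtain ⟨x₂, hx₂, hr₂⟩ := hv₀ hf
            exact ⟨m', f, x₂, he, hf, hx₂, (hreach.trans hr₁).trans hr₂⟩
          · obtain ⟨c, hc, hc', hc''⟩ := hv₁ hf
            refine (hno ⟨c, (hreach.trans hr₁).trans hc, hc', ?_⟩).elim
            rw [← hc'']
            congr 1
            rw [Bool.eq_iff_iff, decide_eq_true_iff, hf']
        intro k
        induction k with
        | zero =>
          obtain ⟨x, hx, hreach⟩ := reach_start (ω₀ := streamCode d 0) (b₀ := b₀) hz hr
          rw [h0]
          obtain ⟨m', f, -, h₁, h₂, -⟩ := step 0 x 0 (by rw [h0]; exact hx) hreach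
          exact ⟨x, 0, hx, hreach, m', f, h₁, h₂⟩
        | succ k ih =>
          obtain ⟨x, m, hx, hreach, -⟩ := ih
          obtain ⟨m', f, x', -, -, h₁, h₂⟩ := step k x m hx hreach
          obtain ⟨m'', f', -, h₃, h₄, -⟩ := step (k + 1) x' m' h₁ h₂
          exact ⟨x', m', h₁, h₂, m'', f', h₃, h₄⟩
      obtain ⟨p, hp, hp'⟩ := hA z hz
      obtain ⟨k, rfl⟩ : p ∈ Set.range F := hF ▸ hp
      obtain ⟨x, m, -, -, m', f, h₁, h₂⟩ := hrun k
      obtain ⟨m'', h₃⟩ := hp' m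
      rw [h₁, h₂] at h₃
      simp at h₃
  refine ⟨T, fun z => ⟨fun hz => ?_, fun hz => ?_⟩⟩
  · obtain ⟨c, h₁, h₂, h₃⟩ := key z
    exact ⟨c, h₁, h₂, by rw [← h₃]; simp [verdictOutput, hz]⟩
  · obtain ⟨c, h₁, h₂, h₃⟩ := key z
    exact ⟨c, h₁, h₂, by rw [← h₃]; simp [verdictOutput, hz]⟩

end BSS

/-! ### Sets that are open together with their complements are computable -/

namespace BSS

open MvPolynomial

/-- The valuation by the parameters `r` and the entries of `z`. -/
noncomputable def listEnv (r : ℕ → ℝ) (z : List ℝ) (v : ℕ) : ℝ :=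
  if v.unpair.1 = 0 then r v.unpair.2 else z.getD v.unpair.2 0

/-- With every `z` the set contains all `z'` of the same length that satisfy certain finitely many
polynomial inequalities. -/
def LOpen (r : ℕ → ℝ) (A : Set (List ℝ)) : Prop :=
  ∀ z ∈ A, ∃ F : Finset (MvPolynomial ℕ ℤ), (∀ p ∈ F, 0 ≤ aeval (listEnv r z) p) ∧
    ∀ z' : List ℝ, z'.length = z.length → (∀ p ∈ F, 0 ≤ aeval (listEnv r z') p) → z' ∈ A

/-- The place on the tape that holds a variable of `listEnv`, for sequences of length `n`. -/
def varCell (n v : ℕ) : ℤ := if v.unpair.1 = 0 then -(v.unpair.2 : ℤ) else n + 1 + v.unpair.2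

theorem cells_varCell (r : ℕ → ℝ) (z : List ℝ) :
    cells r z ∘ varCell z.length = listEnv r z := by
  funext v
  rw [Function.comp_apply, varCell, listEnv]
  split_ifs with h
  · rw [cells, if_pos (by omega)]
    congr 1
    omega
  · rw [cells, if_neg (by omega), if_neg (by omega), if_neg (by omega)]
    congr 1
    omega

/-- Inequalities which say that the input has length `n`. -/
noncomputable def lengthTests (n : ℕ) : List (MvPolynomial ℤ ℤ) :=
  -X (n : ℤ) :: (List.range (n - 1)).map fun i : ℕ => X ((i : ℤ) + 1) - 1

/-- The cells `1, …, n - 1` must contain at least `1` and the cell `n` at most `0`. A shorter input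
has its terminating zero among the first, a longer one has a `1` in the cell `n`. -/
theorem forall_lengthTests {r : ℕ → ℝ} {z : List ℝ} {n : ℕ} (hz : z ≠ []) (hn : n ≠ 0) :
    (∀ p ∈ lengthTests n, 0 ≤ aeval (cells r z) p) ↔ z.length = n := by
  have hz' : 1 ≤ z.length := List.length_pos_iff.2 hz
  simp only [lengthTests, List.forall_mem_cons, List.forall_mem_map, List.mem_range, map_neg,
    map_sub, aeval_X, map_one]
  constructor
  · rintro ⟨h₁, h₂⟩
    rcases lt_trichotomy z.length n with h | h | h
    · have := h₂ (z.length - 1) (by omega)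
      rw [cells, if_neg (by omega), if_neg (by omega), if_pos (by omega)] at this
      norm_num at this
    · exact h
    · rw [cells, if_neg (by omega), if_pos (by omega)] at h₁
      norm_num at h₁
  · rintro rfl
    refine ⟨?_, fun i hi => ?_⟩
    · rw [cells, if_neg (by omega), if_neg (by omega), if_pos rfl]
      simp
    · rw [cells, if_neg (by omega), if_pos (by omega)]
      simp

/-- Each `z` has a basic neighbourhood, within its length, on which membership in `A` is constant.
Testing the length and the inequalities of this neighbourhood is a program whose verdict is right
for every input that passes, and `z` passes it. -/
theorem rComputableSet_of_lOpen {A : Set (List ℝ)} {r : ℕ → ℝ} {K : ℕ} (hr : ∀ i, K ≤ i → r i = 0)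
    (h₁ : LOpen r A) (h₀ : LOpen r Aᶜ) : RComputableSet A := by
  classical
  refine rComputableSet_of_programs A r K hr
    {p | Plain p.1 ∧ ∀ z : List ℝ, z ≠ [] → ∀ m : ℝ, ∃ m' f : ℝ,
      execList (cells r z) p.1 ⟨0, m, 0, 1⟩ = ⟨0, m', 0, f⟩ ∧
        (f = 0 ∨ f = 1 ∧ (p.2 = true ↔ z ∈ A))} (fun p hp => hp) fun z hz => ?_
  have key : ∃ F : Finset (MvPolynomial ℕ ℤ), (∀ p ∈ F, 0 ≤ aeval (listEnv r z) p) ∧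
      ∀ z' : List ℝ, z'.length = z.length → (∀ p ∈ F, 0 ≤ aeval (listEnv r z') p) →
        (decide (z ∈ A) = true ↔ z' ∈ A) := by
    by_cases h : z ∈ A
    · obtain ⟨F, hF, hF'⟩ := h₁ z h
      exact ⟨F, hF, fun z' h' h'' => by simp [h, hF' z' h' h'']⟩
    · obtain ⟨F, hF, hF'⟩ := h₀ z h
      exact ⟨F, hF, fun z' h' h'' => by
        have : z' ∉ A := hF' z' h' h''
        simp [h, this]⟩
  obtain ⟨F, hF, hF'⟩ := key
  obtain ⟨w, hw, hexec⟩ := exists_test_program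
    (lengthTests z.length ++ F.toList.map (rename (varCell z.length)))
  have htest : ∀ z' : List ℝ, z' ≠ [] →
      ((∀ p ∈ lengthTests z.length ++ F.toList.map (rename (varCell z.length)),
        0 ≤ aeval (cells r z') p) ↔
      z'.length = z.length ∧ ∀ p ∈ F, 0 ≤ aeval (listEnv r z') p) := by
    intro z' hz'
    rw [List.forall_mem_append, forall_lengthTests hz' (by simpa using hz), List.forall_mem_map]
    refine and_congr_right fun h => ?_
    simp only [Finset.mem_toList, aeval_rename, ← h, cells_varCell]
  refine ⟨(w, decide (z ∈ A)), ⟨hw, fun z' hz' m => ?_⟩, fun m => ?_⟩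
  · obtain ⟨m', hm'⟩ := hexec (cells r z') ⟨0, m, 0, 1⟩ rfl rfl
    refine ⟨m', _, hm', ?_⟩
    by_cases h : ∀ p ∈ lengthTests z.length ++ F.toList.map (rename (varCell z.length)),
        0 ≤ aeval (cells r z') p
    · refine Or.inr ⟨if_pos h, ?_⟩
      obtain ⟨h, h'⟩ := (htest z' hz').1 h
      exact hF' z' h h'
    · exact Or.inl (if_neg h)
  · obtain ⟨m', hm'⟩ := hexec (cells r z) ⟨0, m, 0, 1⟩ rfl rfl
    refine ⟨m', ?_⟩
    rw [hm', if_pos ((htest z hz).2 ⟨rfl, hF⟩)]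

end BSS

/-! ### Structures that are `Σ`-definable over `HF(ℝ)` have computable copies -/

namespace BSS

open MvPolynomial HFSets

/-- A map to `HF(ℝ)` that is, near every point, the evaluation of a list with variables. -/
def LocTree (f : (ℕ → ℝ) → HF ℝ) : Prop :=
  ∀ x, ∃ (t : Lists' ℕ true) (U : (ℕ → ℝ) → Prop), PolyOpen U ∧ U x ∧ ∀ y, U y → f y = evalHF y t

theorem LocTree.comp {f : (ℕ → ℝ) → HF ℝ} (hf : LocTree f) (ρ : ℕ → ℕ) :
    LocTree fun x => f (x ∘ ρ) := by
  intro x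
  obtain ⟨t, U, hU, hx, h⟩ := hf (x ∘ ρ)
  exact ⟨t.map ρ, _, hU.comp_rename ρ, hx, fun y hy => by rw [evalHF_map]; exact h _ hy⟩

/-- Near each point the maps `g j` are given by fixed terms, for which `IsSigma.polyOpen` applies.
-/
theorem LocTree.polyOpen_realize {m k : ℕ} (φ : SigmaFormula ordFieldLang m k)
    (T : Fin m → Lists' ℕ true) {g : Fin k → (ℕ → ℝ) → HF ℝ} (hg : ∀ j, LocTree (g j)) :
    PolyOpen fun x => (fun j => g j x) ∈ φ.defSet fun i => evalHF x (T i) := by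
  intro x hx
  choose t U hU hUx ht using fun j => hg j x
  have h₁ : PolyOpen fun y => ∀ j ∈ Set.univ, U j y :=
    .forall_mem Set.finite_univ fun j _ => hU j
  have h₂ := φ.2.polyOpen (Sum.elim T t) default
  have e : ∀ y, (∀ j, U j y) → ((fun j => g j y) ∈ (φ.defSet fun i => evalHF y (T i)) ↔
      BoundedFormula.Realize φ.1 (fun a => evalHF y (Sum.elim T t a))
        fun i => evalHF y ((default : Fin 0 → _) i)) := by
    intro y hy
    have e₁ : (fun a => evalHF y (Sum.elim T t a)) =
        Sum.elim (fun i => evalHF y (T i)) fun j => g j y := by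
      funext a
      rcases a with a | a
      · rfl
      · exact (ht a y (hy a)).symm
    rw [e₁, SigmaFormula.defSet, Set.mem_ofPred_eq, Formula.Realize]
    exact iff_of_eq (congrArg _ (Subsingleton.elim _ _))
  obtain ⟨F, hF, hF'⟩ := h₁.and h₂ x ⟨fun j _ => hUx j, (e x hUx).1 hx⟩
  refine ⟨F, hF, fun y hy => ?_⟩
  obtain ⟨h, h'⟩ := hF' y hy
  exact (e y fun j => h j trivial).2 h'

/-- The variable of `listEnv r z` that corresponds to a variable of `listEnv r z.tail`. -/
def tailVar (v : ℕ) : ℕ :=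
  if v.unpair.1 = 0 then v else Nat.pair v.unpair.1 (v.unpair.2 + 1)

theorem listEnv_tail (r : ℕ → ℝ) (z : List ℝ) : listEnv r z.tail = listEnv r z ∘ tailVar := by
  funext v
  rw [Function.comp_apply, tailVar]
  split_ifs with h
  · simp [listEnv, h]
  · rw [listEnv, listEnv, Nat.unpair_pair, if_neg h, if_neg h]
    cases z <;> simp

theorem listEnv_pair_zero (r : ℕ → ℝ) (z : List ℝ) (i : ℕ) :
    listEnv r z (Nat.pair 0 i) = r i := by simp [listEnv]

theorem listEnv_pair_one (r : ℕ → ℝ) (z : List ℝ) (i : ℕ) :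
    listEnv r z (Nat.pair 1 i) = z.getD i 0 := by simp [listEnv]

theorem polyOpen_coord_eq (v : ℕ) (n : ℤ) : PolyOpen fun x : ℕ → ℝ => x v = n :=
  (PolyOpen.eq (X v) (C n)).congr (by simp)

/-- A number is not an integer iff it lies strictly between consecutive integers. With
`polyOpen_coord_eq`, an entry that is meant as a code splits the space into open pieces: one for
each integer and one for the rest. -/
theorem polyOpen_not_int (v : ℕ) : PolyOpen fun x : ℕ → ℝ => ∀ n : ℤ, x v ≠ n := by
  have : PolyOpen fun x : ℕ → ℝ => ∃ n : ℤ, n < x v ∧ x v < (n + 1 : ℤ) :=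
    .exists' fun n => ((PolyOpen.lt (C n) (X v)).and (PolyOpen.lt (X v) (C (n + 1)))).congr
      (by simp)
  refine this.congr fun x => ⟨?_, fun h => ⟨⌊x v⌋, ?_, ?_⟩⟩
  · rintro ⟨n, h₁, h₂⟩ k hk
    rw [hk] at h₁ h₂
    have h₁' := Int.cast_lt.1 h₁
    have h₂' := Int.cast_lt.1 h₂
    omega
  · exact lt_of_le_of_ne (Int.floor_le _) (h _).symm
  · push_cast
    exact Int.lt_floor_add_one _

/-- A set `D ⊆ HF(ℝ)` that is open in the appropriate sense has names in `ℝ^∞`. -/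
theorem exists_naming {r : ℕ → ℝ} {D : Set (HF ℝ)} (T₀ : Lists' ℕ true)
    (hT₀ : ∀ z, evalHF (listEnv r z) T₀ ∈ D) (U : Lists' ℕ true → (ℕ → ℝ) → Prop)
    (hU : ∀ t, PolyOpen (U t))
    (hUD : ∀ t z, U t (listEnv r z) ↔ evalHF (listEnv r z) t ∈ D) :
    ∃ f, LocTree f ∧ (∀ z, f (listEnv r z) ∈ D) ∧ ∀ a ∈ D, ∃ z, f (listEnv r z) = a := by
  classical
  have : Countable (MvPolynomial ℕ ℤ) := by
    rw [← Cardinal.mk_le_aleph0_iff]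
    exact MvPolynomial.cardinalMk_le_max.trans (by simp)
  obtain ⟨code, hcode⟩ :=
    Countable.exists_injective_nat (Lists' ℕ true × Finset (MvPolynomial ℕ ℤ))
  let Valid (c : Lists' ℕ true × Finset (MvPolynomial ℕ ℤ)) : Prop :=
    ∀ z, (∀ p ∈ c.2, 0 ≤ aeval (listEnv r z) p) → evalHF (listEnv r z) c.1 ∈ D
  -- The first entry is the code of a term and of inequalities that guarantee a value in `D`; the
  -- valuation is read from the remaining entries, which have to satisfy these inequalities. `Valid`
  -- does not depend on `x`, so it need not be decidable in any sense.
  let Good (c : Lists' ℕ true × Finset (MvPolynomial ℕ ℤ)) (x : ℕ → ℝ) : Prop :=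
    x (Nat.pair 1 0) = (code c : ℤ) ∧ Valid c ∧ ∀ p ∈ c.2, 0 ≤ aeval (x ∘ tailVar) p
  let f (x : ℕ → ℝ) : HF ℝ :=
    if h : ∃ c, Good c x then evalHF (x ∘ tailVar) h.choose.1 else evalHF x T₀
  have hf₁ : ∀ c x, Good c x → f x = evalHF (x ∘ tailVar) c.1 := by
    intro c x h
    have h' : ∃ c, Good c x := ⟨c, h⟩
    have e : h'.choose = c := hcode (by
      have := h'.choose_spec.1.symm.trans h.1
      exact_mod_cast this)
    simp only [f, dif_pos h', e]
  have hf₀ : ∀ x, (¬ ∃ c, Good c x) → f x = evalHF x T₀ := fun x h => dif_neg h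
  refine ⟨f, fun x => ?_, fun z => ?_, fun a ha => ?_⟩
  -- Four open cases: first entry not an integer, a valid code with inequalities satisfied, a valid
  -- code with some inequality violated, and an integer that is no valid code. In each of them one
  -- term describes `f`.
  · by_cases hx : ∀ n : ℤ, x (Nat.pair 1 0) ≠ n
    · exact ⟨T₀, _, polyOpen_not_int _, hx, fun y hy => hf₀ y fun ⟨c, hc⟩ => hy _ hc.1⟩
    push Not at hx
    obtain ⟨n, hn⟩ := hx
    by_cases hc : ∃ c, (code c : ℤ) = n ∧ Valid c
    · obtain ⟨c, rfl, hc⟩ := hc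
      by_cases hF : ∀ p ∈ c.2, 0 ≤ aeval (x ∘ tailVar) p
      · refine ⟨c.1.map tailVar, fun y => y (Nat.pair 1 0) = (code c : ℤ) ∧
          ∀ p ∈ (c.2 : Set (MvPolynomial ℕ ℤ)), 0 ≤ aeval (y ∘ tailVar) p, (polyOpen_coord_eq _ _).and
          (.forall_mem c.2.finite_toSet fun p _ => (PolyOpen.nonneg p).comp_rename tailVar),
          ⟨hn, hF⟩, fun y hy => ?_⟩
        rw [evalHF_map]
        exact hf₁ c y ⟨hy.1, hc, hy.2⟩
      · push Not at hF
        obtain ⟨p, hp, hpx⟩ := hF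
        refine ⟨T₀, fun y => y (Nat.pair 1 0) = (code c : ℤ) ∧ aeval (y ∘ tailVar) p < 0,
          (polyOpen_coord_eq _ _).and (((PolyOpen.lt p 0).congr fun x => by
            rw [map_zero]).comp_rename tailVar), ⟨hn, hpx⟩,
          fun y hy => hf₀ y fun ⟨c', hc'⟩ => ?_⟩
        have e : c' = c := hcode (by
          have := hc'.1.symm.trans hy.1
          exact_mod_cast this)
        subst e
        exact absurd (hc'.2.2 p hp) (not_le.2 hy.2)
    · refine ⟨T₀, _, polyOpen_coord_eq _ n, hn, fun y hy => hf₀ y fun ⟨c, hc'⟩ => hc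
        ⟨c, ?_, hc'.2.1⟩⟩
      have := hc'.1.symm.trans hy
      exact_mod_cast this
  · by_cases h : ∃ c, Good c (listEnv r z)
    · obtain ⟨c, hc⟩ := h
      rw [hf₁ c _ hc, ← listEnv_tail]
      exact hc.2.1 _ (by rw [listEnv_tail]; exact hc.2.2)
    · rw [hf₀ _ h]
      exact hT₀ z
  -- To name `a`, write it as the value of a term at the entries `zs`. Openness of the condition
  -- "value in `D`" at this point provides the inequalities for the code.
  · obtain ⟨K, t₀, y, -, ht₀, rfl⟩ := exists_evalHF_eq a 0
    set zs := (List.range K).map y with hzs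
    have e : evalHF (listEnv r zs) (t₀.map (Nat.pair 1)) = evalHF y t₀ := by
      rw [evalHF_map]
      refine evalHF_congr fun i hi => ?_
      have := (ht₀ i hi).2
      simp [listEnv_pair_one, hzs, this]
    obtain ⟨F, hF, hF'⟩ := hU (t₀.map (Nat.pair 1)) (listEnv r zs) ((hUD _ _).2 (by rwa [e]))
    refine ⟨(code (t₀.map (Nat.pair 1), F) : ℝ) :: zs, ?_⟩
    have et := listEnv_tail r ((code (t₀.map (Nat.pair 1), F) : ℝ) :: zs)
    rw [List.tail_cons] at et
    rw [hf₁ (t₀.map (Nat.pair 1), F) _ ⟨?_, ?_, ?_⟩, ← et, e]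
    · simp [listEnv_pair_one]
    · exact fun z hz => (hUD _ z).1 (hF' _ hz)
    · rw [← et]
      exact hF

/-! #### The atomic diagram -/

/-- A property of sequences of length `n` that is open and whose negation is open. -/
def ListClopen (r : ℕ → ℝ) (n : ℕ) (Q : List ℝ → Prop) : Prop :=
  ∃ P P' : (ℕ → ℝ) → Prop, PolyOpen P ∧ PolyOpen P' ∧ ∀ z, z.length = n →
    (Q z ↔ P (listEnv r z)) ∧ (¬ Q z ↔ P' (listEnv r z))

section ListClopen

variable {r : ℕ → ℝ} {n : ℕ} {Q Q' : List ℝ → Prop}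

theorem ListClopen.and (hQ : ListClopen r n Q) (hQ' : ListClopen r n Q') :
    ListClopen r n fun z => Q z ∧ Q' z := by
  obtain ⟨P₁, P₁', h₁, h₁', h⟩ := hQ
  obtain ⟨P₂, P₂', h₂, h₂', h'⟩ := hQ'
  exact ⟨_, _, h₁.and h₂, h₁'.or h₂', fun z hz => ⟨and_congr (h z hz).1 (h' z hz).1, by
    rw [not_and_or, (h z hz).2, (h' z hz).2]⟩⟩

theorem ListClopen.exists' {ι : Type} [Finite ι] {Q : ι → List ℝ → Prop}
    (hQ : ∀ i, ListClopen r n (Q i)) : ListClopen r n fun z => ∃ i, Q i z := by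
  choose P P' h h' h'' using hQ
  refine ⟨fun x => ∃ i, P i x, fun x => ∀ i ∈ Set.univ, P' i x, .exists' h,
    .forall_mem Set.finite_univ fun i _ => h' i, fun z hz => ⟨?_, ?_⟩⟩
  · exact exists_congr fun i => (h'' i z hz).1
  · push Not
    simp only [Set.mem_univ, true_imp_iff]
    exact forall_congr' fun i => (h'' i z hz).2

theorem listClopen_length (k : ℕ) : ListClopen r n fun z => z.length = k :=
  ⟨_, _, .const (n = k), .const (n ≠ k), fun z hz => by subst hz; exact ⟨Iff.rfl, Iff.rfl⟩⟩

theorem listClopen_getD (i k : ℕ) : ListClopen r n fun z => z.getD i 0 = k := by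
  refine ⟨fun x => x (Nat.pair 1 i) = (k : ℤ), fun x => x (Nat.pair 1 i) ≠ (k : ℤ),
    polyOpen_coord_eq _ _, (PolyOpen.ne (X (Nat.pair 1 i)) (C (k : ℤ))).congr (by simp),
    fun z hz => ?_⟩
  simp [listEnv_pair_one]

/-- The variable of `listEnv r z` that corresponds to a variable of `listEnv r z'`, where `z'`
consists of the `k` entries of `z` that follow the first `o` entries. -/
def subVar (n o k v : ℕ) : ℕ :=
  -- The index `n` lies past the end of a sequence of length `n`, where the default value `0` is
  -- read.
  if v.unpair.1 = 0 then v else Nat.pair 1 (if v.unpair.2 < k then o + v.unpair.2 else n)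

theorem listEnv_sub (r : ℕ → ℝ) {z : List ℝ} (o k : ℕ) :
    listEnv r ((z.drop o).take k) = listEnv r z ∘ subVar z.length o k := by
  funext v
  rw [Function.comp_apply, subVar]
  split_ifs with h h'
  · simp [listEnv, h]
  · rw [listEnv_pair_one, listEnv, if_neg h]
    simp only [List.getD_eq_getElem?_getD, List.getElem?_take, if_pos h', List.getElem?_drop]
  · rw [listEnv_pair_one, listEnv, if_neg h]
    simp only [List.getD_eq_getElem?_getD, List.getElem?_take, if_neg h']
    simp

/-- The places of the names in a sequence, when the block of the first name begins at `o` and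
the lengths of the names are given. -/
def nameSpans : ℕ → List ℕ → List (ℕ × ℕ)
  | _, [] => []
  | o, n :: ns => (o + 1, n) :: nameSpans (o + n + 1) ns

theorem length_nameSpans (o : ℕ) (ns : List ℕ) : (nameSpans o ns).length = ns.length := by
  induction ns generalizing o with
  | nil => rfl
  | cons n ns ih => simp [nameSpans, ih]

/-- From the place `o`, the sequence consists of names of the given lengths, each preceded by its
length. -/
def HasLengths : ℕ → List ℕ → List ℝ → Prop
  | o, [], z => z.length = o
  | o, n :: ns, z => z.getD o 0 = n ∧ HasLengths (o + n + 1) ns z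

theorem HasLengths.le_length {o : ℕ} {ns : List ℕ} {z : List ℝ} (h : HasLengths o ns z) :
    o ≤ z.length := by
  induction ns generalizing o with
  | nil => exact h.ge
  | cons n ns ih => have := ih h.2; omega

theorem HasLengths.drop_eq {o : ℕ} {ns : List ℕ} {z : List ℝ} (h : HasLengths o ns z) :
    z.drop o = ((nameSpans o ns).map fun q => (z.drop q.1).take q.2).flatMap
      fun a => (a.length : ℝ) :: a := by
  induction ns generalizing o with
  | nil => simp [nameSpans, List.drop_eq_nil_of_le (le_of_eq h)]
  | cons n ns ih =>
    have h' := h.2.le_length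
    rw [nameSpans, List.map_cons, List.flatMap_cons, ← ih h.2]
    have e : o < z.length := by omega
    have hl : ((z.drop (o + 1)).take n).length = n := by
      rw [List.length_take, List.length_drop]; omega
    rw [hl, List.drop_eq_getElem_cons e, ← h.1, List.getD_eq_getElem _ _ e, List.cons_append]
    congr 1
    rw [show o + n + 1 = (o + 1) + n by ring, ← List.drop_drop (i := n)]
    exact (List.take_append_drop _ _).symm

theorem hasLengths_of_drop_eq {o : ℕ} {as : List (List ℝ)} {z : List ℝ} (ho : o ≤ z.length)
    (h : z.drop o = as.flatMap fun a => (a.length : ℝ) :: a) :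
    HasLengths o (as.map List.length) z ∧
      (nameSpans o (as.map List.length)).map (fun q => (z.drop q.1).take q.2) = as := by
  induction as generalizing o with
  | nil =>
    refine ⟨le_antisymm ?_ ho, rfl⟩
    simpa using h
  | cons a as ih =>
    rw [List.flatMap_cons, List.cons_append] at h
    have h₁ : z.drop (o + 1) = a ++ as.flatMap fun a => (a.length : ℝ) :: a := by
      rw [← List.drop_drop, h]; rfl
    have h₂ : z.drop (o + a.length + 1) = as.flatMap fun a => (a.length : ℝ) :: a := by
      rw [show o + a.length + 1 = (o + 1) + a.length by ring, ← List.drop_drop, h₁,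
        List.drop_left]
    have hlen := congrArg List.length h
    rw [List.length_drop, List.length_cons, List.length_append] at hlen
    obtain ⟨h₃, h₄⟩ := ih (by omega) h₂
    refine ⟨⟨?_, h₃⟩, ?_⟩
    · have := congrArg (fun l => l.getD 0 0) h
      simpa using this
    · rw [List.map_cons, nameSpans, List.map_cons, h₄, h₁, List.take_left]

theorem listClopen_hasLengths (o : ℕ) (ns : List ℕ) : ListClopen r n (HasLengths o ns) := by
  induction ns generalizing o with
  | nil => exact listClopen_length o
  | cons k ns ih => exact (listClopen_getD o k).and (ih _)

/-- The atomic diagram of a structure, given by relations `R i` with the numbers `num i` between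
the objects `val z` named by sequences. -/
theorem lOpen_diagram {ι E : Type*} {num ar : ι → ℕ} (hnum : Function.Injective num)
    (R : ∀ i, (Fin (ar i) → E) → Prop) (val : List ℝ → E)
    (hR : ∀ i n (o k : Fin (ar i) → ℕ),
      ListClopen r n fun z => R i fun j => val ((z.drop (o j)).take (k j))) :
    LOpen r {z | ∃ (i : ι) (x : Fin (ar i) → List ℝ), R i (fun j => val (x j)) ∧
      z = atomCode (num i) (List.ofFn x)} ∧
    LOpen r {z | ∃ (i : ι) (x : Fin (ar i) → List ℝ), R i (fun j => val (x j)) ∧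
      z = atomCode (num i) (List.ofFn x)}ᶜ := by
  set A := {z | ∃ (i : ι) (x : Fin (ar i) → List ℝ), R i (fun j => val (x j)) ∧
      z = atomCode (num i) (List.ofFn x)} with hA
  let sp (n : ℕ) (i : ι) (f : Fin (ar i) → Fin (n + 1)) (j : Fin (ar i)) : ℕ × ℕ :=
    (nameSpans 1 (List.ofFn fun j => (f j : ℕ))).getD j (0, 0)
  -- Within sequences of length `n`, the lengths of the names are at most `n`, so there are finitely
  -- many ways to cut the sequence into names. Each way is a clopen condition.
  let G (n : ℕ) (i : ι) (z : List ℝ) : Prop := z.getD 0 0 = num i ∧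
    ∃ f : Fin (ar i) → Fin (n + 1), HasLengths 1 (List.ofFn fun j => (f j : ℕ)) z ∧
      R i fun j => val ((z.drop (sp n i f j).1).take (sp n i f j).2)
  have hG : ∀ n i, ListClopen r n (G n i) := fun n i =>
    (listClopen_getD 0 (num i)).and (.exists' fun f =>
      (listClopen_hasLengths 1 _).and (hR i n _ _))
  have hAG : ∀ n z, z.length = n → (z ∈ A ↔ ∃ i, G n i z) := by
    intro n z hz
    constructor
    · rintro ⟨i, x, hx, rfl⟩
      obtain ⟨h₁, h₂⟩ := hasLengths_of_drop_eq (o := 1) (as := List.ofFn x)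
        (z := atomCode (num i) (List.ofFn x)) (by simp [atomCode]) (by simp [atomCode])
      have hlt : ∀ j, (x j).length < n + 1 := by
        intro j
        rw [← hz, atomCode, List.length_cons, List.length_flatMap]
        have : (x j).length + 1 ≤ ((List.ofFn x).map fun a => ((a.length : ℝ) :: a).length).sum :=
          List.single_le_sum (by simp) _ (List.mem_map.2 ⟨x j, by simp, by simp⟩)
        omega
      have e : (List.ofFn x).map List.length =
          List.ofFn fun j => ((⟨(x j).length, hlt j⟩ : Fin (n + 1)) : ℕ) := by
        rw [List.map_ofFn]; rfl
      rw [e] at h₁ h₂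
      refine ⟨i, by simp [atomCode], fun j => ⟨(x j).length, hlt j⟩, h₁, ?_⟩
      convert hx with j
      have h₃ := congrArg (fun l => l[(j : ℕ)]?) h₂
      have hj : (j : ℕ) < (nameSpans 1 (List.ofFn fun j =>
          ((⟨(x j).length, hlt j⟩ : Fin (n + 1)) : ℕ))).length := by
        rw [length_nameSpans, List.length_ofFn]; exact j.2
      simp only [List.getElem?_map, List.getElem?_eq_getElem hj, Option.map_some] at h₃
      rw [List.getElem?_eq_getElem (by simp), List.getElem_ofFn] at h₃
      simp only [sp, List.getD_eq_getElem _ _ hj]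
      exact Option.some.inj h₃
    · rintro ⟨i, h₀, f, hf, hR⟩
      refine ⟨i, _, hR, ?_⟩
      have h₁ := hf.drop_eq
      have hlen := hf.le_length
      have e : (nameSpans 1 (List.ofFn fun j => (f j : ℕ))).map
          (fun q => (z.drop q.1).take q.2) =
          List.ofFn fun j => (z.drop (sp n i f j).1).take (sp n i f j).2 := by
        refine List.ext_getElem (by simp [length_nameSpans]) fun j hj hj' => ?_
        rw [List.length_map] at hj
        simp only [List.getElem_map, List.getElem_ofFn, sp, List.getD_eq_getElem _ _ hj]
      rw [e] at h₁
      rw [atomCode, ← h₁, ← h₀]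
      cases z with
      | nil => simp at hlen
      | cons a z => rfl
  have hcoord : ∀ z : List ℝ, listEnv r z (Nat.pair 1 0) = z.getD 0 0 := fun z =>
    listEnv_pair_one r z 0
  constructor
  · intro z hz
    obtain ⟨i, hi⟩ := (hAG _ z rfl).1 hz
    obtain ⟨P, P', hP, hP', h⟩ := hG z.length i
    obtain ⟨F, hF, hF'⟩ := hP _ ((h z rfl).1.1 hi)
    exact ⟨F, hF, fun z' hz' h' => (hAG _ z' hz').2 ⟨i, (h z' hz').1.2 (hF' _ h')⟩⟩
  · intro z hz
    have hz' := mt (hAG _ z rfl).2 hz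
    suffices h : ∃ U, PolyOpen U ∧ U (listEnv r z) ∧ ∀ z', z'.length = z.length →
        U (listEnv r z') → ¬ ∃ i, G z.length i z' by
      obtain ⟨U, hU, hUz, h⟩ := h
      obtain ⟨F, hF, hF'⟩ := hU _ hUz
      exact ⟨F, hF, fun z' hz'' h' => mt (hAG _ z' hz'').1 (h z' hz'' (hF' _ h'))⟩
    -- There may be infinitely many symbols, so the complement is not a finite intersection. But the
    -- first entry fixes an integer on an open set, and by injectivity of `num` at most one symbol
    -- remains to be refuted.
    by_cases h₁ : ∀ n : ℤ, z.getD 0 0 ≠ n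
    · refine ⟨_, polyOpen_not_int (Nat.pair 1 0), by simpa only [hcoord] using h₁, ?_⟩
      rintro z' - h ⟨i, hi, -⟩
      exact h (num i) (by rw [hcoord, hi]; simp)
    push Not at h₁
    obtain ⟨n, hn⟩ := h₁
    by_cases h₂ : ∃ i, (num i : ℤ) = n
    · obtain ⟨i, rfl⟩ := h₂
      obtain ⟨P, P', hP, hP', h⟩ := hG z.length i
      refine ⟨_, (polyOpen_coord_eq (Nat.pair 1 0) (num i)).and hP',
        ⟨by rw [hcoord, hn], (h z rfl).2.1 fun hi => hz' ⟨i, hi⟩⟩, ?_⟩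
      rintro z' hz'' ⟨h₃, h₄⟩ ⟨i', hi'⟩
      rw [hcoord, hi'.1] at h₃
      have e : i' = i := hnum (by exact_mod_cast h₃)
      subst e
      exact (h z' hz'').2.2 h₄ hi'
    · refine ⟨_, polyOpen_coord_eq (Nat.pair 1 0) n, by rw [hcoord, hn], ?_⟩
      rintro z' - h ⟨i, hi, -⟩
      rw [hcoord, hi] at h
      exact h₂ ⟨i, by exact_mod_cast h⟩

end ListClopen

end BSS

/-- Two quotient structures are isomorphic if a map between the prestructures respects and reflects
the equivalence relation and all relations, and is surjective up to equivalence. -/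
theorem nonempty_equiv_quotient {L : FirstOrder.Language.{v, w}} [L.IsRelational] {A : Type u}
    {B : Type u'} {s : Setoid A} {t : Setoid B} (P : L.Prestructure s) (P' : L.Prestructure t)
    (g : A → B) (hg : ∀ a a', s a a' ↔ t (g a) (g a')) (hsurj : ∀ b, ∃ a, t (g a) b)
    (hrel : ∀ (k : ℕ) (R : L.Relations k) (x : Fin k → A),
      P.toStructure.RelMap R x ↔ P'.toStructure.RelMap R (g ∘ x)) :
    Nonempty (Quotient s ≃[L] Quotient t) := by
  let e : Quotient s ≃ Quotient t := Equiv.ofBijective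
    (Quotient.map g fun a a' h => (hg a a').1 h) (by
      constructor
      · rintro ⟨a⟩ ⟨a'⟩ h
        exact Quotient.sound ((hg a a').2 (Quotient.exact h))
      · rintro ⟨b⟩
        obtain ⟨a, ha⟩ := hsurj b
        exact ⟨⟦a⟧, Quotient.sound ha⟩)
  refine ⟨⟨e, fun {n} f => isEmptyElim f, fun {n} R x => ?_⟩⟩
  obtain ⟨y, rfl⟩ : ∃ y : Fin n → A, x = fun i => ⟦y i⟧ :=
    ⟨fun i => (x i).out, funext fun i => (Quotient.out_eq _).symm⟩
  have h : (e ∘ fun i => (⟦y i⟧ : Quotient s)) = fun i => ⟦g (y i)⟧ := rfl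
  change Structure.RelMap R (e ∘ fun i => (⟦y i⟧ : Quotient s)) ↔ _
  rw [h, relMap_quotient_mk' s, relMap_quotient_mk' t, hrel]
  rfl

/-! ### The computable copy of a Σ-definable structure -/

namespace BSS

open MvPolynomial HFSets

/-- Finitely many elements of `HF(ℝ)` are the values of lists with variables. -/
theorem exists_parameters (m : ℕ) (q : Fin m → HF ℝ) : ∃ (r : ℕ → ℝ) (K : ℕ)
    (T : Fin m → Lists' ℕ true), (∀ i, K ≤ i → r i = 0) ∧ (∀ j, ∀ i ∈ (T j).atoms, i < K) ∧
      ∀ j, evalHF r (T j) = q j := by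
  induction m with
  | zero => exact ⟨fun _ => 0, 0, Fin.elim0, fun _ _ => rfl, fun j => j.elim0, fun j => j.elim0⟩
  | succ m ih =>
    obtain ⟨r, K, T, hr, hT, h⟩ := ih (Fin.init q)
    obtain ⟨K', t, y, hK, ht, ht'⟩ := exists_evalHF_eq (q (Fin.last m)) K
    refine ⟨fun i => if i < K then r i else if i < K' then y i else 0, K', Fin.snoc T t,
      fun i hi => by dsimp only; rw [if_neg (by omega), if_neg (by omega)],
      Fin.lastCases ?_ fun j => ?_, Fin.lastCases ?_ fun j => ?_⟩
    · rw [Fin.snoc_last]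
      exact fun i hi => (ht i hi).2
    · rw [Fin.snoc_castSucc]
      exact fun i hi => (hT j i hi).trans_le hK
    · rw [Fin.snoc_last, ← ht']
      exact evalHF_congr fun i hi => by
        have := ht i hi
        rw [if_neg (by omega), if_pos (by omega)]
    · rw [Fin.snoc_castSucc]
      refine Eq.trans (evalHF_congr fun i hi => ?_) (h j)
      exact if_pos (hT j i hi)

/-- The prestructure induced by a map. -/
noncomputable abbrev comapPrestructure {L : FirstOrder.Language.{v, w}} [L.IsRelational]
    {A : Type u} {B : Type u'} {t : Setoid B} (P : L.Prestructure t) (g : A → B) :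
    L.Prestructure (t.comap g) where
  toStructure :=
    { funMap := fun f => isEmptyElim f
      RelMap := fun R x => P.toStructure.RelMap R (g ∘ x) }
  fun_equiv {_ f} := isEmptyElim f
  rel_equiv {_ _} _ _ h := P.rel_equiv _ _ fun i => h i

/-- The symbols of the atomic sentences in a language: equality (`none`) and the relation symbols. -/
abbrev Symb (L : FirstOrder.Language.{v, w}) : Type w := Option (Σ k, L.Relations k)

section Symb

variable {L : FirstOrder.Language.{v, w}}

/-- The arity of a symbol. -/
def Symb.arity : Symb L → ℕ
  | none => 2
  | some R => R.1

/-- The number of a symbol. -/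
def Symb.number [Encodable (Σ k, L.Relations k)] : Symb L → ℕ
  | none => 0
  | some R => Encodable.encode R + 1

theorem Symb.number_injective [Encodable (Σ k, L.Relations k)] :
    Function.Injective (Symb.number (L := L)) := by
  rintro (_ | R) (_ | R') h
  · rfl
  · simp [number] at h
  · simp [number] at h
  · simpa [number] using h

/-- The interpretation of a symbol in a prestructure. -/
def Symb.Holds {D : Type u} {s : Setoid D} (P : L.Prestructure s) :
    ∀ i : Symb L, (Fin i.arity → D) → Prop
  | none, x => s (x (0 : Fin 2)) (x (1 : Fin 2))
  | some R, x => P.toStructure.RelMap R.2 x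

theorem atomicDiagram_eq [Encodable (Σ k, L.Relations k)] {D : Set (List ℝ)} {s : Setoid D}
    (P : L.Prestructure s) :
    atomicDiagram D s P = {z | ∃ (i : Symb L) (x : Fin i.arity → D), i.Holds P x ∧
      z = atomCode i.number (List.ofFn fun j => (x j).1)} := by
  ext z
  constructor
  · rintro (⟨a, b, h, rfl⟩ | ⟨k, R, x, h, rfl⟩)
    · refine ⟨none, (![a, b] : Fin 2 → D), h, ?_⟩
      have : List.ofFn (fun j => ((![a, b] : Fin 2 → D) j).1) = [a.1, b.1] := by
        simp [List.ofFn_succ]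
      exact congrArg (atomCode 0) this.symm
    · exact ⟨some ⟨k, R⟩, x, h, rfl⟩
  · rintro ⟨_ | ⟨k, R⟩, x, h, rfl⟩
    · refine Or.inl ⟨x (0 : Fin 2), x (1 : Fin 2), h, ?_⟩
      have : List.ofFn (n := 2) (fun j => (x j).1) = [(x (0 : Fin 2)).1, (x (1 : Fin 2)).1] := by
        simp [List.ofFn_succ]
      exact congrArg (atomCode 0) this
    · exact Or.inr ⟨k, R, x, h, rfl⟩

end Symb

/-- Pulling the structure back along the naming of `D` makes every finite sequence a name. Each
predicate and its complement are given by Σ-formulas evaluated at locally constant terms, so the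
atomic diagram and its complement are open. -/
theorem hasRComputableCopy_of_sigmaDefinable (L : FirstOrder.Language.{v, w}) [L.IsRelational]
    [Encodable (Σ k, L.Relations k)] (N : Type u) [L.Structure N]
    (h : SigmaDefinable ordFieldLang ℝ L N) : HasRComputableCopy L N := by
  obtain ⟨m, p, Ψ₀, Ψ₁, Ψ₁', Φ, Φ', D, hD, ⟨d₀, hd₀⟩, hΨ, hΦ, s, P, hs, hP, ⟨e⟩⟩ := h
  -- An element `d₀` of `D` is treated as an additional parameter; it is the default value of
  -- sequences that are not proper names.
  obtain ⟨r₀, K, T₀, hr, -, hT₀⟩ := exists_parameters (m + 1) (Fin.cons d₀ p)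
  let T : Fin (m + 1) → Lists' ℕ true := fun j => (T₀ j).map (Nat.pair 0)
  have hT : ∀ j z, evalHF (listEnv r₀ z) (T j) = (Fin.cons d₀ p : Fin (m + 1) → HF ℝ) j := by
    intro j z
    rw [evalHF_map, ← hT₀ j]
    exact evalHF_congr fun i _ => listEnv_pair_zero r₀ z i
  have hp : ∀ z, (fun i : Fin m => evalHF (listEnv r₀ z) (T i.succ)) = p := fun z =>
    funext fun i => by rw [hT, Fin.cons_succ]
  obtain ⟨f, hf, hfD, hsurj⟩ := exists_naming (r := r₀) (D := D) (T 0)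
    (fun z => by rw [hT, Fin.cons_zero]; exact hd₀)
    (fun t x => (fun _ => evalHF x t) ∈ Ψ₀.defSet fun i => evalHF x (T i.succ))
    (fun t => LocTree.polyOpen_realize Ψ₀ _ fun _ x =>
      ⟨t, fun _ => True, .const _, trivial, fun _ _ => rfl⟩)
    (fun t z => by rw [hp, hD]; rfl)
  let val : List ℝ → D := fun z => ⟨f (listEnv r₀ z), hfD z⟩
  have hcompl : ∀ {k : ℕ} (F F' : SigmaFormula ordFieldLang m k),
      F'.defSet p = {x | ∀ i, x i ∈ D} \ F.defSet p → ∀ (x : Fin k → D) (q : Prop),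
      (q ↔ (fun j => (x j).1) ∈ F.defSet p) → (¬ q ↔ (fun j => (x j).1) ∈ F'.defSet p) := by
    intro k F F' h x q hq
    rw [hq, h]
    exact ⟨fun h => ⟨fun j => (x j).2, h⟩, fun h => h.2⟩
  have hF : ∀ i : Symb L, ∃ F F' : SigmaFormula ordFieldLang m i.arity, ∀ x : Fin i.arity → D,
      (i.Holds P x ↔ (fun j => (x j).1) ∈ F.defSet p) ∧
      (¬ i.Holds P x ↔ (fun j => (x j).1) ∈ F'.defSet p) := by
    rintro (_ | R)
    · refine ⟨Ψ₁, Ψ₁', fun x => ?_⟩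
      have e : (fun j => (x j).1) = ![(x (0 : Fin 2)).1, (x (1 : Fin 2)).1] := by
        refine funext fun j : Fin 2 => ?_
        fin_cases j <;> rfl
      have h₁ : Symb.Holds P none x ↔ (fun j => (x j).1) ∈ Ψ₁.defSet p :=
        (hs _ _).trans (iff_of_eq (congrArg (· ∈ Ψ₁.defSet p) e.symm))
      exact ⟨h₁, hcompl Ψ₁ Ψ₁' hΨ x _ h₁⟩
    · refine ⟨Φ _ R.2, Φ' _ R.2, fun x => ?_⟩
      have h₁ : Symb.Holds P (some R) x ↔ (fun j => (x j).1) ∈ (Φ _ R.2).defSet p := hP _ _ _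
      exact ⟨h₁, hcompl _ _ (hΦ _ R.2) x _ h₁⟩
  choose F F' hFF using hF
  have key := lOpen_diagram (r := r₀) (Symb.number_injective (L := L))
    (fun i => i.Holds P) val (fun i n o k => by
      refine ⟨_, _, LocTree.polyOpen_realize (F i) (fun j => T j.succ)
        fun j => hf.comp (subVar n (o j) (k j)),
        LocTree.polyOpen_realize (F' i) (fun j => T j.succ)
          fun j => hf.comp (subVar n (o j) (k j)), fun z hz => ?_⟩
      simp only [hp, ← hz, ← listEnv_sub]
      exact hFF i fun j => val ((z.drop (o j)).take (k j)))
  -- All of `ℝ^∞` serves as the set of names, so no separate condition for being a name enters the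
  -- diagram.
  refine ⟨Set.univ, _, comapPrestructure P fun z => val z.1, ?_, ?_⟩
  · rw [atomicDiagram_eq]
    have e : {z | ∃ (i : Symb L) (x : Fin i.arity → (Set.univ : Set (List ℝ))),
        i.Holds (comapPrestructure P fun z => val z.1) x ∧
          z = atomCode i.number (List.ofFn fun j => (x j).1)} =
        {z | ∃ (i : Symb L) (x : Fin i.arity → List ℝ), i.Holds P (fun j => val (x j)) ∧
          z = atomCode i.number (List.ofFn x)} := by
      ext z
      constructor
      · rintro ⟨i, x, h, rfl⟩
        refine ⟨i, fun j => (x j).1, ?_, rfl⟩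
        rcases i with _ | R <;> exact h
      · rintro ⟨i, x, h, rfl⟩
        refine ⟨i, fun j => ⟨x j, trivial⟩, ?_, rfl⟩
        rcases i with _ | R <;> exact h
    rw [e]
    exact rComputableSet_of_lOpen hr key.1 key.2
  · let _ := comapPrestructure P fun z : (Set.univ : Set (List ℝ)) => val z.1
    obtain ⟨e'⟩ := nonempty_equiv_quotient (comapPrestructure P fun z : Set.univ => val z.1) P
      (fun z => val z.1) (fun _ _ => Iff.rfl) (fun b => by
        obtain ⟨z, hz⟩ := hsurj b.1 b.2
        refine ⟨⟨z, trivial⟩, ?_⟩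
        have : val z = b := Subtype.ext hz
        rw [this]) (fun _ _ _ => Iff.rfl)
    exact ⟨(e'.symm.comp e)⟩

end BSS

/-! ### A calculus of Σ-definable properties -/

namespace HFSets

/-- A way to read the elements of a type `E` of environments as assignments of values to the
free and the bound variables of formulas. -/
structure Ctx (α E : Type) where
  /-- The values of the free variables. -/
  free : E → α → HF ℝ
  /-- The number of bound variables. -/
  n : ℕ
  /-- The values of the bound variables. -/
  bound : E → Fin n → HF ℝ

variable {α E E' E'' : Type} {Γ : Ctx α E} {Γ' : Ctx α E'} {Γ'' : Ctx α E''}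

/-- The extension of a context by a variable for an element of `HF(ℝ)`. -/
def Ctx.ext (Γ : Ctx α E) : Ctx α (E × HF ℝ) :=
  ⟨fun e => Γ.free e.1, Γ.n + 1, fun e => Fin.snoc (Γ.bound e.1) e.2⟩

/-- The extension of a context by a variable for a real number. -/
def Ctx.extR (Γ : Ctx α E) : Ctx α (E × ℝ) :=
  ⟨fun e => Γ.free e.1, Γ.n + 1, fun e => Fin.snoc (Γ.bound e.1) (singleton e.2)⟩

/-- The map `f` is the value of a variable. -/
def Var (Γ : Ctx α E) (f : E → HF ℝ) : Prop :=
  ∃ i : α ⊕ Fin Γ.n, ∀ e, Sum.elim (Γ.free e) (Γ.bound e) i = f e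

/-- The real-valued map `f` is the value of a variable. -/
def RVar (Γ : Ctx α E) (f : E → ℝ) : Prop := Var Γ fun e => singleton (f e)

/-- Every variable of `Γ` is a variable of `Γ'`. -/
def Ext (Γ' : Ctx α E') (Γ : Ctx α E) (π : E' → E) : Prop := ∀ f, Var Γ f → Var Γ' (f ∘ π)

/-- A property of environments that is defined by a Σ-formula. -/
def Sig (Γ : Ctx α E) (P : E → Prop) : Prop :=
  ∃ φ : (hfLang ordFieldLang).BoundedFormula α Γ.n, IsSigma φ ∧
    ∀ e, φ.Realize (Γ.free e) (Γ.bound e) ↔ P e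

/-- A property of environments that is defined by a Σ-formula in every extension of the context. -/
def SDef (Γ : Ctx α E) (P : E → Prop) : Prop :=
  ∀ ⦃E' : Type⦄ (Γ' : Ctx α E') (π : E' → E), Ext Γ' Γ π → Sig Γ' (P ∘ π)

/-- A real-valued function of environments whose graph is defined by a Σ-formula. -/
def RDef (Γ : Ctx α E) (f : E → ℝ) : Prop := SDef Γ.extR fun e => e.2 = f e.1

theorem Ext.refl : Ext Γ Γ id := fun _ h => h

theorem Ext.trans {π : E' → E} {π' : E'' → E'} (h' : Ext Γ'' Γ' π') (h : Ext Γ' Γ π) :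
    Ext Γ'' Γ (π ∘ π') := fun _ hf => h' _ (h _ hf)

theorem ext_ext : Ext Γ.ext Γ Prod.fst := by
  rintro f ⟨i | i, hi⟩
  · exact ⟨.inl i, fun e => hi e.1⟩
  · refine ⟨.inr i.castSucc, fun e => ?_⟩
    exact (Fin.snoc_castSucc (α := fun _ => HF ℝ) _ _ _).trans (hi e.1)

theorem ext_extR : Ext Γ.extR Γ Prod.fst := by
  rintro f ⟨i | i, hi⟩
  · exact ⟨.inl i, fun e => hi e.1⟩
  · refine ⟨.inr i.castSucc, fun e => ?_⟩
    exact (Fin.snoc_castSucc (α := fun _ => HF ℝ) _ _ _).trans (hi e.1)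

theorem Var.z : Var Γ.ext Prod.snd :=
  ⟨.inr (Fin.last _), fun _ => Fin.snoc_last (α := fun _ => HF ℝ) _ _⟩

theorem RVar.z : RVar Γ.extR Prod.snd :=
  ⟨.inr (Fin.last _), fun _ => Fin.snoc_last (α := fun _ => HF ℝ) _ _⟩

theorem Var.sH {f : E → HF ℝ} (h : Var Γ f) : Var Γ.ext fun e => f e.1 := ext_ext _ h

theorem Var.s {f : E → HF ℝ} (h : Var Γ f) : Var Γ.extR fun e => f e.1 := ext_extR _ h

theorem RVar.sH {f : E → ℝ} (h : RVar Γ f) : RVar Γ.ext fun e => f e.1 := ext_ext _ h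

theorem RVar.s {f : E → ℝ} (h : RVar Γ f) : RVar Γ.extR fun e => f e.1 := ext_extR _ h

/-- The new variable of `Γ.ext` may be instantiated by any variable of `Γ'`. This is substitution,
carried out on environments instead of formulas. -/
theorem Ext.lift_of_var {π : E' → E} (h : Ext Γ' Γ π) {g : E' → HF ℝ} (hg : Var Γ' g) :
    Ext Γ' Γ.ext fun e => (π e, g e) := by
  rintro f ⟨i | i, hi⟩
  · obtain ⟨j, hj⟩ := h (fun e => Γ.free e i) ⟨.inl i, fun _ => rfl⟩
    exact ⟨j, fun e => (hj e).trans (hi (π e, g e))⟩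
  · induction i using Fin.lastCases with
    | last =>
      obtain ⟨j, hj⟩ := hg
      refine ⟨j, fun e => (hj e).trans ((Eq.symm ?_).trans (hi (π e, g e)))⟩
      exact Fin.snoc_last (α := fun _ => HF ℝ) _ _
    | cast i =>
      obtain ⟨j, hj⟩ := h (fun e => Γ.bound e i) ⟨.inr i, fun _ => rfl⟩
      refine ⟨j, fun e => (hj e).trans ((Eq.symm ?_).trans (hi (π e, g e)))⟩
      exact Fin.snoc_castSucc (α := fun _ => HF ℝ) _ _ _

theorem Ext.lift_of_rvar {π : E' → E} (h : Ext Γ' Γ π) {g : E' → ℝ} (hg : RVar Γ' g) :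
    Ext Γ' Γ.extR fun e => (π e, g e) := fun _ hf =>
  h.lift_of_var hg (fun e => Sum.elim (Γ.ext.free e) (Γ.ext.bound e) hf.choose)
    ⟨hf.choose, fun _ => rfl⟩ |>.imp fun _ hj e => (hj e).trans (hf.choose_spec (π e, g e))

theorem Ext.lift {π : E' → E} (h : Ext Γ' Γ π) : Ext Γ'.ext Γ.ext fun e => (π e.1, e.2) :=
  (ext_ext.trans h).lift_of_var .z

theorem Ext.liftR {π : E' → E} (h : Ext Γ' Γ π) : Ext Γ'.extR Γ.extR fun e => (π e.1, e.2) :=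
  (ext_extR.trans h).lift_of_rvar .z

namespace SDef

variable {P Q : E → Prop}

theorem sig (h : SDef Γ P) : Sig Γ P := h Γ id .refl

/-- Because `SDef` quantifies over all extensions of the context, weakening and substitution of
variables are compositions of maps, and no formula has to be renamed. -/
theorem comp {π : E' → E} (hπ : Ext Γ' Γ π) (h : SDef Γ P) : SDef Γ' (P ∘ π) :=
  fun _ _ _ hπ' => h _ _ (hπ'.trans hπ)

theorem congr (h : SDef Γ P) (h' : ∀ e, P e ↔ Q e) : SDef Γ Q := by
  rwa [show Q = P from funext fun e => propext (h' e).symm]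

theorem and (hP : SDef Γ P) (hQ : SDef Γ Q) : SDef Γ fun e => P e ∧ Q e := by
  intro E' Γ' π hπ
  obtain ⟨φ, h, hφ⟩ := hP Γ' π hπ
  obtain ⟨ψ, h', hψ⟩ := hQ Γ' π hπ
  exact ⟨_, h.and h', fun e => BoundedFormula.realize_inf.trans (and_congr (hφ e) (hψ e))⟩

theorem or (hP : SDef Γ P) (hQ : SDef Γ Q) : SDef Γ fun e => P e ∨ Q e := by
  intro E' Γ' π hπ
  obtain ⟨φ, h, hφ⟩ := hP Γ' π hπ
  obtain ⟨ψ, h', hψ⟩ := hQ Γ' π hπ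
  exact ⟨_, h.or h', fun e => BoundedFormula.realize_sup.trans (or_congr (hφ e) (hψ e))⟩

theorem const (p : Prop) : SDef Γ fun _ => p := by
  intro E' Γ' π _
  by_cases hp : p
  · exact ⟨⊥ ⟹ ⊥, .delta0 (.imp .falsum .falsum), fun e => by simp [hp]⟩
  · exact ⟨⊥, .delta0 .falsum, fun e => by simp [hp]⟩

theorem exists_list {ι : Type*} (l : List ι) {P : ι → E → Prop} (h : ∀ i ∈ l, SDef Γ (P i)) :
    SDef Γ fun e => ∃ i ∈ l, P i e := by
  induction l with
  | nil => exact (const False).congr (by simp)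
  | cons a l ih =>
    exact ((h a List.mem_cons_self).or (ih fun i hi => h i (List.mem_cons_of_mem _ hi))).congr
      (by simp)

theorem forall_list {ι : Type*} (l : List ι) {P : ι → E → Prop} (h : ∀ i ∈ l, SDef Γ (P i)) :
    SDef Γ fun e => ∀ i ∈ l, P i e := by
  induction l with
  | nil => exact (const True).congr (by simp)
  | cons a l ih =>
    exact ((h a List.mem_cons_self).and (ih fun i hi => h i (List.mem_cons_of_mem _ hi))).congr
      (by simp)

theorem exists_finite {ι : Type*} [Finite ι] {P : ι → E → Prop} (h : ∀ i, SDef Γ (P i)) :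
    SDef Γ fun e => ∃ i, P i e := by
  have := Fintype.ofFinite ι
  exact (exists_list Finset.univ.toList fun i _ => h i).congr (by simp)

theorem forall_finite {ι : Type*} [Finite ι] {P : ι → E → Prop} (h : ∀ i, SDef Γ (P i)) :
    SDef Γ fun e => ∀ i, P i e := by
  have := Fintype.ofFinite ι
  exact (forall_list Finset.univ.toList fun i _ => h i).congr (by simp)

theorem ex {P : E → HF ℝ → Prop} (h : SDef Γ.ext fun e => P e.1 e.2) :
    SDef Γ fun e => ∃ a, P e a := by
  intro E' Γ' π hπ
  obtain ⟨φ, hφ, h'⟩ := h _ _ hπ.lift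
  exact ⟨_, .ex hφ, fun e => BoundedFormula.realize_ex.trans (exists_congr fun a => h' (e, a))⟩

theorem allMem {P : E → HF ℝ → Prop} {f : E → HF ℝ} (hf : Var Γ f)
    (h : SDef Γ.ext fun e => P e.1 e.2) : SDef Γ fun e => ∀ a, Mem a.1 (f e).1 → P e a := by
  intro E' Γ' π hπ
  obtain ⟨i, hi⟩ := hπ _ hf
  obtain ⟨φ, hφ, h'⟩ := h _ _ hπ.lift
  refine ⟨_, .allMem (Term.var i) hφ, fun e => (realize_allMem _ _ _ _).trans ?_⟩
  rw [Term.realize_var, hi]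
  exact forall_congr' fun a => imp_congr_right fun _ => h' (e, a)

end SDef

/-! #### Atomic properties -/

theorem isAtomic_rel {n k : ℕ} (R : (hfLang ordFieldLang).Relations k) (i : Fin k → α ⊕ Fin n) :
    (Relations.boundedFormula R fun j => Term.var (i j)).IsAtomic := .rel _ _

theorem realize_atomic {n k : ℕ} (R : (hfLang ordFieldLang).Relations k) (i : Fin k → α ⊕ Fin n)
    (v : α → HF ℝ) (x : Fin n → HF ℝ) :
    (Relations.boundedFormula R fun j => Term.var (i j)).Realize v x ↔
      Structure.RelMap R fun j => Sum.elim v x (i j) := BoundedFormula.realize_rel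

theorem sdef_relMap {k : ℕ} (R : (hfLang ordFieldLang).Relations k) {f : Fin k → E → HF ℝ}
    (hf : ∀ j, Var Γ (f j)) : SDef Γ fun e => Structure.RelMap R fun j => f j e := by
  intro E' Γ' π hπ
  choose i hi using fun j => hπ _ (hf j)
  refine ⟨_, .delta0 (.atomic (isAtomic_rel R i)), fun e => (realize_atomic _ _ _ _).trans ?_⟩
  exact iff_of_eq (congrArg _ (funext fun j => hi j e))

theorem sdef_not_relMap {k : ℕ} (R : (hfLang ordFieldLang).Relations k) {f : Fin k → E → HF ℝ}
    (hf : ∀ j, Var Γ (f j)) : SDef Γ fun e => ¬ Structure.RelMap R fun j => f j e := by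
  intro E' Γ' π hπ
  choose i hi using fun j => hπ _ (hf j)
  refine ⟨_, .delta0 (.imp (.atomic (isAtomic_rel R i)) .falsum), fun e =>
    BoundedFormula.realize_imp.trans (imp_congr ((realize_atomic _ _ _ _).trans ?_) Iff.rfl)⟩
  exact iff_of_eq (congrArg _ (funext fun j => hi j e))

theorem sdef_mem {f g : E → HF ℝ} (hf : Var Γ f) (hg : Var Γ g) :
    SDef Γ fun e => Mem (f e).1 (g e).1 :=
  sdef_relMap (f := ![f, g]) (memSymb (L := ordFieldLang)) (Fin.forall_fin_two.2 ⟨hf, hg⟩)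

theorem sdef_eq_var {f g : E → HF ℝ} (hf : Var Γ f) (hg : Var Γ g) :
    SDef Γ fun e => f e = g e := by
  intro E' Γ' π hπ
  obtain ⟨i, hi⟩ := hπ _ hf
  obtain ⟨j, hj⟩ := hπ _ hg
  refine ⟨_, .delta0 (.atomic (.equal (Term.var i) (Term.var j))), fun e => ?_⟩
  refine (BoundedFormula.realize_bdEqual _ _).trans ?_
  rw [Term.realize_var, Term.realize_var, hi, hj]
  rfl

theorem relMap_singleton {k : ℕ} {S : (Fin k → ℝ) → Prop} (x : Fin k → ℝ) :
    (∃ y : Fin k → ℝ, (∀ i, (singleton (x i)).1 = singletonAtom (y i)) ∧ S y) ↔ S x := by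
  constructor
  · rintro ⟨y, h, hy⟩
    obtain rfl : x = y := funext fun i => singleton_injective (Subtype.ext (h i))
    exact hy
  · exact fun h => ⟨x, fun _ => rfl, h⟩

/-- The symbol `<` of the language of `HF(ℝ)`. -/
def ltSymb : (hfLang ordFieldLang).Relations 2 := HFRel.rel OrdFieldRel.lt

/-- The symbol for the graph of an operation in the language of `HF(ℝ)`. -/
def graphSymb {k : ℕ} (F : OrdFieldFun k) : (hfLang ordFieldLang).Relations (k + 1) :=
  HFRel.graph F

/-- An element of `HF(ℝ)` that is the singleton of a real number. -/
def IsReal (a : HF ℝ) : Prop := ∃ x : ℝ, a = singleton x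

/-- The relation `<` of `HF(ℝ)` holds of singletons of reals only, and every real has a larger one.
-/
theorem sdef_isReal {f : E → HF ℝ} (hf : Var Γ f) : SDef Γ fun e => IsReal (f e) := by
  refine (SDef.ex (P := fun e b => Structure.RelMap ltSymb
    fun j => (![f e, b] : Fin 2 → HF ℝ) j) ?_).congr fun e => ⟨?_, ?_⟩
  · refine (sdef_relMap (f := ![fun e => f e.1, fun e => e.2]) ltSymb
      (Fin.forall_fin_two.2 ⟨hf.sH, .z⟩)).congr fun e => iff_of_eq (congrArg _ (funext fun j => ?_))
    fin_cases j <;> rfl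
  · rintro ⟨b, x, h, -⟩
    exact ⟨x 0, Subtype.ext (h 0)⟩
  · rintro ⟨x, hx⟩
    refine ⟨singleton (x + 1), ![x, x + 1], fun j => ?_, lt_add_one x⟩
    fin_cases j
    · exact congrArg Subtype.val hx
    · rfl

theorem sdef_zero {f : E → HF ℝ} (hf : Var Γ f) : SDef Γ fun e => f e = singleton 0 :=
  (sdef_relMap (f := ![f]) (graphSymb OrdFieldFun.zero) (Fin.forall_fin_one.2 hf)).congr
    fun e => ⟨fun ⟨x, h, h'⟩ => Subtype.ext ((h 0).trans (congrArg singletonAtom h'.symm)),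
      fun h => ⟨fun _ => 0, fun j => by
        fin_cases j
        exact congrArg Subtype.val h, rfl⟩⟩

/-- The graph of addition holds of `(a, {0}, a)` exactly when `a` is the singleton of a real, and
the negation of an atomic formula is Δ₀. -/
theorem sdef_not_isReal {f : E → HF ℝ} (hf : Var Γ f) : SDef Γ fun e => ¬ IsReal (f e) := by
  refine (SDef.ex (P := fun e b => b = singleton 0 ∧
    ¬ Structure.RelMap (graphSymb OrdFieldFun.add)
      fun j => (![f e, b, f e] : Fin 3 → HF ℝ) j) ?_).congr fun e => ⟨?_, ?_⟩
  · refine (sdef_zero .z).and ((sdef_not_relMap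
      (f := ![fun e => f e.1, fun e => e.2, fun e => f e.1]) (graphSymb OrdFieldFun.add)
      (fun j => ?_)).congr fun e => not_congr (iff_of_eq (congrArg _ (funext fun j => ?_))))
    · fin_cases j
      exacts [hf.sH, .z, hf.sH]
    · fin_cases j <;> rfl
  · rintro ⟨b, rfl, h⟩ ⟨x, hx⟩
    refine h ⟨![x, 0, x], fun j => ?_, add_zero x⟩
    fin_cases j
    exacts [congrArg Subtype.val hx, rfl, congrArg Subtype.val hx]
  · intro h
    refine ⟨_, rfl, ?_⟩
    rintro ⟨x, h', -⟩
    exact h ⟨x 0, Subtype.ext (h' 0)⟩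

theorem sdef_eq_rvar {f g : E → ℝ} (hf : RVar Γ f) (hg : RVar Γ g) : SDef Γ fun e => f e = g e :=
  (sdef_eq_var hf hg).congr fun _ => singleton_injective.eq_iff

theorem sdef_lt_rvar {f g : E → ℝ} (hf : RVar Γ f) (hg : RVar Γ g) : SDef Γ fun e => f e < g e :=
  (sdef_relMap (f := ![fun e => singleton (f e), fun e => singleton (g e)])
    ltSymb (Fin.forall_fin_two.2 ⟨hf, hg⟩)).congr fun e => by
      have : (fun j => (![fun e => singleton (f e), fun e => singleton (g e)] : Fin 2 → _) j e) =
          fun j => singleton ((![f e, g e] : Fin 2 → ℝ) j) := by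
        funext j
        fin_cases j <;> rfl
      rw [this]
      exact relMap_singleton (S := fun y => y 0 < y 1) ![f e, g e]

theorem sdef_graph_rvar (F : OrdFieldFun 2) {f g h : E → ℝ} (hf : RVar Γ f) (hg : RVar Γ g)
    (hh : RVar Γ h) : SDef Γ fun e =>
      Structure.funMap (L := ordFieldLang) (M := ℝ) F ![f e, g e] = h e :=
  (sdef_relMap (f := ![fun e => singleton (f e), fun e => singleton (g e),
      fun e => singleton (h e)]) (graphSymb F) (fun j => by
    fin_cases j
    exacts [hf, hg, hh])).congr fun e => by
      have : (fun j => (![fun e => singleton (f e), fun e => singleton (g e),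
          fun e => singleton (h e)] : Fin 3 → _) j e) =
          fun j => singleton ((![f e, g e, h e] : Fin 3 → ℝ) j) := by
        funext j
        fin_cases j <;> rfl
      rw [this]
      refine (relMap_singleton (S := fun y => Structure.funMap (L := ordFieldLang) (M := ℝ) F
        (Fin.init y) = y (Fin.last 2)) ![f e, g e, h e]).trans ?_
      have : Fin.init (![f e, g e, h e] : Fin 3 → ℝ) = ![f e, g e] := by
        funext j
        fin_cases j <;> rfl
      rw [this]
      rfl

/-! #### Real numbers -/

theorem SDef.exR {P : E → ℝ → Prop} (h : SDef Γ.extR fun e => P e.1 e.2) :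
    SDef Γ fun e => ∃ a, P e a := by
  intro E' Γ' π hπ
  obtain ⟨φ, hφ, h'⟩ := h _ _ hπ.liftR
  obtain ⟨ψ, hψ, h''⟩ := (sdef_isReal (Γ := Γ'.ext) Var.z).sig
  refine ⟨_, .ex (hψ.and hφ), fun e => BoundedFormula.realize_ex.trans ?_⟩
  constructor
  · rintro ⟨a, ha⟩
    obtain ⟨ha, ha'⟩ := BoundedFormula.realize_inf.1 ha
    obtain ⟨x, rfl⟩ := (h'' (e, a)).1 ha
    exact ⟨x, (h' (e, x)).1 ha'⟩
  · rintro ⟨x, hx⟩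
    exact ⟨singleton x, BoundedFormula.realize_inf.2 ⟨(h'' (e, singleton x)).2 ⟨x, rfl⟩,
      (h' (e, x)).2 hx⟩⟩

/-- The restriction of a bounded universal quantifier to reals becomes a disjunction with the
negation of `IsReal`. Hence that negation has to be Σ as well. -/
theorem SDef.allMemR {P : E → ℝ → Prop} {f : E → HF ℝ} (hf : Var Γ f)
    (h : SDef Γ.extR fun e => P e.1 e.2) :
    SDef Γ fun e => ∀ x, Mem (singleton x).1 (f e).1 → P e x := by
  intro E' Γ' π hπ
  obtain ⟨i, hi⟩ := hπ _ hf
  obtain ⟨φ, hφ, h'⟩ := h _ _ hπ.liftR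
  obtain ⟨ψ, hψ, h''⟩ := (sdef_not_isReal (Γ := Γ'.ext) Var.z).sig
  refine ⟨_, .allMem (Term.var i) (hψ.or hφ), fun e => (realize_allMem _ _ _ _).trans ?_⟩
  rw [Term.realize_var, hi]
  constructor
  · intro H x hx
    refine (h' (e, x)).1 ((BoundedFormula.realize_sup.1 (H _ hx)).resolve_left fun H' => ?_)
    exact (h'' (e, singleton x)).1 H' ⟨x, rfl⟩
  · intro H a ha
    refine BoundedFormula.realize_sup.2 ?_
    by_cases hr : IsReal a
    · obtain ⟨x, rfl⟩ := hr
      exact Or.inr ((h' (e, x)).2 (H x ha))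
    · exact Or.inl ((h'' (e, a)).2 hr)

namespace RDef

variable {f g : E → ℝ}

theorem comp {π : E' → E} (hπ : Ext Γ' Γ π) (h : RDef Γ f) : RDef Γ' (f ∘ π) :=
  SDef.comp hπ.liftR h

theorem s (h : RDef Γ f) : RDef Γ.extR fun e => f e.1 := h.comp ext_extR

theorem sH (h : RDef Γ f) : RDef Γ.ext fun e => f e.1 := h.comp ext_ext

theorem var (h : RVar Γ f) : RDef Γ f := sdef_eq_rvar .z h.s

theorem z : RDef Γ.extR fun e => e.2 := var .z

/-- A definable function is eliminated by naming its value with an existential quantifier, so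
functions and relations can be composed freely. -/
theorem subst {Q : E → ℝ → Prop} (hf : RDef Γ f) (hQ : SDef Γ.extR fun e => Q e.1 e.2) :
    SDef Γ fun e => Q e (f e) :=
  (SDef.exR (P := fun e x => x = f e ∧ Q e x) (SDef.and hf hQ)).congr fun _ => by simp

theorem graph (F : OrdFieldFun 2) (hf : RDef Γ f) (hg : RDef Γ g) :
    RDef Γ fun e => Structure.funMap (L := ordFieldLang) (M := ℝ) F ![f e, g e] :=
  hf.s.subst (Q := fun (e : E × ℝ) a => e.2 = Structure.funMap (L := ordFieldLang) (M := ℝ) F ![a, g e.1])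
    (hg.s.s.subst (Q := fun (e : (E × ℝ) × ℝ) b => e.1.2 =
        Structure.funMap (L := ordFieldLang) (M := ℝ) F ![e.2, b])
      ((sdef_graph_rvar F (RVar.s .z) .z (RVar.s (RVar.s .z))).congr fun _ => eq_comm))

theorem add (hf : RDef Γ f) (hg : RDef Γ g) : RDef Γ fun e => f e + g e := graph .add hf hg

theorem mul (hf : RDef Γ f) (hg : RDef Γ g) : RDef Γ fun e => f e * g e := graph .mul hf hg

theorem eq (hf : RDef Γ f) (hg : RDef Γ g) : SDef Γ fun e => f e = g e :=
  hf.subst (Q := fun e x => x = g e) hg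

theorem lt (hf : RDef Γ f) (hg : RDef Γ g) : SDef Γ fun e => f e < g e :=
  hf.subst (Q := fun e x => x < g e) (hg.s.subst (Q := fun e y => e.2 < y)
    (sdef_lt_rvar (RVar.s .z) .z))

theorem ne (hf : RDef Γ f) (hg : RDef Γ g) : SDef Γ fun e => f e ≠ g e :=
  ((hf.lt hg).or (hg.lt hf)).congr fun _ => ne_iff_lt_or_gt.symm

theorem le (hf : RDef Γ f) (hg : RDef Γ g) : SDef Γ fun e => f e ≤ g e :=
  ((hf.lt hg).or (hf.eq hg)).congr fun _ => le_iff_lt_or_eq.symm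

theorem sub (hf : RDef Γ f) (hg : RDef Γ g) : RDef Γ fun e => f e - g e :=
  (eq (z.add hg.s) hf.s).congr fun _ => eq_sub_iff_add_eq.symm

theorem zero : RDef Γ fun _ => 0 := (sdef_zero (Γ := Γ.extR) RVar.z).congr fun _ =>
  singleton_injective.eq_iff

theorem one : RDef Γ fun _ => 1 :=
  (sdef_relMap (f := ![fun e => singleton e.2]) (graphSymb OrdFieldFun.one)
    (fun j => by
      fin_cases j
      exact RVar.z (Γ := Γ))).congr fun e => by
      have : (fun j => (![fun e => singleton e.2] : Fin 1 → E × ℝ → HF ℝ) j e) =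
          fun j => singleton ((![e.2] : Fin 1 → ℝ) j) := by
        funext j
        fin_cases j
        rfl
      rw [this]
      exact (relMap_singleton (S := fun y => 1 = y 0) ![e.2]).trans eq_comm

theorem natCast (n : ℕ) : RDef Γ fun _ => (n : ℝ) := by
  induction n with
  | zero => simpa using zero
  | succ n ih => simpa using ih.add one

theorem intCast (n : ℤ) : RDef Γ fun _ => (n : ℝ) := by
  rcases n.eq_nat_or_neg with ⟨n, rfl | rfl⟩
  · simpa using natCast n
  · simpa using zero.sub (natCast n)

end RDef

/-! #### Finite sets of triples of real numbers -/

/-- The triples of real numbers that are represented in a hereditarily finite set. -/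
def triples (W : HF ℝ) : Set (ℝ × ℝ × ℝ) :=
  {τ | ∃ p : HF ℝ, Mem p.1 W.1 ∧ Mem (singleton τ.1).1 p.1 ∧ ∃ u : HF ℝ, Mem u.1 p.1 ∧
    Mem (singleton τ.2.1).1 u.1 ∧ ∃ w : HF ℝ, Mem w.1 u.1 ∧ Mem (singleton τ.2.2).1 w.1}

theorem not_mem_singleton (a : HF ℝ) (x : ℝ) : ¬ Mem a.1 (singleton x).1 := fun h =>
  a.2 x ((mem_singletonAtom _ _).1 h)

theorem exists_triples_eq (s : Set (ℝ × ℝ × ℝ)) (hs : s.Finite) : ∃ W, triples W = s := by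
  have key : ∀ τ : ℝ × ℝ × ℝ, ∃ p : HF ℝ, ∀ τ' : ℝ × ℝ × ℝ, (Mem (singleton τ'.1).1 p.1 ∧
      ∃ u : HF ℝ, Mem u.1 p.1 ∧ Mem (singleton τ'.2.1).1 u.1 ∧
        ∃ w : HF ℝ, Mem w.1 u.1 ∧ Mem (singleton τ'.2.2).1 w.1) ↔ τ' = τ := by
    rintro ⟨t, i, v⟩
    -- The triple is coded by `p = {{t}, u}` with `u = {{i}, w}` and `w = {{v}}`. Singletons of
    -- reals have no sets as members, so they cannot be confused with `u` or `w`, and the components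
    -- can be read back.
    obtain ⟨w, hw⟩ := exists_hf_of_finite {singleton v} (Set.finite_singleton _)
    obtain ⟨u, hu⟩ := exists_hf_of_finite {singleton i, w} (Set.toFinite _)
    obtain ⟨p, hp⟩ := exists_hf_of_finite {singleton t, u} (Set.toFinite _)
    have hwx : ∀ x, singleton x ≠ w := fun x h =>
      not_mem_singleton _ x (by rw [h]; exact (hw (singleton v)).2 rfl)
    have hux : ∀ x, singleton x ≠ u := fun x h =>
      not_mem_singleton _ x (by rw [h]; exact (hu w).2 (by simp))
    refine ⟨p, fun ⟨t', i', v'⟩ => ?_⟩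
    simp only [hp, Set.mem_insert_iff, Set.mem_singleton_iff, hux, or_false,
      singleton_injective.eq_iff, Prod.mk.injEq]
    refine and_congr_right fun _ => ⟨?_, ?_⟩
    · rintro ⟨u', rfl | rfl, h, w', h', h''⟩
      · exact (not_mem_singleton _ _ h).elim
      · rw [hu] at h h'
        have e : i' = i := by simpa [hwx, singleton_injective.eq_iff] using h
        rcases h' with rfl | rfl
        · exact (not_mem_singleton _ _ h'').elim
        · exact ⟨e, by simpa [singleton_injective.eq_iff] using (hw _).1 h''⟩
    · rintro ⟨rfl, rfl⟩
      exact ⟨u, Or.inr rfl, (hu _).2 (by simp), w, (hu _).2 (by simp), (hw _).2 rfl⟩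
  choose p hp using key
  obtain ⟨W, hW⟩ := exists_hf_of_finite (p '' s) (hs.image p)
  refine ⟨W, Set.ext fun τ => ⟨?_, fun h => ?_⟩⟩
  · rintro ⟨q, hq, h⟩
    obtain ⟨τ', hτ', rfl⟩ := (hW q).1 hq
    rwa [(hp τ' τ).1 h]
  · exact ⟨p τ, (hW _).2 ⟨τ, h, rfl⟩, (hp τ τ).2 rfl⟩

theorem sdef_mem_rdef {f : E → ℝ} {g : E → HF ℝ} (hf : RDef Γ f) (hg : Var Γ g) :
    SDef Γ fun e => Mem (singleton (f e)).1 (g e).1 :=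
  hf.subst (Q := fun e x => Mem (singleton x).1 (g e).1) (sdef_mem RVar.z hg.s)

theorem sdef_mem_triples {W : E → HF ℝ} {f g h : E → ℝ} (hW : Var Γ W) (hf : RDef Γ f)
    (hg : RDef Γ g) (hh : RDef Γ h) : SDef Γ fun e => (f e, g e, h e) ∈ triples (W e) := by
  refine .ex ((sdef_mem .z hW.sH).and ((sdef_mem_rdef hf.sH .z).and (.ex ?_)))
  refine (sdef_mem .z (Var.sH .z)).and ((sdef_mem_rdef hg.sH.sH .z).and (.ex ?_))
  exact (sdef_mem .z (Var.sH .z)).and (sdef_mem_rdef hh.sH.sH.sH .z)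

/-- All triples are reached from `W` by descending through members, so the quantifier is a chain of
bounded quantifiers and may stand in front of a Σ-property. -/
theorem sdef_forall_triples {W : E → HF ℝ} {P : E → ℝ → ℝ → ℝ → Prop} (hW : Var Γ W)
    (hP : SDef Γ.extR.extR.extR fun e => P e.1.1.1 e.1.1.2 e.1.2 e.2) :
    SDef Γ fun e => ∀ t i v, (t, i, v) ∈ triples (W e) → P e t i v := by
  have h₁ : SDef Γ.ext.extR.ext.extR.ext.extR fun e =>
      P e.1.1.1.1.1.1 e.1.1.1.1.2 e.1.1.2 e.2 := by
    refine hP.comp (π := fun e : (((((E × HF ℝ) × ℝ) × HF ℝ) × ℝ) × HF ℝ) × ℝ => (((e.1.1.1.1.1.1, e.1.1.1.1.2), e.1.1.2), e.2)) ?_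
    refine Ext.lift_of_rvar (Ext.lift_of_rvar (Ext.lift_of_rvar ?_ ?_) ?_) .z
    · exact ext_extR.trans (ext_ext.trans (ext_extR.trans (ext_ext.trans
        (ext_extR.trans ext_ext))))
    · exact RVar.s (RVar.sH (RVar.s (RVar.sH .z)))
    · exact RVar.s (RVar.sH .z)
  refine (SDef.allMem hW (P := fun e p => ∀ t, Mem (singleton t).1 p.1 → ∀ u : HF ℝ, Mem u.1 p.1 →
    ∀ i, Mem (singleton i).1 u.1 → ∀ w : HF ℝ, Mem w.1 u.1 → ∀ v, Mem (singleton v).1 w.1 →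
    P e t i v) ?_).congr fun e => ⟨?_, ?_⟩
  · refine .allMemR .z (.allMem (Var.s .z) (.allMemR .z (.allMem (Var.s .z) (.allMemR .z h₁))))
  · rintro H t i v ⟨p, hp, ht, u, hu, hi, w, hw, hv⟩
    exact H p hp t ht u hu i hi w hw v hv
  · intro H p hp t ht u hu i hi w hw v hv
    exact H t i v ⟨p, hp, ht, u, hu, hi, w, hw, hv⟩

end HFSets

/-! ### Certificates for computations -/

namespace BSS

open HFSets

/-! #### Polynomial expressions -/

/-- Polynomial expressions in the contents of the cells of a tape. -/
inductive PExpr : Type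
  | const (r : ℝ)
  | var (i : ℤ)
  | add (a b : PExpr)
  | mul (a b : PExpr)

namespace PExpr

/-- The value of an expression. -/
def eval (x : ℤ → ℝ) : PExpr → ℝ
  | const r => r
  | var i => x i
  | add a b => a.eval x + b.eval x
  | mul a b => a.eval x * b.eval x

/-- The constants in an expression. -/
def consts : PExpr → Set ℝ
  | const r => {r}
  | var _ => ∅
  | add a b => a.consts ∪ b.consts
  | mul a b => a.consts ∪ b.consts

/-- The value of an expression, as a relation, when `L i` is the relation of being the content of
the cell `i`. -/
def Rel (L : ℤ → ℝ → Prop) : PExpr → ℝ → Prop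
  | const r, v => v = r
  | var i, v => L i v
  | add a b, v => ∃ x, a.Rel L x ∧ ∃ y, b.Rel L y ∧ v = x + y
  | mul a b, v => ∃ x, a.Rel L x ∧ ∃ y, b.Rel L y ∧ v = x * y

theorem finite_consts (e : PExpr) : e.consts.Finite := by
  induction e with
  | const r => exact Set.finite_singleton r
  | var i => exact Set.finite_empty
  | add a b ha hb => exact ha.union hb
  | mul a b ha hb => exact ha.union hb

theorem eq_eval_of_rel {L : ℤ → ℝ → Prop} {x : ℤ → ℝ} (h : ∀ i v, L i v → v = x i) (e : PExpr)
    {v : ℝ} (he : e.Rel L v) : v = e.eval x := by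
  induction e generalizing v with
  | const r => exact he
  | var i => exact h i v he
  | add a b ha hb =>
    obtain ⟨y, hy, z, hz, rfl⟩ := he
    rw [ha hy, hb hz]; rfl
  | mul a b ha hb =>
    obtain ⟨y, hy, z, hz, rfl⟩ := he
    rw [ha hy, hb hz]; rfl

/-- An expression reads finitely many cells, so a partial tape description suffices to evaluate it,
provided it contains the cells near the origin. -/
theorem exists_bound (e : PExpr) : ∃ B : ℕ, ∀ (L : ℤ → ℝ → Prop) (x : ℤ → ℝ),
    (∀ i : ℤ, |i| ≤ B → L i (x i)) → e.Rel L (e.eval x) := by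
  induction e with
  | const r => exact ⟨0, fun _ _ _ => rfl⟩
  | var i => exact ⟨i.natAbs, fun L x h => h i (by simp)⟩
  | add a b ha hb =>
    obtain ⟨A, hA⟩ := ha
    obtain ⟨B, hB⟩ := hb
    refine ⟨max A B, fun L x h => ⟨_, hA L x fun i hi => h i (hi.trans ?_), _,
      hB L x fun i hi => h i (hi.trans ?_), rfl⟩⟩ <;> simp
  | mul a b ha hb =>
    obtain ⟨A, hA⟩ := ha
    obtain ⟨B, hB⟩ := hb
    refine ⟨max A B, fun L x h => ⟨_, hA L x fun i hi => h i (hi.trans ?_), _,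
      hB L x fun i hi => h i (hi.trans ?_), rfl⟩⟩ <;> simp

end PExpr

theorem exists_pexpr (p : MvPolynomial ℤ ℝ) :
    ∃ e : PExpr, ∀ x : ℤ → ℝ, e.eval x = MvPolynomial.eval x p := by
  induction p using MvPolynomial.induction_on with
  | C a => exact ⟨.const a, fun x => by simp [PExpr.eval]⟩
  | add p q hp hq =>
    obtain ⟨a, ha⟩ := hp
    obtain ⟨b, hb⟩ := hq
    exact ⟨.add a b, fun x => by simp [PExpr.eval, ha, hb]⟩
  | mul_X p i hp =>
    obtain ⟨a, ha⟩ := hp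
    exact ⟨.mul a (.var i), fun x => by simp [PExpr.eval, ha]⟩

/-- An expression for a polynomial. -/
noncomputable def pexpr (p : MvPolynomial ℤ ℝ) : PExpr := (exists_pexpr p).choose

theorem eval_pexpr (p : MvPolynomial ℤ ℝ) (x : ℤ → ℝ) :
    (pexpr p).eval x = MvPolynomial.eval x p := (exists_pexpr p).choose_spec x

/-! #### Runs of machines -/

/-- The polynomials that occur in a node. -/
def Node.polys {Q : Type} : Node Q → Set (MvPolynomial ℤ ℝ)
  | .computation S num den _ => num '' S ∪ den '' S
  | .branch h _ _ => {h}
  | _ => ∅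

theorem Node.finite_polys {Q : Type} (q : Node Q) : q.polys.Finite := by
  cases q with
  | computation S num den _ => exact (S.finite_toSet.image _).union (S.finite_toSet.image _)
  | branch h _ _ => exact Set.finite_singleton h
  | shiftLeft _ => exact Set.finite_empty
  | shiftRight _ => exact Set.finite_empty
  | output => exact Set.finite_empty

namespace Machine

variable (T : Machine)

open Classical in
/-- The configuration that follows a configuration; divisions by zero are ignored. -/
noncomputable def next (c : T.Q × Tape) : T.Q × Tape :=
  match T.node c.1 with
  | .computation S num den q => (q, ratMap S num den c.2)
  | .branch h q₀ q₁ => (if 0 ≤ MvPolynomial.eval c.2 h then q₁ else q₀, c.2)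
  | .shiftLeft q => (q, shiftL c.2)
  | .shiftRight q => (q, shiftR c.2)
  | .output => c

/-- The configuration after `n` steps. -/
noncomputable def run (z : List ℝ) (n : ℕ) : T.Q × Tape := T.next^[n] (T.start, inputTape z)

variable {T}

theorem run_succ (z : List ℝ) (n : ℕ) : T.run z (n + 1) = T.next (T.run z n) :=
  Function.iterate_succ_apply' _ _ _

theorem Step.eq_next {c c' : T.Q × Tape} (h : T.Step c c') : c' = T.next c := by
  rw [Step] at h
  rw [next]
  revert h
  cases T.node c.1 with
  | computation S num den q => exact fun h => h.2
  | branch p q₀ q₁ =>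
    rintro (⟨h, rfl⟩ | ⟨h, rfl⟩)
    · dsimp only
      rw [if_pos h]
    · dsimp only
      rw [if_neg (not_le.2 h)]
  | shiftLeft q => exact fun h => h
  | shiftRight q => exact fun h => h
  | output => exact fun h => h.elim

theorem exists_run_of_reach {z : List ℝ} {c : T.Q × Tape}
    (h : Relation.ReflTransGen T.Step (T.start, inputTape z) c) :
    ∃ n, c = T.run z n ∧ ∀ k < n, T.Step (T.run z k) (T.run z (k + 1)) := by
  induction h with
  | refl => exact ⟨0, rfl, by simp⟩
  | tail _ h ih =>
    obtain ⟨n, rfl, hn⟩ := ih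
    have e := h.eq_next
    rw [← run_succ] at e
    subst e
    refine ⟨n + 1, rfl, fun k hk => ?_⟩
    rcases Nat.lt_succ_iff_lt_or_eq.1 hk with hk | rfl
    · exact hn k hk
    · exact h

theorem run_eq_of_output {z : List ℝ} {n m : ℕ} (h : T.node (T.run z n).1 = .output)
    (hnm : n ≤ m) : T.run z m = T.run z n := by
  induction m, hnm using Nat.le_induction with
  | base => rfl
  | succ m _ ih => rw [run_succ, ih, next, h]

theorem Computes.unique {z y y' : List ℝ} (h : T.Computes z y) (h' : T.Computes z y') :
    y = y' := by
  obtain ⟨c, hc, hout, rfl⟩ := h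
  obtain ⟨c', hc', hout', rfl⟩ := h'
  obtain ⟨n, rfl, -⟩ := exists_run_of_reach hc
  obtain ⟨m, rfl, -⟩ := exists_run_of_reach hc'
  rcases le_total n m with h | h
  · rw [run_eq_of_output hout h]
  · rw [run_eq_of_output hout' h]

end Machine

/-- The output has length one iff the run of ones from place `0` downwards has length exactly one.
This involves only the three cells `-1, 0, 1`. -/
theorem outputTape_eq_singleton {x : Tape} {b : ℝ} :
    [b] = outputTape x ↔ x 0 = 1 ∧ x (-1) ≠ 1 ∧ x 1 = b := by
  have hlen : (outputTape x).length = sInf {k : ℕ | x (-(k : ℤ)) ≠ 1} := by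
    simp [outputTape]
  have key : sInf {k : ℕ | x (-(k : ℤ)) ≠ 1} = 1 → [x 1] = outputTape x := fun h => by
    refine List.ext_getElem (by rw [hlen, h]; rfl) fun i h₁ h₂ => ?_
    simp only [List.length_cons, List.length_nil] at h₁
    obtain rfl : i = 0 := by omega
    simp [outputTape]
  have hinf : sInf {k : ℕ | x (-(k : ℤ)) ≠ 1} = 1 ↔ x 0 = 1 ∧ x (-1) ≠ 1 := by
    constructor
    · intro h
      have hne : {k : ℕ | x (-(k : ℤ)) ≠ 1}.Nonempty := by
        by_contra hne
        rw [Set.not_nonempty_iff_eq_empty.1 hne, Nat.sInf_empty] at h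
        omega
      have h₁ := Nat.sInf_mem hne
      rw [h] at h₁
      have h₀ : (0 : ℕ) ∉ {k : ℕ | x (-(k : ℤ)) ≠ 1} := Nat.notMem_of_lt_sInf (by omega)
      exact ⟨by simpa using h₀, by simpa using h₁⟩
    · rintro ⟨h₀, h₁⟩
      apply le_antisymm
      · exact Nat.sInf_le (by simpa using h₁)
      · refine le_csInf ⟨1, by simpa using h₁⟩ fun k hk => ?_
        rcases k with _ | k
        · exact (hk (by simpa using h₀)).elim
        · omega
  constructor
  · intro h
    have h₁ : sInf {k : ℕ | x (-(k : ℤ)) ≠ 1} = 1 := by rw [← hlen, ← h]; rfl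
    have h₂ := hinf.1 h₁
    refine ⟨h₂.1, h₂.2, ?_⟩
    have := (key h₁).trans h.symm
    simpa using this
  · rintro ⟨h₀, h₁, rfl⟩
    exact key (hinf.2 ⟨h₀, h₁⟩)

end BSS

namespace BSS

open HFSets

/-! #### Local rules for certificates

A certificate is a finite set of triples. A triple `(t, i, v)` with an integer `i` means that at the
time `t` the cell `i` contains `v`; a triple `(t, 1 / 2, v)` means that at the time `t` the machine is
at the node with the number `v`. -/

/-- The rule for the node that follows the node `q` at the time `t`. -/
def Node.NodeRule {Q : Type} (ν : Q → ℕ) (L : ℤ → ℝ → Prop) (q : Node Q) (v : ℝ) : Prop :=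
  match q with
  | .computation S _ den next =>
      (∀ i ∈ S.toList, ∃ d, (pexpr (den i)).Rel L d ∧ d ≠ 0) ∧ v = ν next
  | .branch h next₀ next₁ =>
      (∃ a, (pexpr h).Rel L a ∧ ((0 ≤ a ∧ v = ν next₁) ∨ (a < 0 ∧ v = ν next₀)))
  | .shiftLeft next => v = ν next
  | .shiftRight next => v = ν next
  | .output => False

/-- The rule for the content of the cell `j` at the time after `t`, when the machine is at the
node `q` at the time `t`. -/
def Node.CellRule {Q : Type} (M : Set (ℝ × ℝ × ℝ)) (t : ℝ) (q : Node Q) (j v : ℝ) : Prop :=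
  match q with
  | .computation S num den _ =>
      (∃ i ∈ S.toList, j = (i : ℤ) ∧ ∃ a, (pexpr (num i)).Rel (fun i v => (t, (i : ℝ), v) ∈ M) a ∧
        ∃ b, (pexpr (den i)).Rel (fun i v => (t, (i : ℝ), v) ∈ M) b ∧ v = a / b) ∨
      ((∀ i ∈ S.toList, j ≠ (i : ℤ)) ∧ (t, j, v) ∈ M)
  | .branch _ _ _ => (t, j, v) ∈ M
  | .shiftLeft _ => (t, j + 1, v) ∈ M
  | .shiftRight _ => (t, j - 1, v) ∈ M
  | .output => False

/-- The triple `(t, j, v)` is justified by the initial configuration or by other triples. -/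
def Justified (T : Machine) (ν : T.Q → ℕ) (Init : ℝ → ℝ → Prop) (M : Set (ℝ × ℝ × ℝ)) (t j v : ℝ) :
    Prop :=
  (t = 0 ∧ ((j = 1 / 2 ∧ v = ν T.start) ∨ (j ≠ 1 / 2 ∧ Init j v))) ∨
  ∃ s, t = s + 1 ∧ ∃ q, (s, 1 / 2, (ν q : ℝ)) ∈ M ∧
    ((j = 1 / 2 ∧ (T.node q).NodeRule ν (fun i v => (s, (i : ℝ), v) ∈ M) v) ∨
      (j ≠ 1 / 2 ∧ (T.node q).CellRule M s j v))

theorem intCast_ne_half (i : ℤ) : (i : ℝ) ≠ 1 / 2 := by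
  intro h
  have h' : (2 * i : ℝ) = 1 := by rw [h]; norm_num
  have : 2 * i = 1 := by exact_mod_cast h'
  omega

/-! ### Justified triples describe the actual computation -/

section Soundness

variable {T : Machine} {ν : T.Q → ℕ} {Init : ℝ → ℝ → Prop} {z : List ℝ}

theorem ratMap_apply (S : Finset ℤ) (num den : ℤ → MvPolynomial ℤ ℝ) (x : Tape) (i : ℤ) :
    ratMap S num den x i =
      if i ∈ S then MvPolynomial.eval x (num i) / MvPolynomial.eval x (den i) else x i := rfl

theorem step_of_nodeRule {c : T.Q × Tape} {L : ℤ → ℝ → Prop}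
    (hL : ∀ i v, L i v → v = c.2 i) {v : ℝ} (h : (T.node c.1).NodeRule ν L v) :
    v = ν (T.next c).1 ∧ T.Step c (T.next c) := by
  have hp : ∀ p v, (pexpr p).Rel L v → v = MvPolynomial.eval c.2 p := fun p v h => by
    rw [← eval_pexpr]
    exact PExpr.eq_eval_of_rel hL _ h
  rw [Machine.Step, Machine.next]
  revert h
  cases T.node c.1 with
  | computation S num den q =>
    rintro ⟨h, rfl⟩
    refine ⟨rfl, fun i hi => ?_, rfl⟩
    obtain ⟨d, hd, hd'⟩ := h i (by simpa using hi)
    rwa [hp _ _ hd] at hd'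
  | branch p q₀ q₁ =>
    rintro ⟨a, ha, h⟩
    rw [hp _ _ ha] at h
    rcases h with ⟨h, rfl⟩ | ⟨h, rfl⟩
    · dsimp only
      rw [if_pos h]
      exact ⟨rfl, Or.inl ⟨h, rfl⟩⟩
    · dsimp only
      rw [if_neg (not_le.2 h)]
      exact ⟨rfl, Or.inr ⟨h, rfl⟩⟩
  | shiftLeft q => exact fun h => ⟨h, rfl⟩
  | shiftRight q => exact fun h => ⟨h, rfl⟩
  | output => exact fun h => h.elim

theorem eq_of_cellRule {c : T.Q × Tape} {M : Set (ℝ × ℝ × ℝ)} {t : ℝ}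
    (hL : ∀ (i : ℤ) v, (t, (i : ℝ), v) ∈ M → v = c.2 i) {i : ℤ} {v : ℝ}
    (h : (T.node c.1).CellRule M t i v) : v = (T.next c).2 i := by
  have hp : ∀ p v, (pexpr p).Rel (fun i v => (t, (i : ℝ), v) ∈ M) v →
      v = MvPolynomial.eval c.2 p := fun p v h => by
    rw [← eval_pexpr]
    exact PExpr.eq_eval_of_rel hL _ h
  rw [Machine.next]
  revert h
  cases T.node c.1 with
  | computation S num den q =>
    rintro (⟨j, hj, hij, a, ha, b, hb, rfl⟩ | ⟨hi, h⟩)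
    · obtain rfl : i = j := by exact_mod_cast hij
      rw [ratMap_apply, if_pos (by simpa using hj), hp _ _ ha, hp _ _ hb]
    · rw [ratMap_apply, if_neg fun hi' => hi i (by simpa using hi') rfl]
      exact hL i v h
  | branch p q₀ q₁ => exact fun h => hL i v h
  | shiftLeft q =>
    intro h
    rw [shiftL_apply]
    exact hL (i + 1) v (by push_cast; exact h)
  | shiftRight q =>
    intro h
    rw [shiftR_apply]
    exact hL (i - 1) v (by push_cast; exact h)
  | output => exact fun h => h.elim

/-- A justification either refers to time `0` or to triples exactly one time unit earlier. A finite
set of triples has a least time, so the descent ends, all times are natural numbers, and induction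
on time compares the triples with the run. Triples for indices other than integers and `1 / 2` carry
no information. -/
theorem of_justified (hν : Function.Injective ν) {M : Set (ℝ × ℝ × ℝ)} (hM : M.Finite)
    (hInit : ∀ (i : ℤ) v, Init i v → v = inputTape z i)
    (h : ∀ t j v, (t, j, v) ∈ M → Justified T ν Init M t j v) {t j v : ℝ} (hτ : (t, j, v) ∈ M) :
    ∃ n : ℕ, t = n ∧ (j = 1 / 2 → v = ν (T.run z n).1 ∧
      Relation.ReflTransGen T.Step (T.start, inputTape z) (T.run z n)) ∧
      ∀ i : ℤ, j = i → v = (T.run z n).2 i := by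
  obtain ⟨b, hb⟩ := (hM.image Prod.fst).bddBelow
  have hb' : ∀ t j v, (t, j, v) ∈ M → b ≤ t := fun t j v h => hb ⟨_, h, rfl⟩
  -- Times are a priori arbitrary reals, so the induction is on the distance from the lower bound
  -- `b`.
  have key : ∀ k : ℕ, ∀ t j v, (t, j, v) ∈ M → t < b + k → ∃ n : ℕ, t = n ∧
      (j = 1 / 2 → v = ν (T.run z n).1 ∧
        Relation.ReflTransGen T.Step (T.start, inputTape z) (T.run z n)) ∧
      ∀ i : ℤ, j = i → v = (T.run z n).2 i := by
    intro k
    induction k with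
    | zero =>
      intro t j v hτ ht
      have := hb' t j v hτ
      simp only [Nat.cast_zero, add_zero] at ht
      linarith
    | succ k ih =>
      intro t j v hτ ht
      rcases h t j v hτ with ⟨rfl, h'⟩ | ⟨s, rfl, q, hq, h'⟩
      · refine ⟨0, by simp, fun hj => ?_, fun i hi => ?_⟩
        · rcases h' with ⟨-, rfl⟩ | ⟨hj', -⟩
          · exact ⟨rfl, .refl⟩
          · exact (hj' hj).elim
        · subst hi
          rcases h' with ⟨hj', -⟩ | ⟨-, h'⟩
          · exact (intCast_ne_half i hj').elim
          · exact hInit i v h'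
      · have hs : s < b + k := by
          push_cast at ht
          linarith
        obtain ⟨n, rfl, hn, -⟩ := ih s _ _ hq hs
        obtain ⟨hn, hreach⟩ := hn rfl
        obtain rfl : q = (T.run z n).1 := hν (by exact_mod_cast hn)
        have hL : ∀ (i : ℤ) v, ((n : ℝ), (i : ℝ), v) ∈ M → v = (T.run z n).2 i := by
          intro i v hv
          obtain ⟨m, hm, -, hm'⟩ := ih _ _ _ hv hs
          obtain rfl : n = m := by exact_mod_cast hm
          exact hm' i rfl
        refine ⟨n + 1, by simp, fun hj => ?_, fun i hi => ?_⟩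
        · rcases h' with ⟨-, h'⟩ | ⟨hj', -⟩
          · have := step_of_nodeRule hL h'
            rw [Machine.run_succ]
            exact ⟨this.1, hreach.tail this.2⟩
          · exact (hj' hj).elim
        · subst hi
          rcases h' with ⟨hj', -⟩ | ⟨-, h'⟩
          · exact (intCast_ne_half i hj').elim
          · rw [Machine.run_succ]
            exact eq_of_cellRule hL h'
  obtain ⟨k, hk⟩ := exists_nat_gt (t - b)
  exact key k t j v hτ (by linarith)

end Soundness

/-! ### Finitely many steps have a finite certificate -/

section Completeness

variable {T : Machine} {ν : T.Q → ℕ} {Init : ℝ → ℝ → Prop} {z : List ℝ}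

theorem nodeRule_of_step {B : ℕ} {q : T.Q} {x : Tape} {L : ℤ → ℝ → Prop}
    (hB : ∀ p ∈ (T.node q).polys, ∀ (L : ℤ → ℝ → Prop) (x : ℤ → ℝ),
      (∀ i : ℤ, |i| ≤ B → L i (x i)) → (pexpr p).Rel L ((pexpr p).eval x))
    (hL : ∀ i : ℤ, |i| ≤ B → L i (x i)) (h : T.Step (q, x) (T.next (q, x))) :
    (T.node q).NodeRule ν L (ν (T.next (q, x)).1) := by
  have hp : ∀ p ∈ (T.node q).polys, (pexpr p).Rel L (MvPolynomial.eval x p) := fun p hp => by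
    rw [← eval_pexpr]
    exact hB p hp L x hL
  rw [Machine.Step, Machine.next] at h
  rw [Machine.next]
  dsimp only at h ⊢
  revert h hp
  cases T.node q with
  | computation S num den q =>
    intro h hp
    exact ⟨fun i hi => ⟨_, hp _ (Or.inr ⟨i, by simpa using hi, rfl⟩), h.1 i (by simpa using hi)⟩, rfl⟩
  | branch p q₀ q₁ =>
    intro h hp
    refine ⟨_, hp _ rfl, ?_⟩
    dsimp only
    split_ifs with h'
    · exact Or.inl ⟨h', rfl⟩
    · exact Or.inr ⟨not_le.1 h', rfl⟩
  | shiftLeft q => exact fun _ _ => rfl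
  | shiftRight q => exact fun _ _ => rfl
  | output => exact fun h _ => h.elim

theorem cellRule_of_step {B : ℕ} {q : T.Q} {x : Tape} {M : Set (ℝ × ℝ × ℝ)} {t : ℝ} {i : ℤ}
    (hB : ∀ p ∈ (T.node q).polys, ∀ (L : ℤ → ℝ → Prop) (x : ℤ → ℝ),
      (∀ i : ℤ, |i| ≤ B → L i (x i)) → (pexpr p).Rel L ((pexpr p).eval x))
    (hL : ∀ i : ℤ, |i| ≤ B → (t, (i : ℝ), x i) ∈ M)
    (hL' : ∀ j : ℤ, |j| ≤ |i| + 1 → (t, (j : ℝ), x j) ∈ M)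
    (h : T.Step (q, x) (T.next (q, x))) :
    (T.node q).CellRule M t i ((T.next (q, x)).2 i) := by
  have hp : ∀ p ∈ (T.node q).polys, (pexpr p).Rel (fun i v => (t, (i : ℝ), v) ∈ M)
      (MvPolynomial.eval x p) := fun p hp => by
    rw [← eval_pexpr]
    exact hB p hp _ x hL
  rw [Machine.Step] at h
  rw [Machine.next]
  dsimp only at h ⊢
  revert h hp
  cases T.node q with
  | computation S num den q =>
    intro h hp
    dsimp only
    rw [ratMap_apply]
    by_cases hi : i ∈ S
    · rw [if_pos hi]
      exact Or.inl ⟨i, by simpa using hi, rfl, _, hp _ (Or.inl ⟨i, hi, rfl⟩), _,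
        hp _ (Or.inr ⟨i, hi, rfl⟩), rfl⟩
    · rw [if_neg hi]
      refine Or.inr ⟨fun j hj hij => hi ?_, hL' i (by omega)⟩
      obtain rfl : i = j := by exact_mod_cast hij
      simpa using hj
  | branch p q₀ q₁ => exact fun _ _ => hL' i (by omega)
  | shiftLeft q =>
    intro _ _
    have := hL' (i + 1) (abs_add_le i 1)
    push_cast at this
    exact this
  | shiftRight q =>
    intro _ _
    have := hL' (i - 1) (abs_sub i 1)
    push_cast at this
    exact this
  | output => exact fun h _ => h.elim

theorem Machine.exists_bound (T : Machine) : ∃ B : ℕ, ∀ q, ∀ p ∈ (T.node q).polys,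
    ∀ (L : ℤ → ℝ → Prop) (x : ℤ → ℝ), (∀ i : ℤ, |i| ≤ B → L i (x i)) →
      (pexpr p).Rel L ((pexpr p).eval x) := by
  have := T.finite
  choose b hb using fun p => (pexpr p).exists_bound
  obtain ⟨B, hB⟩ := ((Set.finite_iUnion fun q => (T.node q).finite_polys).image b).bddAbove
  refine ⟨B, fun q p hp L x h => hb p L x fun i hi => h i (hi.trans ?_)⟩
  exact_mod_cast hB ⟨p, Set.mem_iUnion.2 ⟨q, hp⟩, rfl⟩

/-- The first `n` steps of a computation have a certificate. -/
theorem exists_certificate (hInit : ∀ i : ℤ, Init i (inputTape z i)) {n : ℕ}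
    (hstep : ∀ k < n, T.Step (T.run z k) (T.run z (k + 1))) :
    ∃ M : Set (ℝ × ℝ × ℝ), M.Finite ∧
      (∀ t j v, (t, j, v) ∈ M → Justified T ν Init M t j v) ∧
      ((n : ℝ), 1 / 2, (ν (T.run z n).1 : ℝ)) ∈ M ∧
      ∀ i : ℤ, |i| ≤ 1 → ((n : ℝ), (i : ℝ), (T.run z n).2 i) ∈ M := by
  obtain ⟨B, hB⟩ := T.exists_bound
  -- The cell `i` after a step depends on the cells up to `|i| + 1` (shifts) and up to `B`
  -- (polynomials) before it. Widening the window by `B + 1` for each step backwards covers both,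
  -- and the final `+ 1` leaves the output cells `-1, 0, 1` at time `n`.
  let bd (k : ℕ) : ℕ := (B + 1) * (n - k) + 1
  let M : Set (ℝ × ℝ × ℝ) := ⋃ k ∈ Set.Iic n,
    ({((k : ℝ), 1 / 2, (ν (T.run z k).1 : ℝ))} ∪
      (fun i : ℤ => ((k : ℝ), (i : ℝ), (T.run z k).2 i)) '' Set.Icc (-(bd k : ℤ)) (bd k))
  have hM : ∀ k ≤ n, ∀ i : ℤ, |i| ≤ bd k → ((k : ℝ), (i : ℝ), (T.run z k).2 i) ∈ M :=
    fun k hk i hi => Set.mem_biUnion (Set.mem_Iic.2 hk) (Or.inr ⟨i, abs_le.1 hi, rfl⟩)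
  have hM' : ∀ k ≤ n, ((k : ℝ), 1 / 2, (ν (T.run z k).1 : ℝ)) ∈ M :=
    fun k hk => Set.mem_biUnion (Set.mem_Iic.2 hk) (Or.inl rfl)
  have hbd : ∀ k < n, bd k = bd (k + 1) + (B + 1) := fun k hk => by
    simp only [bd, show n - k = n - (k + 1) + 1 by omega]
    ring
  refine ⟨M, (Set.finite_Iic n).biUnion fun k _ => (Set.finite_singleton _).union
    ((Set.finite_Icc _ _).image _), fun t j v hτ => ?_, hM' n le_rfl,
    fun i hi => hM n le_rfl i (by simpa [bd] using hi)⟩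
  obtain ⟨k, hk, h⟩ := Set.mem_iUnion₂.1 hτ
  rw [Set.mem_Iic] at hk
  rcases k with _ | k
  · refine Or.inl ?_
    rcases h with h | ⟨i, -, h⟩
    · obtain ⟨rfl, rfl, rfl⟩ : t = (0 : ℕ) ∧ j = 1 / 2 ∧ v = (ν (T.run z 0).1 : ℝ) := by
        simpa using h
      exact ⟨by simp, Or.inl ⟨rfl, rfl⟩⟩
    · obtain ⟨rfl, rfl, rfl⟩ : (0 : ℕ) = t ∧ (i : ℝ) = j ∧ (T.run z 0).2 i = v := by
        simpa using h
      exact ⟨by simp, Or.inr ⟨intCast_ne_half i, hInit i⟩⟩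
  · have hs := hstep k hk
    rw [Machine.run_succ] at hs
    have hL : ∀ i : ℤ, |i| ≤ B → ((k : ℝ), (i : ℝ), (T.run z k).2 i) ∈ M := fun i hi =>
      hM k (by omega) i (by have := hbd k hk; omega)
    refine Or.inr ⟨k, ?_⟩
    rcases h with h | ⟨i, hi, h⟩
    · obtain ⟨rfl, rfl, rfl⟩ : t = (k + 1 : ℕ) ∧ j = 1 / 2 ∧
          v = (ν (T.run z (k + 1)).1 : ℝ) := by
        simpa using h
      refine ⟨by simp, _, hM' k (by omega), Or.inl ⟨rfl, ?_⟩⟩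
      rw [Machine.run_succ]
      exact nodeRule_of_step (hB _) hL hs
    · obtain ⟨rfl, rfl, rfl⟩ : (k + 1 : ℕ) = t ∧ (i : ℝ) = j ∧ (T.run z (k + 1)).2 i = v := by
        simpa using h
      refine ⟨by simp, _, hM' k (by omega), Or.inr ⟨intCast_ne_half i, ?_⟩⟩
      rw [Machine.run_succ]
      refine cellRule_of_step (hB _) hL (fun j hj => hM k (by omega) j ?_) hs
      have h₁ := abs_le.2 hi
      have := hbd k hk
      omega

end Completeness

/-- There is a certificate that a machine accepts with the output `b`. -/
def Accepts (T : Machine) (ν : T.Q → ℕ) (Init : ℝ → ℝ → Prop) (b : ℝ) : Prop :=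
  ∃ W : HF ℝ, (∀ t j v, (t, j, v) ∈ triples W → Justified T ν Init (triples W) t j v) ∧
    ∃ t, (∃ q, T.node q = .output ∧ (t, 1 / 2, (ν q : ℝ)) ∈ triples W) ∧
      (t, ((0 : ℤ) : ℝ), 1) ∈ triples W ∧ (∃ a, a ≠ 1 ∧ (t, ((-1 : ℤ) : ℝ), a) ∈ triples W) ∧
      (t, ((1 : ℤ) : ℝ), b) ∈ triples W

theorem finite_triples (W : HF ℝ) : (triples W).Finite := by
  have h : ∀ a : HF ℝ, {x : ℝ | Mem (singleton x).1 a.1}.Finite := fun a =>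
    (finite_mem_hf a).preimage singleton_injective.injOn
  have h' : ∀ a : HF ℝ, Finite {b : HF ℝ // Mem b.1 a.1} := fun a => (finite_mem_hf a).to_subtype
  have hS : ∀ (W p : HF ℝ), Mem p.1 W.1 → (⋃ (u : {b : HF ℝ // Mem b.1 p.1})
      (w : {b : HF ℝ // Mem b.1 u.1.1}), {x : ℝ | Mem (singleton x).1 p.1} ×ˢ
        ({x : ℝ | Mem (singleton x).1 u.1.1} ×ˢ {x : ℝ | Mem (singleton x).1 w.1.1})).Finite :=
    fun W p _ => Set.finite_iUnion fun u => Set.finite_iUnion fun w =>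
      (h _).prod ((h _).prod (h _))
  refine (Set.finite_iUnion fun p : {b : HF ℝ // Mem b.1 W.1} => hS W p.1 p.2).subset ?_
  rintro ⟨t, i, v⟩ ⟨p, hp, ht, u, hu, hi, w, hw, hv⟩
  simp only [Set.mem_iUnion]
  exact ⟨⟨p, hp⟩, ⟨u, hu⟩, ⟨w, hw⟩, ht, hi, hv⟩

/-- Soundness applies to every `W`, since the triples in a hereditarily finite set are always
finitely many; completeness uses that every finite set of triples comes from some `W`. -/
theorem accepts_iff {T : Machine} {ν : T.Q → ℕ} (hν : Function.Injective ν)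
    {Init : ℝ → ℝ → Prop} {z : List ℝ} (hInit : ∀ (i : ℤ) v, Init i v ↔ v = inputTape z i) (b : ℝ) :
    Accepts T ν Init b ↔ T.Computes z [b] := by
  constructor
  · rintro ⟨W, hW, t, ⟨q, hq, hqt⟩, h₀, ⟨a, ha, h₁⟩, h₂⟩
    have key := fun {t j v : ℝ} => of_justified (t := t) (j := j) (v := v) hν (finite_triples W)
      (fun i v h => (hInit i v).1 h) hW
    obtain ⟨n, rfl, hn, -⟩ := key hqt
    obtain ⟨hn, hreach⟩ := hn rfl
    obtain rfl : q = (T.run z n).1 := hν (by exact_mod_cast hn)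
    have hcell : ∀ (i : ℤ) v, ((n : ℝ), (i : ℝ), v) ∈ triples W → v = (T.run z n).2 i := by
      intro i v hv
      obtain ⟨m, hm, -, hm'⟩ := key hv
      obtain rfl : n = m := by exact_mod_cast hm
      exact hm' i rfl
    refine ⟨_, hreach, hq, outputTape_eq_singleton.2 ⟨?_, ?_, ?_⟩⟩
    · exact (hcell 0 1 h₀).symm
    · rw [← hcell (-1) a h₁]
      exact ha
    · exact (hcell 1 b h₂).symm
  · rintro ⟨c, hc, hout, hb⟩
    obtain ⟨n, rfl, hstep⟩ := Machine.exists_run_of_reach hc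
    obtain ⟨h₀, h₁, rfl⟩ := outputTape_eq_singleton.1 hb
    obtain ⟨M, hM, hJ, hq, hcell⟩ := exists_certificate (ν := ν)
      (fun i => (hInit i _).2 rfl) hstep
    obtain ⟨W, rfl⟩ := exists_triples_eq M hM
    refine ⟨W, hJ, n, ⟨_, hout, hq⟩, ?_, ⟨_, h₁, hcell (-1) (by simp)⟩, hcell 1 (by simp)⟩
    rw [← h₀]
    exact hcell 0 (by simp)

end BSS

namespace BSS

open HFSets

/-! #### Acceptance is Σ-definable -/

section Definability

variable {α E : Type} {Γ : Ctx α E}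

/-- The graph has a second branch for the convention `x / 0 = 0`. -/
theorem _root_.HFSets.RDef.div {f g : E → ℝ} (hf : RDef Γ f) (hg : RDef Γ g) :
    RDef Γ fun e => f e / g e := by
  refine (((hg.s.ne .zero).and ((RDef.z.mul hg.s).eq hf.s)).or
    ((hg.s.eq .zero).and (RDef.z.eq .zero))).congr fun e => ?_
  by_cases h : g e.1 = 0
  · simp [h]
  · simp [h, eq_div_iff h]

theorem half : RDef Γ fun _ => (1 / 2 : ℝ) := by
  simpa using RDef.one.div (RDef.natCast (Γ := Γ) 2)

theorem PExpr.sdef_rel (a : PExpr) {Γ : Ctx α E} (hc : ∀ r ∈ a.consts, RDef Γ fun _ => r)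
    {W : E → HF ℝ} {t v : E → ℝ} (hW : Var Γ W) (ht : RDef Γ t) (hv : RDef Γ v) :
    SDef Γ fun e => a.Rel (fun i x => (t e, (i : ℝ), x) ∈ triples (W e)) (v e) := by
  induction a generalizing E with
  | const r => exact hv.eq (hc r rfl)
  | var i => exact sdef_mem_triples hW ht (.intCast i) hv
  | add a b ha hb =>
    exact .exR ((ha (fun r hr => (hc r (Or.inl hr)).s) hW.s ht.s .z).and
      (.exR ((hb (fun r hr => (hc r (Or.inr hr)).s.s) hW.s.s ht.s.s .z).and
        (hv.s.s.eq (RDef.z.s.add .z)))))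
  | mul a b ha hb =>
    exact .exR ((ha (fun r hr => (hc r (Or.inl hr)).s) hW.s ht.s .z).and
      (.exR ((hb (fun r hr => (hc r (Or.inr hr)).s.s) hW.s.s ht.s.s .z).and
        (hv.s.s.eq (RDef.z.s.mul .z)))))

variable {W : E → HF ℝ} {t j v : E → ℝ}

theorem Node.sdef_nodeRule {Q : Type} (ν : Q → ℕ) (q : Node Q)
    (hc : ∀ p ∈ q.polys, ∀ r ∈ (pexpr p).consts, RDef Γ fun _ => r) (hW : Var Γ W) (ht : RDef Γ t)
    (hv : RDef Γ v) :
    SDef Γ fun e => q.NodeRule ν (fun i x => (t e, (i : ℝ), x) ∈ triples (W e)) (v e) := by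
  cases q with
  | computation S num den next =>
    exact (SDef.forall_list _ fun i hi => .exR (((pexpr (den i)).sdef_rel
      (fun r hr => (hc _ (Or.inr ⟨i, by simpa using hi, rfl⟩) r hr).s) hW.s ht.s .z).and
        (RDef.z.ne .zero))).and (hv.eq (.natCast _))
  | branch h q₀ q₁ =>
    exact .exR (((pexpr h).sdef_rel (fun r hr => (hc _ rfl r hr).s) hW.s ht.s .z).and
      (((RDef.zero.le .z).and (hv.s.eq (.natCast _))).or
        ((RDef.z.lt .zero).and (hv.s.eq (.natCast _)))))
  | shiftLeft q => exact hv.eq (.natCast _)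
  | shiftRight q => exact hv.eq (.natCast _)
  | output => exact .const False

theorem Node.sdef_cellRule {Q : Type} (q : Node Q)
    (hc : ∀ p ∈ q.polys, ∀ r ∈ (pexpr p).consts, RDef Γ fun _ => r) (hW : Var Γ W) (ht : RDef Γ t)
    (hj : RDef Γ j) (hv : RDef Γ v) :
    SDef Γ fun e => q.CellRule (triples (W e)) (t e) (j e) (v e) := by
  cases q with
  | computation S num den next =>
    refine (SDef.exists_list _ fun i hi => (hj.eq (.intCast i)).and (.exR ?_)).or
      ((SDef.forall_list _ fun i _ => hj.ne (.intCast i)).and (sdef_mem_triples hW ht hj hv))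
    have hi' : i ∈ S := by simpa using hi
    exact ((pexpr (num i)).sdef_rel (fun r hr => (hc _ (Or.inl ⟨i, hi', rfl⟩) r hr).s)
      hW.s ht.s .z).and (.exR (((pexpr (den i)).sdef_rel
        (fun r hr => (hc _ (Or.inr ⟨i, hi', rfl⟩) r hr).s.s) hW.s.s ht.s.s .z).and
          (hv.s.s.eq (RDef.z.s.div .z))))
  | branch h q₀ q₁ => exact sdef_mem_triples hW ht hj hv
  | shiftLeft q => exact sdef_mem_triples hW ht (hj.add .one) hv
  | shiftRight q => exact sdef_mem_triples hW ht (hj.sub .one) hv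
  | output => exact .const False

/-- All constants that occur in the machine are definable. -/
def HasConsts (Γ : Ctx α E) (T : Machine) : Prop :=
  ∀ q, ∀ p ∈ (T.node q).polys, ∀ r ∈ (pexpr p).consts, RDef Γ fun _ => r

theorem HasConsts.comp {E' : Type} {Γ' : Ctx α E'} {π : E' → E} (hπ : Ext Γ' Γ π) {T : Machine}
    (h : HasConsts Γ T) : HasConsts Γ' T := fun q p hp r hr => (h q p hp r hr).comp hπ

theorem sdef_justified {T : Machine} (ν : T.Q → ℕ) (hc : HasConsts Γ T) {Init : E → ℝ → ℝ → Prop}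
    (hI : SDef Γ fun e => Init e (j e) (v e)) (hW : Var Γ W) (ht : RDef Γ t) (hj : RDef Γ j)
    (hv : RDef Γ v) : SDef Γ fun e => Justified T ν (Init e) (triples (W e)) (t e) (j e) (v e) := by
  have := T.finite
  refine ((ht.eq .zero).and (((hj.eq half).and (hv.eq (.natCast _))).or ((hj.ne half).and hI))).or
    (.exR ((ht.s.eq (RDef.z.add .one)).and (.exists_finite fun q =>
      (sdef_mem_triples hW.s .z half (.natCast _)).and ?_)))
  exact ((hj.s.eq half).and
    ((T.node q).sdef_nodeRule ν ((hc.comp ext_extR) q) hW.s .z hv.s)).or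
    ((hj.s.ne half).and ((T.node q).sdef_cellRule ((hc.comp ext_extR) q) hW.s .z hj.s hv.s))

/-- Only the certificate `W`, the final time and the cell content different from `1` are sought by
quantifiers at the outer level. Justification is required for the triples in `W`, a bounded
condition, and the finitely many nodes give finite disjunctions. -/
theorem sdef_accepts {T : Machine} (ν : T.Q → ℕ) (hc : HasConsts Γ T) {Init : E → ℝ → ℝ → Prop}
    (hI : SDef Γ.extR.extR fun e => Init e.1.1 e.1.2 e.2) (b : ℕ) :
    SDef Γ fun e => Accepts T ν (Init e) b := by
  have := T.finite
  refine .ex ((sdef_forall_triples .z (sdef_justified ν (hc.comp (((ext_extR.trans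
    (ext_extR.trans (ext_extR.trans ext_ext)))))) ?_ (Var.s (Var.s (Var.s .z))) RDef.z.s.s
      RDef.z.s .z)).and (.exR (.and (.exists_finite fun q => (SDef.const _).and
        (sdef_mem_triples (Var.s .z) .z half (.natCast _))) ?_)))
  · refine hI.comp (π := fun e : (((E × HF ℝ) × ℝ) × ℝ) × ℝ => ((e.1.1.1.1, e.1.2), e.2)) ?_
    exact Ext.lift_of_rvar (Ext.lift_of_rvar (ext_extR.trans (ext_extR.trans (ext_extR.trans
      ext_ext))) (RVar.s .z)) .z
  · exact (sdef_mem_triples (Var.s .z) .z (.intCast 0) .one).and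
      ((SDef.exR ((RDef.z.ne .one).and (sdef_mem_triples (Var.s (Var.s .z)) RDef.z.s
        (.intCast (-1)) .z))).and (sdef_mem_triples (Var.s .z) .z (.intCast 1) (.natCast b)))

end Definability

/-! #### Codes of sequences -/

/-- The triples that represent a sequence of real numbers, together with its length. -/
def listCode (a : List ℝ) : Set (ℝ × ℝ × ℝ) :=
  {τ | ∃ n : ℕ, n ≤ a.length ∧ τ = (0, (n : ℝ), ((a.length : ℝ) :: a).getD n 0)}

theorem finite_listCode (a : List ℝ) : (listCode a).Finite := by
  refine ((Set.finite_Iic a.length).image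
    fun n : ℕ => ((0 : ℝ), (n : ℝ), ((a.length : ℝ) :: a).getD n 0)).subset ?_
  rintro τ ⟨n, hn, rfl⟩
  exact ⟨n, hn, rfl⟩

theorem mem_listCode_nat {a : List ℝ} {n : ℕ} {v : ℝ} : (0, (n : ℝ), v) ∈ listCode a ↔
    n ≤ a.length ∧ v = ((a.length : ℝ) :: a).getD n 0 := by
  constructor
  · rintro ⟨m, hm, h⟩
    simp only [Prod.mk.injEq, Nat.cast_inj, true_and] at h
    obtain ⟨rfl, rfl⟩ := h
    exact ⟨hm, rfl⟩
  · rintro ⟨hn, rfl⟩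
    exact ⟨n, hn, rfl⟩

theorem mem_listCode_zero {a : List ℝ} {v : ℝ} : (0, 0, v) ∈ listCode a ↔ v = a.length := by
  have := mem_listCode_nat (a := a) (n := 0) (v := v)
  simpa using this

theorem listCode_injective : Function.Injective listCode := by
  intro a b h
  have hlen : a.length = b.length := by
    have h₁ : ((0 : ℝ), (0 : ℝ), (a.length : ℝ)) ∈ listCode a := mem_listCode_zero.2 rfl
    rw [h, mem_listCode_zero] at h₁
    exact_mod_cast h₁
  refine List.ext_getElem hlen fun n h₁ h₂ => ?_
  have h₃ : ((0 : ℝ), ((n + 1 : ℕ) : ℝ), a[n]) ∈ listCode a :=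
    mem_listCode_nat.2 ⟨h₁, by simp [h₁]⟩
  rw [h, mem_listCode_nat] at h₃
  rw [h₃.2]
  simp [h₂]

/-- The hereditarily finite set represents a sequence. -/
def IsListCode (d : HF ℝ) : Prop :=
  ∃ n, (0, 0, n) ∈ triples d ∧ ∀ t i v, (t, i, v) ∈ triples d → t = 0 ∧
    ((i = 0 ∧ v = n) ∨ (1 ≤ i ∧ i ≤ n ∧ ∃ w, (0, i - 1, w) ∈ triples d)) ∧
    (i = n ∨ ∃ w, (0, i + 1, w) ∈ triples d) ∧
    ∀ t' i' v', (t', i', v') ∈ triples d → i ≠ i' ∨ v = v'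

/-- The conditions on neighbours replace the notion of natural number. Having a predecessor down to
`0` forces each index to be natural; having a successor up to `n` forces every natural number up to
`n` to occur and `n` itself to be natural. The last clause makes the values unique, and gives the
index `0` the value `n`. -/
theorem isListCode_iff (d : HF ℝ) : IsListCode d ↔ ∃ a, triples d = listCode a := by
  constructor
  · rintro ⟨n, h0, h⟩
    have hnat : ∀ k : ℕ, ∀ t i v, (t, i, v) ∈ triples d → i < k → ∃ m : ℕ, i = m := by
      intro k
      induction k with
      | zero =>
        intro t i v hτ hi
        rw [Nat.cast_zero] at hi
        rcases (h t i v hτ).2.1 with ⟨h, -⟩ | ⟨h, -⟩ <;> linarith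
      | succ k ih =>
        intro t i v hτ hi
        rcases (h t i v hτ).2.1 with ⟨rfl, -⟩ | ⟨-, -, w, hw⟩
        · exact ⟨0, by simp⟩
        · obtain ⟨m, hm⟩ := ih _ _ _ hw (by push_cast at hi; linarith)
          exact ⟨m + 1, by push_cast; linarith⟩
    have hall : ∀ m : ℕ, (m : ℝ) ≤ n → ∃ v, (0, (m : ℝ), v) ∈ triples d := by
      intro m
      induction m with
      | zero => exact fun _ => ⟨n, by simpa using h0⟩
      | succ m ih =>
        intro hm
        push_cast at hm
        obtain ⟨v, hv⟩ := ih (by linarith)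
        rcases (h _ _ _ hv).2.2.1 with h | ⟨w, hw⟩
        · linarith
        · exact ⟨w, by push_cast; exact hw⟩
    have hle : ∀ t i v, (t, i, v) ∈ triples d → 1 ≤ i → i ≤ n := by
      intro t i v hτ hi
      rcases (h t i v hτ).2.1 with ⟨h, -⟩ | ⟨-, h, -⟩
      · linarith
      · exact h
    have hn0 : 0 ≤ n := by
      rcases (h _ _ _ h0).2.2.1 with h' | ⟨w, hw⟩
      · exact h'.le
      · have := hle _ _ _ hw (by norm_num)
        linarith
    -- The index `⌊n⌋` occurs. If it were not `n`, its successor would occur too and be at most `n`,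
    -- contrary to the choice of the floor.
    obtain ⟨N, rfl⟩ : ∃ N : ℕ, n = N := by
      refine ⟨⌊n⌋₊, ?_⟩
      obtain ⟨v, hv⟩ := hall ⌊n⌋₊ (Nat.floor_le hn0)
      rcases (h _ _ _ hv).2.2.1 with h' | ⟨w, hw⟩
      · exact h'.symm
      · have h₁ := hle _ _ _ hw (by have : (0 : ℝ) ≤ ⌊n⌋₊ := Nat.cast_nonneg _; linarith)
        have h₂ := Nat.lt_floor_add_one n
        linarith
    choose! f hf using hall
    have hlen : (List.ofFn fun i : Fin N => f (i + 1)).length = N := List.length_ofFn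
    have hget : ∀ m ≤ N, ((N : ℝ) :: List.ofFn fun i : Fin N => f (i + 1)).getD m 0 = f m := by
      intro m hm
      rcases m with _ | m
      · have h₁ := hf 0 (by simp)
        rw [Nat.cast_zero] at h₁
        rcases (h _ _ _ h0).2.2.2 _ _ _ h₁ with h' | h'
        · exact (h' rfl).elim
        · simpa using h'
      · have hm' : m < N := hm
        simp [hm']
    refine ⟨List.ofFn fun i : Fin N => f (i + 1), Set.ext fun ⟨t, i, v⟩ => ⟨fun hτ => ?_, ?_⟩⟩
    · obtain ⟨rfl, h₁, -, h₂⟩ := h t i v hτ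
      obtain ⟨k, hk⟩ := exists_nat_gt i
      obtain ⟨m, rfl⟩ := hnat k _ _ _ hτ hk
      have hm : m ≤ N := by
        rcases h₁ with ⟨h₁, -⟩ | ⟨-, h₁, -⟩
        · have : m = 0 := by exact_mod_cast h₁
          omega
        · exact_mod_cast h₁
      rw [mem_listCode_nat, hlen, hget m hm]
      refine ⟨hm, (h₂ _ _ _ (hf m (by exact_mod_cast hm))).resolve_left fun h => h rfl⟩
    · rintro ⟨m, hm, e⟩
      rw [hlen] at hm
      rw [e, hlen, hget m hm]
      exact hf m (by exact_mod_cast hm)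
  · rintro ⟨a, ha⟩
    refine ⟨a.length, by rw [ha, mem_listCode_zero], ?_⟩
    rw [ha]
    rintro t i v ⟨m, hm, e⟩
    simp only [Prod.mk.injEq] at e
    obtain ⟨rfl, rfl, rfl⟩ := e
    refine ⟨rfl, ?_, ?_, ?_⟩
    · rcases m with _ | m
      · exact Or.inl (by simp)
      · refine Or.inr ⟨by simp, by exact_mod_cast hm,
          ((a.length : ℝ) :: a).getD m 0, m, by omega, ?_⟩
        simp only [Prod.mk.injEq, true_and]
        exact ⟨by simp, trivial⟩
    · rcases hm.eq_or_lt with rfl | hm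
      · exact Or.inl rfl
      · refine Or.inr ⟨((a.length : ℝ) :: a).getD (m + 1) 0, m + 1, hm, ?_⟩
        simp only [Prod.mk.injEq, true_and]
        exact ⟨by simp, trivial⟩
    · rintro t' i' v' ⟨m', hm', e⟩
      simp only [Prod.mk.injEq] at e
      obtain ⟨rfl, rfl, rfl⟩ := e
      by_cases h : m = m'
      · exact Or.inr (by rw [h])
      · exact Or.inl (by exact_mod_cast h)

theorem exists_listCode (a : List ℝ) : ∃ d, triples d = listCode a :=
  exists_triples_eq _ (finite_listCode a)

/-- The content of the cell `i` is `v`, when the input consists of the sequences that are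
represented by the list, each preceded by its length, beginning at the cell `o`. -/
def BlockCell : List (HF ℝ) → ℝ → ℝ → ℝ → Prop
  | [], o, i, v => (o ≤ i ∧ v = 0) ∨ (i ≤ 0 ∧ ((2 ≤ i + o ∧ v = 1) ∨ (i + o ≤ 1 ∧ v = 0)))
  | d :: ds, o, i, v => ∃ n, (0, 0, n) ∈ triples d ∧
      ((0, i - o, v) ∈ triples d ∨ BlockCell ds (o + n + 1) i v)

/-- The content of the cell `i` is `v`, when the input is the code of an atomic sentence. -/
def InitCell (c : ℕ) (ds : List (HF ℝ)) (i v : ℝ) : Prop := (i = 1 ∧ v = c) ∨ BlockCell ds 2 i v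

/-- Here `o` is the first cell not yet filled, so `o - 1` entries precede it. When the list is
exhausted the input has length `o - 1`, and the unary length mark occupies the places `i ≤ 0` with
`i + o ≥ 2`. The mark is therefore determined only at the end of the recursion. -/
theorem blockCell_iff {ds : List (HF ℝ)} {as : List (List ℝ)}
    (h : List.Forall₂ (fun d a => triples d = listCode a) ds as) (o : ℕ) (ho : 1 ≤ o) (i : ℤ)
    (v : ℝ) : BlockCell ds o i v ↔
      ((o : ℤ) ≤ i ∧ v = (as.flatMap fun a => (a.length : ℝ) :: a).getD (i - o).toNat 0) ∨
      (i ≤ 0 ∧ v = if 2 ≤ i + o + (as.flatMap fun a => (a.length : ℝ) :: a).length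
        then 1 else 0) := by
  induction h generalizing o with
  | nil =>
    have h₁ : ((o : ℝ) ≤ i) ↔ (o : ℤ) ≤ i := by exact_mod_cast Iff.rfl
    have h₂ : ((i : ℝ) ≤ 0) ↔ i ≤ 0 := by exact_mod_cast Iff.rfl
    have h₃ : ((2 : ℝ) ≤ i + o) ↔ 2 ≤ i + o := by exact_mod_cast Iff.rfl
    have h₄ : ((i : ℝ) + o ≤ 1) ↔ i + o ≤ 1 := by exact_mod_cast Iff.rfl
    rw [BlockCell, h₁, h₂, h₃, h₄]
    simp only [List.flatMap_nil, List.getD_nil, List.length_nil, Nat.cast_zero, add_zero]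
    refine or_congr Iff.rfl (and_congr_right fun _ => ?_)
    split_ifs with h
    · simp [h, show ¬ i + (o : ℤ) ≤ 1 by omega]
    · simp [h, show i + (o : ℤ) ≤ 1 by omega]
  | @cons d a ds as hd _ ih =>
    have h₁ : ((0 : ℝ), (i : ℝ) - o, v) ∈ listCode a ↔ (o : ℤ) ≤ i ∧ i ≤ o + a.length ∧
        v = ((a.length : ℝ) :: a).getD (i - o).toNat 0 := by
      constructor
      · rintro ⟨m, hm, e⟩
        simp only [Prod.mk.injEq, true_and] at e
        obtain ⟨e, rfl⟩ := e
        have e' : i - o = m := by exact_mod_cast e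
        exact ⟨by omega, by omega, by rw [e', Int.toNat_natCast]⟩
      · rintro ⟨h₁, h₂, rfl⟩
        refine ⟨(i - o).toNat, by omega, ?_⟩
        simp only [Prod.mk.injEq, true_and, and_true]
        have : (((i - o).toNat : ℤ) : ℝ) = ((i - o : ℤ) : ℝ) := by
          rw [Int.toNat_of_nonneg (by omega)]
        push_cast at this
        exact this.symm
    have h₂ := ih (o + a.length + 1) (by omega)
    push_cast at h₂
    rw [BlockCell, hd]
    simp only [mem_listCode_zero, exists_eq_left, h₁, h₂]
    set F := as.flatMap fun a => (a.length : ℝ) :: a with hF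
    have hFa : (a :: as).flatMap (fun a => (a.length : ℝ) :: a) = ((a.length : ℝ) :: a) ++ F := rfl
    rw [hFa]
    have hl : (((a.length : ℝ) :: a) ++ F).length = a.length + 1 + F.length := by
      simp only [List.length_append, List.length_cons]
    rw [hl]
    rcases lt_or_ge i o with hi | hi
    · simp only [show ¬ (o : ℤ) ≤ i by omega, show ¬ (o : ℤ) + a.length + 1 ≤ i by omega, false_and,
        false_or]
      refine and_congr_right fun _ => ?_
      push_cast
      simp only [← add_assoc]
    · simp only [hi, show ¬ i ≤ 0 by omega, false_and, or_false, true_and]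
      rcases le_or_gt i (o + a.length) with hi' | hi'
      · simp only [hi', show ¬ (o : ℤ) + a.length + 1 ≤ i by omega, false_and, or_false, true_and]
        rw [List.getD_append _ _ _ _ (by simp; omega)]
      · simp only [show ¬ i ≤ o + a.length by omega, show (o : ℤ) + a.length + 1 ≤ i by omega,
          false_and, false_or, true_and]
        rw [List.getD_append_right _ _ _ _ (by simp; omega)]
        congr! 2
        simp only [List.length_cons]
        omega

theorem initCell_iff (c : ℕ) {ds : List (HF ℝ)} {as : List (List ℝ)}
    (h : List.Forall₂ (fun d a => triples d = listCode a) ds as) (i : ℤ) (v : ℝ) :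
    InitCell c ds i v ↔ v = inputTape (atomCode c as) i := by
  have h₁ := blockCell_iff h 2 (by omega) i v
  have h₂ : ((i : ℝ) = 1) ↔ i = 1 := by exact_mod_cast Iff.rfl
  push_cast at h₁
  rw [InitCell, h₁, h₂, inputTape_apply, atomCode]
  set F := as.flatMap fun a => (a.length : ℝ) :: a with hF
  rcases lt_trichotomy i 1 with hi | rfl | hi
  · simp only [show ¬ i = 1 by omega, show ¬ 2 ≤ i by omega, show i ≤ 0 by omega, false_and,
      false_or, true_and, show ¬ 0 < i by omega, if_false]
    rw [List.length_cons]
    push_cast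
    simp only [show (-((F.length : ℤ) + 1) < i) ↔ 2 ≤ i + 2 + F.length by omega]
  · simp
  · simp only [show ¬ i = 1 by omega, show 2 ≤ i by omega, show ¬ i ≤ 0 by omega, false_and,
      false_or, or_false, true_and, show 0 < i by omega, if_true]
    rw [show (i - 1).toNat = (i - 2).toNat + 1 by omega, List.getD_cons_succ]

section Definability

variable {α E : Type} {Γ : Ctx α E}

theorem sdef_isListCode {d : E → HF ℝ} (hd : Var Γ d) : SDef Γ fun e => IsListCode (d e) := by
  refine .exR ((sdef_mem_triples hd.s .zero .zero .z).and (sdef_forall_triples hd.s ?_))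
  refine (RDef.z.s.s.eq .zero).and (.and (.or ((RDef.z.s.eq .zero).and (RDef.z.eq RDef.z.s.s.s))
    ((RDef.one.le RDef.z.s).and ((RDef.z.s.le RDef.z.s.s.s).and (.exR ?_)))) (.and
      ((RDef.z.s.eq RDef.z.s.s.s).or (.exR ?_)) (sdef_forall_triples hd.s.s.s.s ?_)))
  · exact sdef_mem_triples hd.s.s.s.s.s .zero (RDef.z.s.s.sub .one) .z
  · exact sdef_mem_triples hd.s.s.s.s.s .zero (RDef.z.s.s.add .one) .z
  · exact (RDef.z.s.s.s.s.ne RDef.z.s).or (RDef.z.s.s.s.eq .z)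

theorem sdef_blockCell {ι : Type} (l : List ι) {Γ : Ctx α E} {g : ι → E → HF ℝ}
    (hg : ∀ j, Var Γ (g j)) {o i v : E → ℝ} (ho : RDef Γ o) (hi : RDef Γ i) (hv : RDef Γ v) :
    SDef Γ fun e => BlockCell (l.map fun j => g j e) (o e) (i e) (v e) := by
  induction l generalizing E with
  | nil =>
    exact ((ho.le hi).and (hv.eq .zero)).or ((hi.le .zero).and
      ((((RDef.natCast 2).le (hi.add ho)).and (hv.eq .one)).or
        (((hi.add ho).le .one).and (hv.eq .zero))))
  | cons j l ih =>
    exact .exR ((sdef_mem_triples (hg j).s .zero .zero .z).and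
      ((sdef_mem_triples (hg j).s .zero (hi.s.sub ho.s) hv.s).or
        (ih (fun j => (hg j).s) ((ho.s.add .z).add .one) hi.s hv.s)))

theorem sdef_initCell {ι : Type} (c : ℕ) (l : List ι) {Γ : Ctx α E} {g : ι → E → HF ℝ}
    (hg : ∀ j, Var Γ (g j)) {i v : E → ℝ} (hi : RDef Γ i) (hv : RDef Γ v) :
    SDef Γ fun e => InitCell c (l.map fun j => g j e) (i e) (v e) :=
  ((hi.eq .one).and (hv.eq (.natCast c))).or
    ((sdef_blockCell l hg (.natCast 2) hi hv).congr fun e => by simp)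

end Definability

end BSS

/-! ### Structures with computable copies are `Σ`-definable over `HF(ℝ)` -/

namespace BSS

open HFSets

/-- Each name is preceded by its length, which tells where it ends; so the code can be decoded in
only one way. -/
theorem flatMap_length_cons_injective :
    Function.Injective fun as : List (List ℝ) => as.flatMap fun a => (a.length : ℝ) :: a := by
  intro as bs h
  dsimp only at h
  induction as generalizing bs with
  | nil =>
    cases bs with
    | nil => rfl
    | cons b bs => simp at h
  | cons a as ih =>
    cases bs with
    | nil => simp at h
    | cons b bs =>
      simp only [List.flatMap_cons, List.cons_append, List.cons.injEq, Nat.cast_inj] at h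
      obtain ⟨h₁, h₂⟩ := List.append_inj h.2 h.1
      rw [h₁, ih h₂]

theorem atomCode_inj {c c' : ℕ} {as as' : List (List ℝ)} :
    atomCode c as = atomCode c' as' ↔ c = c' ∧ as = as' := by
  refine ⟨fun h => ?_, fun ⟨h, h'⟩ => by rw [h, h']⟩
  rw [atomCode, atomCode, List.cons.injEq] at h
  exact ⟨by exact_mod_cast h.1, flatMap_length_cons_injective h.2⟩

theorem atomCode_mem_atomicDiagram {L : FirstOrder.Language.{v, w}}
    [Encodable (Σ k, L.Relations k)] {D : Set (List ℝ)} {s : Setoid D} (P : L.Prestructure s)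
    (i : Symb L) (a : Fin i.arity → List ℝ) :
    atomCode i.number (List.ofFn a) ∈ atomicDiagram D s P ↔
      ∃ h : ∀ j, a j ∈ D, i.Holds P fun j => ⟨a j, h j⟩ := by
  rw [atomicDiagram_eq]
  constructor
  · rintro ⟨i', x, hx, h⟩
    obtain ⟨h₁, h₂⟩ := atomCode_inj.1 h
    obtain rfl := Symb.number_injective h₁
    obtain rfl := List.ofFn_injective h₂
    exact ⟨fun j => (x j).2, hx⟩
  · rintro ⟨h, h'⟩
    exact ⟨i, _, h', rfl⟩

/-- The context with a list `c` of real parameters and `k` free variables. -/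
def freeCtx {m : ℕ} (c : Fin m → ℝ) (k : ℕ) : Ctx (Fin m ⊕ Fin k) (Fin k → HF ℝ) :=
  ⟨fun x => Sum.elim (fun j => singleton (c j)) x, 0, fun _ => default⟩

theorem exists_sigmaFormula {m k : ℕ} {c : Fin m → ℝ} {P : (Fin k → HF ℝ) → Prop}
    (h : SDef (freeCtx c k) P) : ∃ F : SigmaFormula ordFieldLang m k,
      ∀ x, x ∈ F.defSet (fun j => singleton (c j)) ↔ P x := by
  obtain ⟨φ, hφ, h'⟩ := h.sig
  exact ⟨⟨φ, hφ⟩, h'⟩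

theorem var_freeCtx {m k : ℕ} (c : Fin m → ℝ) (j : Fin k) : Var (freeCtx c k) fun x => x j :=
  ⟨.inl (.inr j), fun _ => rfl⟩

theorem rdef_freeCtx {m k : ℕ} (c : Fin m → ℝ) (j : Fin m) : RDef (freeCtx c k) fun _ => c j :=
  .var ⟨.inl (.inl j), fun _ => rfl⟩

theorem Machine.exists_consts (T : Machine) : ∃ (m : ℕ) (c : Fin m → ℝ),
    ∀ k, HasConsts (freeCtx c k) T := by
  have := T.finite
  have hfin : (⋃ (q : T.Q), ⋃ p ∈ (T.node q).polys, (pexpr p).consts).Finite :=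
    Set.finite_iUnion fun q => (T.node q).finite_polys.biUnion fun p _ => (pexpr p).finite_consts
  obtain ⟨m, c, -, hc⟩ := hfin.fin_param
  refine ⟨m, c, fun k q p hp r hr => ?_⟩
  have hr' : r ∈ Set.range c := by
    rw [hc]
    exact Set.mem_iUnion.2 ⟨q, Set.mem_biUnion hp hr⟩
  obtain ⟨j, rfl⟩ := hr'
  exact rdef_freeCtx c j

/-- A predicate is defined by "the machine outputs `1` on the code of the atomic sentence" and its
complement by "it outputs `0`". Uniqueness of the output makes the two exclusive and totality makes
them exhaustive. Several hereditarily finite sets may represent one sequence and several sequences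
may name one element; the congruence, pulled back from the equality of names, absorbs both. -/
theorem sigmaDefinable_of_hasRComputableCopy (L : FirstOrder.Language.{v, w}) [L.IsRelational]
    [Encodable (Σ k, L.Relations k)] (N : Type u) [Nonempty N] [L.Structure N]
    (h : HasRComputableCopy L N) : SigmaDefinable ordFieldLang ℝ L N := by
  obtain ⟨D, s, P, ⟨T, hT⟩, ⟨e⟩⟩ := h
  have := T.finite
  obtain ⟨ν, hν⟩ := Countable.exists_injective_nat T.Q
  obtain ⟨m, c, hc⟩ := T.exists_consts
  let p : Fin m → HF ℝ := fun j => singleton (c j)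
  let Acc (i : Symb L) (b : ℕ) (x : Fin i.arity → HF ℝ) : Prop :=
    Accepts T ν (InitCell i.number ((List.finRange i.arity).map x)) b
  let InD (d : HF ℝ) : Prop := ∃ a ∈ D, triples d = listCode a
  have hAcc : ∀ (i : Symb L) (x : Fin i.arity → HF ℝ) (a : Fin i.arity → List ℝ),
      (∀ j, triples (x j) = listCode (a j)) →
      ((Acc i 1 x ↔ atomCode i.number (List.ofFn a) ∈ atomicDiagram D s P) ∧
        (Acc i 0 x ↔ atomCode i.number (List.ofFn a) ∉ atomicDiagram D s P)) := by
    intro i x a hxa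
    have hF : List.Forall₂ (fun d a => triples d = listCode a)
        ((List.finRange i.arity).map x) (List.ofFn a) := by
      rw [List.ofFn_eq_map, List.forall₂_map_left_iff, List.forall₂_map_right_iff,
        List.forall₂_same]
      exact fun j _ => hxa j
    have h₁ := accepts_iff (T := T) hν (initCell_iff i.number hF)
    have hz := hT (atomCode i.number (List.ofFn a))
    have key : ∀ b : ℕ, Acc i b x ↔ T.Computes (atomCode i.number (List.ofFn a)) [(b : ℝ)] :=
      fun b => h₁ b
    rw [key, key]
    by_cases h : atomCode i.number (List.ofFn a) ∈ atomicDiagram D s P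
    · have h₂ := hz.1 h
      refine ⟨⟨fun _ => h, fun _ => by simpa using h₂⟩, ⟨fun h₃ => ?_, fun h₃ => (h₃ h).elim⟩⟩
      have := h₂.unique h₃
      simp at this
    · have h₂ := hz.2 h
      refine ⟨⟨fun h₃ => ?_, fun h₃ => (h h₃).elim⟩, ⟨fun _ => h, fun _ => by simpa using h₂⟩⟩
      have := h₂.unique h₃
      simp at this
  -- A sequence `a` is a name iff the sentence `a = a` belongs to the atomic diagram, so the domain
  -- needs no separate decision procedure.
  have hInD : ∀ d, InD d ↔ IsListCode d ∧ Acc none 1 fun _ => d := by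
    intro d
    rw [isListCode_iff]
    constructor
    · rintro ⟨a, ha, hda⟩
      refine ⟨⟨a, hda⟩, (hAcc none _ (fun _ => a) fun _ => hda).1.2 ?_⟩
      exact (atomCode_mem_atomicDiagram P none _).2 ⟨fun _ => ha, s.refl _⟩
    · rintro ⟨⟨a, hda⟩, h⟩
      obtain ⟨h', -⟩ := (atomCode_mem_atomicDiagram P none _).1
        ((hAcc none _ (fun _ => a) fun _ => hda).1.1 h)
      exact ⟨a, h' (0 : Fin 2), hda⟩
  have sdef_acc : ∀ {k : ℕ} (i : Symb L) (b : ℕ) (g : Fin i.arity → Fin k),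
      SDef (freeCtx c k) fun x => Acc i b fun j => x (g j) := fun {k} i b g =>
    sdef_accepts ν (hc k) (sdef_initCell i.number (List.finRange i.arity)
      (fun j => (var_freeCtx c (g j)).s.s) RDef.z.s .z) b
  have sdef_inD : ∀ {k : ℕ} (j : Fin k), SDef (freeCtx c k) fun x => InD (x j) := fun {k} j =>
    ((sdef_isListCode (var_freeCtx c j)).and (sdef_acc none 1 fun _ => j)).congr
      fun x => (hInD (x j)).symm
  -- Output `0` also occurs on sequences that are not names, so membership of the arguments in the
  -- domain is included in both formulas.
  have hF : ∀ (i : Symb L) (b : ℕ), ∃ F : SigmaFormula ordFieldLang m i.arity, ∀ x,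
      x ∈ F.defSet p ↔ (∀ j, InD (x j)) ∧ Acc i b x := fun i b =>
    exists_sigmaFormula ((SDef.forall_finite fun j => sdef_inD j).and (sdef_acc i b id))
  choose F hF using hF
  obtain ⟨Ψ₀, hΨ₀⟩ := exists_sigmaFormula (sdef_inD (0 : Fin 1))
  choose name hname hname' using fun d : {d | InD d} => d.2
  let nm : {d | InD d} → D := fun d => ⟨name d, hname d⟩
  have hHolds : ∀ (i : Symb L) (x : Fin i.arity → {d | InD d}),
      (i.Holds P (fun j => nm (x j)) ↔ Acc i 1 fun j => (x j).1) ∧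
      (¬ i.Holds P (fun j => nm (x j)) ↔ Acc i 0 fun j => (x j).1) := by
    intro i x
    obtain ⟨h₁, h₂⟩ := hAcc i (fun j => (x j).1) (fun j => name (x j)) fun j => hname' (x j)
    have h₃ : i.Holds P (fun j => nm (x j)) ↔
        atomCode i.number (List.ofFn fun j => name (x j)) ∈ atomicDiagram D s P :=
      (atomCode_mem_atomicDiagram P i _).trans
        ⟨fun ⟨_, h⟩ => h, fun h => ⟨fun j => hname (x j), h⟩⟩ |>.symm
    rw [h₁, h₂, h₃]
    exact ⟨Iff.rfl, Iff.rfl⟩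
  have hcompl : ∀ i : Symb L,
      (F i 0).defSet p = {x | ∀ j, x j ∈ {d | InD d}} \ (F i 1).defSet p := by
    intro i
    ext x
    rw [Set.mem_sdiff, hF, hF]
    constructor
    · rintro ⟨h, h'⟩
      refine ⟨h, fun h'' => ?_⟩
      have := hHolds i fun j => ⟨x j, h j⟩
      exact this.2.2 h' (this.1.2 h''.2)
    · rintro ⟨h, h'⟩
      refine ⟨h, ?_⟩
      have := hHolds i fun j => ⟨x j, h j⟩
      exact this.2.1 fun h'' => h' ⟨h, this.1.1 h''⟩
  have hrel : ∀ (i : Symb L) (x : Fin i.arity → {d | InD d}),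
      i.Holds P (fun j => nm (x j)) ↔ (fun j => (x j).1) ∈ (F i 1).defSet p := by
    intro i x
    rw [(hHolds i x).1, hF]
    exact ⟨fun h => ⟨fun j => (x j).2, h⟩, fun h => h.2⟩
  refine ⟨m, p, Ψ₀, F none 1, F none 0, fun k R => F (some ⟨k, R⟩) 1,
    fun k R => F (some ⟨k, R⟩) 0, {d | InD d}, ?_, ?_, hcompl none, fun k R => hcompl _,
    s.comap nm, comapPrestructure P nm, fun a b => ?_, fun k R x => hrel (some ⟨k, R⟩) x, ?_⟩
  · ext d
    exact (hΨ₀ fun _ => d).symm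
  · obtain ⟨n⟩ := ‹Nonempty N›
    obtain ⟨d, hd⟩ := exists_listCode (e n).out.1
    exact ⟨d, _, (e n).out.2, hd⟩
  · refine (hrel none (![a, b] : Fin 2 → {d | InD d})).trans (iff_of_eq ?_)
    congr 1
    refine funext fun j : Fin 2 => ?_
    fin_cases j <;> rfl
  · let _ := comapPrestructure P nm
    obtain ⟨e'⟩ := nonempty_equiv_quotient (comapPrestructure P nm) P nm (fun _ _ => Iff.rfl)
      (fun a => by
        obtain ⟨d, hd⟩ := exists_listCode a.1
        refine ⟨⟨d, a.1, a.2, hd⟩, ?_⟩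
        have : nm ⟨d, a.1, a.2, hd⟩ = a :=
          Subtype.ext (listCode_injective ((hname' ⟨d, a.1, a.2, hd⟩).symm.trans hd))
        rw [this]) (fun _ _ _ => Iff.rfl)
    exact ⟨e'.symm.comp e⟩

end BSS

/-- The structures (in a countable relational language) that are `Σ`-definable over `HF(ℝ)` are
exactly those with an `ℝ`-computable isomorphic copy. -/
theorem mainTheorem4 (L : FirstOrder.Language.{v, w}) [L.IsRelational]
    [Encodable (Σ k, L.Relations k)] (N : Type u) [Nonempty N] [L.Structure N] :
    HFSets.SigmaDefinable ordFieldLang ℝ L N ↔ BSS.HasRComputableCopy L N :=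
  ⟨BSS.hasRComputableCopy_of_sigmaDefinable L N, BSS.sigmaDefinable_of_hasRComputableCopy L N⟩
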